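/- Let $N$ be a compact oriented smooth 6-manifold without boundary. A 3-form $\rho$ on $N$ is definite if, at every point, $i_v\rho$ has rank $4$ for each non-zero tangent vector $v$. Such a form and the orientation determine an almost complex structure $I_\rho$ on $N$: for $v\neq 0$, let $N_v$ be the null space of $i_v\rho$, of dimension $2$; for non-zero $u\in N_v$ the form $i_u\rho$ induces a symplectic form on $T/N_v$, where $T$ is the tangent space; orient $T/N_v$ so that $(i_u\rho)^2>0$, give $N_v$ the conformal structure defined by $u\mapsto (i_u\rho)^2$ and the orientation for which $N_v\oplus T/N_v$ has the orientation of $T$; then $I_\rho v$ is $v$ rotated by a positive right angle in $N_v$. The definite form $\rho$ is tamed by a 2-form $\Omega$ if $\Omega(v,I_\rho v)>0$ for all $v\ne 0$. A 3-form $\phi$ on an oriented 7-manifold is positive if, at every point, $i_u\phi$ has rank $6$ for each non-zero $u$ and, for a splitting $\mathbb{R}\nu\oplus P$ of the tangent space with induced orientation of $P$, writing $\phi=\omega\wedge dt+\rho$ with $\omega\in\Lambda^2P^*$, $\rho\in\Lambda^3P^*$ and $dt$ dual to $\nu$, the form $\rho$ is definite and $\omega(v,I_\rho v)>0$ for all non-zero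 $v\in P$. A closed $G_2$-cobordism from $\rho_0$ to $\rho_1$ on $N\times[0,1]$ is a smooth closed 3-form $\phi$ on $N\times[0,1]$, positive for the product orientation, that restricts to $\rho_0$ on $N\times\{0\}$ and to $\rho_1$ on $N\times\{1\}$. Let $\Omega$ be a symplectic form on $N$. Suppose that $\rho_0$ and $\rho_1$ are joined by a continuous path $\rho_t$, $t\in[0,1]$, of smooth closed definite 3-forms on $N$ in a fixed de Rham cohomology class, each tamed by $\Omega$ (continuity meaning that $\rho_t(x)$ is jointly continuous in $(t,x)$). Then: (1) there is a closed $G_2$-cobordism from $\rho_0$ to $\rho_1$ on $N\times[0,1]$; (2) let $S_0,S_1$ be smooth singular 2-cycles in $N$ and $W$ a smooth singular 3-chain in $N\times[0,1]$, all with real coefficients, such that $\partial W=S_1\times\{1\}-S_0\times\{0\}$ and $\int_{S_1}\Omega>0$. Then there is a $\kappa_0\in\mathbb{R}$ such that for every $\kappa\ge\kappa_0$ there is a closed $G_2$-cobordism $\phi$ from $\rho_0$ to $\rho_1$ on $N\times[0,1]$ with $I_W(\phi):=\int_W\phi=\kappa$. (Here singular chains are cubical, modulo degenerate cubes.) -/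

import Mathlib

open Set Filter MeasureTheory Module
open scoped Manifold ContDiff Topology

noncomputable section

/-! ### Linear algebra of 3-forms in dimensions 6 and 7 -/

section LinearAlgebra

variable {V : Type*} [AddCommGroup V] [Module ℝ V]

/-- The rank of a 2-form `β`, i.e. the rank of the linear map `v ↦ i_v β`. -/
def twoFormRank (β : V [⋀^Fin 2]→ₗ[ℝ] ℝ) : ℕ :=
  finrank ℝ (LinearMap.range β.curryLeft)

/-- A 3-form `ρ` on a 6-dimensional space is definite if `i_v ρ` has rank `4` for all `v ≠ 0`. -/
def IsDefiniteSix (ρ : V [⋀^Fin 3]→ₗ[ℝ] ℝ) : Prop :=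
  ∀ v : V, v ≠ 0 → twoFormRank (ρ.curryLeft v) = 4

/-- A 3-form `φ` on a 7-dimensional space is definite if `i_u φ` has rank `6` for all `u ≠ 0`. -/
def IsDefiniteSeven (φ : V [⋀^Fin 3]→ₗ[ℝ] ℝ) : Prop :=
  ∀ u : V, u ≠ 0 → twoFormRank (φ.curryLeft u) = 6

/-- The family `v` is a basis that is positive for the orientation `o`. -/
def IsPosOriented {n : ℕ} (o : Orientation ℝ V (Fin n)) (v : Fin n → V) : Prop :=
  ∃ b : Basis (Fin n) ℝ V, ⇑b = v ∧ b.orientation = o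

/-- The value of the 4-form `α ∧ β` on four vectors, for 2-forms `α` and `β`. -/
def wedgeTwoTwo (α β : V [⋀^Fin 2]→ₗ[ℝ] ℝ) (x : Fin 4 → V) : ℝ :=
  α ![x 0, x 1] * β ![x 2, x 3] - α ![x 0, x 2] * β ![x 1, x 3]
    + α ![x 0, x 3] * β ![x 1, x 2] + α ![x 1, x 2] * β ![x 0, x 3]
    - α ![x 1, x 3] * β ![x 0, x 2] + α ![x 2, x 3] * β ![x 0, x 1]

/-- `w = I_ρ v`, where `I_ρ` is the complex structure that the definite 3-form `ρ` induces on the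
oriented 6-dimensional space `V`, for `v ≠ 0`.  Let `N_v` be the (2-dimensional) null space of
`i_v ρ`.  For nonzero `u ∈ N_v` the form `i_u ρ` descends to a symplectic form on `V / N_v`;
`V / N_v` is oriented by `(i_u ρ)² > 0`, the quadratic map `u ↦ (i_u ρ)²` gives the conformal
structure of `N_v`, and `N_v` is oriented so that `N_v ⊕ V / N_v` has the orientation of `V`.
Then `I_ρ v` is `v` rotated by a positive right angle in `N_v`. -/
def IsComplexImage (o : Orientation ℝ V (Fin 6)) (ρ : V [⋀^Fin 3]→ₗ[ℝ] ℝ) (v w : V) : Prop :=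
  (∀ u : V, ρ ![v, w, u] = 0) ∧
  (∀ x : Fin 4 → V, wedgeTwoTwo (ρ.curryLeft v) (ρ.curryLeft w) x = 0) ∧
  (∀ x : Fin 4 → V, wedgeTwoTwo (ρ.curryLeft w) (ρ.curryLeft w) x
    = wedgeTwoTwo (ρ.curryLeft v) (ρ.curryLeft v) x) ∧
  (∀ x : Fin 4 → V, 0 < wedgeTwoTwo (ρ.curryLeft v) (ρ.curryLeft v) x →
    IsPosOriented o ![v, w, x 0, x 1, x 2, x 3])

/-- `η` is a taming form for the complex structure `I_ρ`: `η (v, I_ρ v) > 0` for all `v ≠ 0`. -/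
def IsTamingForm (o : Orientation ℝ V (Fin 6)) (ρ : V [⋀^Fin 3]→ₗ[ℝ] ℝ)
    (η : V [⋀^Fin 2]→ₗ[ℝ] ℝ) : Prop :=
  ∀ v : V, v ≠ 0 → ∃ w : V, IsComplexImage o ρ v w ∧ 0 < η ![v, w]

/-- A 3-form `φ` on an oriented 7-dimensional space `U` is positive: it is definite and, writing
`U = ℝ ν ⊕ P` and `φ = η ∧ dt + ρ` with `η = (i_ν φ)|_P` and `ρ = φ|_P`, the form `η` is a taming
form for the complex structure defined by `ρ` and the orientation induced on `P`. -/
def IsPositiveForm (o : Orientation ℝ V (Fin 7)) (φ : V [⋀^Fin 3]→ₗ[ℝ] ℝ) : Prop :=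
  IsDefiniteSeven φ ∧
  ∃ (ν : V) (P : Submodule ℝ V) (oP : Orientation ℝ P (Fin 6)),
    ν ≠ 0 ∧ IsCompl (Submodule.span ℝ {ν}) P ∧
    (∀ x : Fin 6 → P, IsPosOriented oP x ↔
      IsPosOriented o (Fin.cons ν (fun i => (x i : V)) : Fin 7 → V)) ∧
    IsDefiniteSix (φ.compLinearMap P.subtype) ∧
    IsTamingForm oP (φ.compLinearMap P.subtype) ((φ.curryLeft ν).compLinearMap P.subtype)

end LinearAlgebra

/-! ### Differential forms and orientations on manifolds (possibly with boundary) -/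

section Forms

variable {E : Type*} [NormedAddCommGroup E] [NormedSpace ℝ E]
  {H : Type*} [TopologicalSpace H] (I : ModelWithCorners ℝ E H)
  (M : Type*) [TopologicalSpace M] [ChartedSpace H M]
  {E' : Type*} [NormedAddCommGroup E'] [NormedSpace ℝ E']
  {H' : Type*} [TopologicalSpace H'] (I' : ModelWithCorners ℝ E' H')
  {M' : Type*} [TopologicalSpace M'] [ChartedSpace H' M']

/-- A (not necessarily smooth) `k`-form on the manifold `M`. -/
abbrev DForm (k : ℕ) : Type _ := ∀ x : M, TangentSpace I x [⋀^Fin k]→L[ℝ] ℝ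

variable {M}

/-- The expression of a form in the chart at `x₀`: its pullback under the inverse chart. -/
def DForm.inChart {k : ℕ} (η : DForm I M k) (x₀ : M) (y : E) : E [⋀^Fin k]→L[ℝ] ℝ :=
  (η ((extChartAt I x₀).symm y)).compContinuousLinearMap
    (mfderivWithin 𝓘(ℝ, E) I (extChartAt I x₀).symm (range I) y)

/-- A form is smooth if its expression in every chart is smooth. -/
def DForm.IsSmooth {k : ℕ} (η : DForm I M k) : Prop :=
  ∀ x₀ : M, ContDiffOn ℝ ∞ (DForm.inChart I η x₀) (extChartAt I x₀).target

/-- The exterior derivative, computed in the chart at the point. -/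
def DForm.d {k : ℕ} (η : DForm I M k) : DForm I M (k + 1) := fun x =>
  (extDerivWithin (DForm.inChart I η x) (range I) (extChartAt I x x)).compContinuousLinearMap
    (mfderiv I 𝓘(ℝ, E) (extChartAt I x) x)

/-- A form is closed if its exterior derivative vanishes. -/
def DForm.IsClosed {k : ℕ} (η : DForm I M k) : Prop := ∀ x : M, DForm.d I η x = 0

/-- The forms `η` and `η'` differ by the exterior derivative of a smooth form. -/
def DForm.Cohomologous {k : ℕ} (η η' : DForm I M (k + 1)) : Prop :=
  ∃ α : DForm I M k, DForm.IsSmooth I α ∧ ∀ x : M, η' x - η x = DForm.d I α x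

/-- The pullback of a form under a map. -/
def DForm.pullback {k : ℕ} (f : M → M') (η : DForm I' M' k) : DForm I M k := fun x =>
  (η (f x)).compContinuousLinearMap (mfderiv I I' f x)

/-- A family of forms, parametrised by `[0, 1]`, that is continuous in the parameter and the point
jointly (in every chart). -/
def DForm.IsContinuousPath {k : ℕ} (ρ : Icc (0 : ℝ) 1 → DForm I M k) : Prop :=
  ∀ x₀ : M, ContinuousOn (fun p : Icc (0 : ℝ) 1 × E => DForm.inChart I (ρ p.1) x₀ p.2)
    (univ ×ˢ (extChartAt I x₀).target)

/-- A symplectic form: a smooth closed nondegenerate 2-form. -/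
def DForm.IsSymplectic (Ω : DForm I M 2) : Prop :=
  DForm.IsSmooth I Ω ∧ DForm.IsClosed I Ω ∧
    ∀ (x : M) (v : TangentSpace I x), (∀ w : TangentSpace I x, Ω x ![v, w] = 0) → v = 0

variable (M)

/-- An orientation of an `n`-dimensional manifold: an orientation of each tangent space which, near
every point `x₀`, corresponds to a fixed orientation of the model space under the chart at `x₀`. -/
structure ManifoldOrientation (n : ℕ) where
  /-- The orientation of the tangent space at a point. -/
  at' : ∀ x : M, Orientation ℝ (TangentSpace I x) (Fin n)
  locally_constant : ∀ x₀ : M, ∃ c : Orientation ℝ E (Fin n), ∀ᶠ x in 𝓝 x₀,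
    ∀ v : Fin n → TangentSpace I x, IsPosOriented (at' x) v ↔
      IsPosOriented c (fun i => (mfderiv I 𝓘(ℝ, E) (extChartAt I x₀) x (v i) : E))

end Forms

/-! ### Smooth singular (cubical) chains with real coefficients -/

section Chains

/-- A singular `k`-cube in `M`: a map from the cube `[0, 1]^k` to `M`. -/
abbrev SingularCube (k : ℕ) (M : Type*) : Type _ := (Fin k → Icc (0 : ℝ) 1) → M

/-- Cubical chains with real coefficients. -/
abbrev CubeChain (k : ℕ) (M : Type*) : Type _ := SingularCube k M →₀ ℝ

variable {M M' : Type*} {k : ℕ}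

/-- A singular cube as a map on `ℝ^k`; only its values on `[0, 1]^k` matter. -/
def SingularCube.extend (σ : SingularCube k M) (x : Fin k → ℝ) : M :=
  σ (fun i => projIcc (0 : ℝ) 1 zero_le_one (x i))

/-- The face of a cube on which the `i`-th coordinate equals `a`. -/
def SingularCube.face (σ : SingularCube (k + 1) M) (i : Fin (k + 1)) (a : Icc (0 : ℝ) 1) :
    SingularCube k M :=
  fun x => σ (i.insertNth a x)

/-- A cube is degenerate if it does not depend on one of its coordinates. -/
def SingularCube.IsDegenerate (σ : SingularCube k M) : Prop :=
  ∃ i : Fin k, ∀ x y : Fin k → Icc (0 : ℝ) 1, (∀ j, j ≠ i → x j = y j) → σ x = σ y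

/-- The boundary `∑ i, (-1)^i (σ|_{x i = 1} - σ|_{x i = 0})`, with `i` counted from `0`. -/
def CubeChain.boundary (c : CubeChain (k + 1) M) : CubeChain k M :=
  c.sum fun σ a => ∑ i : Fin (k + 1), ((-1 : ℝ) ^ (i : ℕ) * a) •
    (Finsupp.single (SingularCube.face σ i 1) (1 : ℝ) -
      Finsupp.single (SingularCube.face σ i 0) (1 : ℝ))

/-- Equality in the normalised cubical chain complex, i.e. modulo degenerate cubes. -/
def CubeChain.Equiv (c c' : CubeChain k M) : Prop :=
  ∀ σ ∈ (c - c').support, SingularCube.IsDegenerate σ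

/-- A cycle of the normalised cubical chain complex. -/
def CubeChain.IsCycle (c : CubeChain (k + 1) M) : Prop :=
  CubeChain.Equiv (CubeChain.boundary c) 0

/-- The push-forward of a chain under a map. -/
def CubeChain.map (f : M → M') (c : CubeChain k M) : CubeChain k M' :=
  Finsupp.mapDomain (fun σ : SingularCube k M => fun x => f (σ x)) c

variable {E : Type*} [NormedAddCommGroup E] [NormedSpace ℝ E]
  {H : Type*} [TopologicalSpace H] (I : ModelWithCorners ℝ E H)
  [TopologicalSpace M] [ChartedSpace H M]

/-- A chain is smooth if each of its cubes is smooth on the closed cube `[0, 1]^k`. -/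
def CubeChain.IsSmooth (c : CubeChain k M) : Prop :=
  ∀ σ ∈ c.support, ContMDiffOn 𝓘(ℝ, Fin k → ℝ) I ∞ (SingularCube.extend σ) (Icc 0 1)

/-- The integral of a `k`-form over a singular `k`-cube. -/
def SingularCube.integral (φ : DForm I M k) (σ : SingularCube k M) : ℝ :=
  ∫ x in Icc (0 : Fin k → ℝ) 1, φ (SingularCube.extend σ x)
    (fun i => mfderivWithin 𝓘(ℝ, Fin k → ℝ) I (SingularCube.extend σ) (Icc 0 1) x
      (Pi.single i (1 : ℝ) : Fin k → ℝ))

/-- The integral of a `k`-form over a chain. -/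
def CubeChain.integral (φ : DForm I M k) (c : CubeChain k M) : ℝ :=
  c.sum fun σ a => a * SingularCube.integral I φ σ

end Chains

/-! ### Closed `SL(3, ℂ)`-structures on 6-manifolds and closed `G₂`-cobordisms -/

section Cobordism

variable {N : Type*} [TopologicalSpace N] [ChartedSpace (EuclideanSpace ℝ (Fin 6)) N]

/-- A closed `SL(3, ℂ)`-structure on a 6-manifold: a smooth closed definite 3-form. -/
def IsClosedSL3Structure (ρ : DForm (𝓡 6) N 3) : Prop :=
  DForm.IsSmooth (𝓡 6) ρ ∧ DForm.IsClosed (𝓡 6) ρ ∧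
    ∀ x : N, IsDefiniteSix (ρ x).toAlternatingMap

/-- The definite 3-form `ρ` is tamed by the 2-form `Ω`. -/
def IsTamedBy (o : ManifoldOrientation (𝓡 6) N 6) (ρ : DForm (𝓡 6) N 3)
    (Ω : DForm (𝓡 6) N 2) : Prop :=
  ∀ x : N, IsTamingForm (o.at' x) (ρ x).toAlternatingMap (Ω x).toAlternatingMap

/-- The model with corners of the 7-manifold with boundary `N × [0, 1]`. -/
abbrev cylModel : ModelWithCorners ℝ (EuclideanSpace ℝ (Fin 6) × EuclideanSpace ℝ (Fin 1))
    (ModelProd (EuclideanSpace ℝ (Fin 6)) (EuclideanHalfSpace 1)) :=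
  (𝓡 6).prod (𝓡∂ 1)

/-- The inclusion of `N` into `N × [0, 1]` as the slice `N × {t}`. -/
def slice (t : Icc (0 : ℝ) 1) (x : N) : N × Icc (0 : ℝ) 1 := (x, t)

/-- The coordinate vector field `∂/∂t` on `N × [0, 1]`. -/
def timeVector (p : N × Icc (0 : ℝ) 1) : TangentSpace cylModel p :=
  mfderiv (𝓡∂ 1) cylModel (fun s : Icc (0 : ℝ) 1 => (p.1, s)) p.2 (oneTangentSpaceIcc p.2)

/-- The product orientation of `N × [0, 1]`: if `v` is a positive basis of the tangent space of
`N`, then `(∂/∂t, v)` is positive (equivalently `(v, ∂/∂t)`, as `N` has even dimension). -/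
def IsProductOrientation (o : ManifoldOrientation (𝓡 6) N 6)
    (oM : ManifoldOrientation cylModel (N × Icc (0 : ℝ) 1) 7) : Prop :=
  ∀ (p : N × Icc (0 : ℝ) 1) (v : Fin 6 → TangentSpace (𝓡 6) p.1), IsPosOriented (o.at' p.1) v →
    IsPosOriented (oM.at' p) (Fin.cons (timeVector p)
      (fun i => mfderiv (𝓡 6) cylModel (slice p.2) p.1 (v i)) : Fin 7 → TangentSpace cylModel p)

/-- `φ` is a closed `G₂`-cobordism from `(N, ρ₀)` to `(N, ρ₁)` on the product `N × [0, 1]`: a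
smooth closed 3-form, positive for the product orientation, restricting to `ρ₀` on `N × {0}` and to
`ρ₁` on `N × {1}`. -/
def IsClosedG2Cobordism (o : ManifoldOrientation (𝓡 6) N 6) (ρ₀ ρ₁ : DForm (𝓡 6) N 3)
    (φ : DForm cylModel (N × Icc (0 : ℝ) 1) 3) : Prop :=
  DForm.IsSmooth cylModel φ ∧ DForm.IsClosed cylModel φ ∧
  (∃ oM : ManifoldOrientation cylModel (N × Icc (0 : ℝ) 1) 7,
    IsProductOrientation o oM ∧ ∀ p, IsPositiveForm (oM.at' p) (φ p).toAlternatingMap) ∧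
  DForm.pullback (𝓡 6) cylModel (slice 0) φ = ρ₀ ∧
  DForm.pullback (𝓡 6) cylModel (slice 1) φ = ρ₁

end Cobordism

end

/-! A 3-form on $N\times[0,1]$ is sought in the shape $\phi=\rho_t+dt\wedge\beta_t$ with forms
$\rho_t,\beta_t$ on $N$. It is closed as soon as each $\rho_t$ is closed and
$\partial_t\rho_t=d\beta_t$; it is positive if each $\rho_t$ is definite and tamed by $\beta_t$.
Both properties survive adding $K\,dt\wedge\Omega$ for $K\ge 0$: this form is closed, vanishes on
slices, and changes $\beta_t$ by $K\Omega$, which tames $\rho_t$. A large $K$ even creates tameness: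
$K\Omega+\beta_t=K(\Omega+K^{-1}\beta_t)$ tames $\rho_t$ because tameness is open and $N\times[0,1]$
is compact (`exists_forall_isTamedPair_smul_add`).

The given path is only continuous in $t$, so it is replaced by a smooth one. By openness and
compactness there is a $\delta$ such that every convex combination of two members at times closer
than $\delta$ is still tamed by $\Omega$ (`exists_forall_convexCombination_isTamedPair`). Take
$\sigma_i=\rho_{i/n}$ with $1/n<\delta$, primitives $\sigma_{i+1}-\sigma_i=da_i$, and smooth cutoffs
$s_i$ rising from $0$ to $1$ on $[i/n,(i+1)/n]$. Then $\sigma_0+\sum s_i(t)\,da_i$ is a smooth path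
of tamed closed forms and $\beta_t=\sum s_i'(t)\,a_i$ satisfies the equation above (`d_stepForm`,
`exists_stepForm_isClosedG2Cobordism`).

For the periods, $dt\wedge\Omega=d(t\,\Omega)$, so Stokes gives $\int_W
dt\wedge\Omega=\int_{S_1}\Omega>0$ (`integral_cylFormWedge_one`). Hence $\int_W\phi$ is an
increasing affine function of $K$ and takes every sufficiently large value.

Openness is the point of the linear algebra. Tameness is defined through $I_\rho$, which is awkward
to vary; `IsTamedPair` replaces it by two conditions polynomial in the forms and in $v$:
$(i_v\rho)^2\ne 0$, and a fixed sign of the 6-form $i_v\eta\wedge i_v\rho\wedge\rho$. The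
equivalence rests on `tamingSixForm_of_null`. -/

section AlternatingAlgebra

variable {V : Type*} [AddCommGroup V] [Module ℝ V]

/-! ### Wedge products of alternating forms in low degree -/

namespace AlternatingMap

section Two

variable (β : V [⋀^Fin 2]→ₗ[ℝ] ℝ) (a a' b b' : V) (r : ℝ)

lemma two_add_left : β ![a + a', b] = β ![a, b] + β ![a', b] := β.map_vecCons_add _ _ _

lemma two_smul_left : β ![r • a, b] = r * β ![a, b] := β.map_vecCons_smul _ _ _

lemma two_self : β ![a, a] = 0 := β.map_eq_zero_of_eq _ (i := 0) (j := 1) rfl (by decide)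

lemma two_swap : β ![a, b] = -β ![b, a] := by
  have h := β.map_swap ![b, a] (i := 0) (j := 1) (by decide)
  rw [← h]
  congr 1
  ext i
  fin_cases i <;> rfl

lemma two_add_right : β ![a, b + b'] = β ![a, b] + β ![a, b'] := by
  rw [β.two_swap, β.two_add_left, β.two_swap b, β.two_swap b']; ring

lemma two_smul_right : β ![a, r • b] = r * β ![a, b] := by
  rw [β.two_swap, β.two_smul_left, β.two_swap b]; ring

lemma two_zero_right : β ![a, 0] = 0 := by simpa using β.two_smul_right a 0 0

lemma two_zero_left : β ![0, a] = 0 := by simpa using β.two_smul_left 0 a 0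

lemma two_neg_right : β ![a, -b] = -β ![a, b] := by simpa using β.two_smul_right a b (-1)

lemma two_neg_left : β ![-a, b] = -β ![a, b] := by simpa using β.two_smul_left a b (-1)

end Two

section Three

variable (γ : V [⋀^Fin 3]→ₗ[ℝ] ℝ) (a a' b b' c c' : V) (r : ℝ)

lemma curryLeft_two : γ.curryLeft a ![b, c] = γ ![a, b, c] := rfl

lemma three_add_fst : γ ![a + a', b, c] = γ ![a, b, c] + γ ![a', b, c] := γ.map_vecCons_add _ _ _

lemma three_smul_fst : γ ![r • a, b, c] = r * γ ![a, b, c] := γ.map_vecCons_smul _ _ _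

lemma three_swap_right : γ ![a, b, c] = -γ ![a, c, b] := (γ.curryLeft a).two_swap b c

lemma three_swap_left : γ ![a, b, c] = -γ ![b, a, c] := by
  have h := γ.map_swap ![b, a, c] (i := 0) (j := 1) (by decide)
  rw [← h]
  congr 1
  ext i
  fin_cases i <;> rfl

lemma three_self_left : γ ![a, a, c] = 0 := γ.map_eq_zero_of_eq _ (i := 0) (j := 1) rfl (by decide)

lemma three_self_right : γ ![a, c, c] = 0 := (γ.curryLeft a).two_self c

lemma three_self_outer : γ ![a, c, a] = 0 := by rw [three_swap_right, three_self_left, neg_zero]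

lemma three_add_snd : γ ![a, b + b', c] = γ ![a, b, c] + γ ![a, b', c] :=
  (γ.curryLeft a).two_add_left _ _ _

lemma three_add_thd : γ ![a, b, c + c'] = γ ![a, b, c] + γ ![a, b, c'] :=
  (γ.curryLeft a).two_add_right _ _ _

lemma three_smul_snd : γ ![a, r • b, c] = r * γ ![a, b, c] :=
  (γ.curryLeft a).two_smul_left _ _ _

lemma three_smul_thd : γ ![a, b, r • c] = r * γ ![a, b, c] :=
  (γ.curryLeft a).two_smul_right _ _ _

end Three

/-- The value of the 5-form `β ∧ γ` on five vectors, for a 2-form `β` and a 3-form `γ`. -/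
def wedgeTwoThreeFun (β : V [⋀^Fin 2]→ₗ[ℝ] ℝ) (γ : V [⋀^Fin 3]→ₗ[ℝ] ℝ) (y : Fin 5 → V) : ℝ :=
  β ![y 0, y 1] * γ ![y 2, y 3, y 4] - β ![y 0, y 2] * γ ![y 1, y 3, y 4]
    + β ![y 0, y 3] * γ ![y 1, y 2, y 4] - β ![y 0, y 4] * γ ![y 1, y 2, y 3]
    + β ![y 1, y 2] * γ ![y 0, y 3, y 4] - β ![y 1, y 3] * γ ![y 0, y 2, y 4]
    + β ![y 1, y 4] * γ ![y 0, y 2, y 3] + β ![y 2, y 3] * γ ![y 0, y 1, y 4]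
    - β ![y 2, y 4] * γ ![y 0, y 1, y 3] + β ![y 3, y 4] * γ ![y 0, y 1, y 2]

/-- The 5-form `β ∧ γ`, for a 2-form `β` and a 3-form `γ`. -/
def wedgeTwoThree (β : V [⋀^Fin 2]→ₗ[ℝ] ℝ) (γ : V [⋀^Fin 3]→ₗ[ℝ] ℝ) : V [⋀^Fin 5]→ₗ[ℝ] ℝ where
  toFun := wedgeTwoThreeFun β γ
  map_update_add' := by
    intro inst y i u w
    obtain rfl : inst = instDecidableEqFin 5 := Subsingleton.elim _ _
    unfold wedgeTwoThreeFun
    fin_cases i <;> simp [two_add_left, two_add_right, three_add_fst,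
      three_add_snd, three_add_thd] <;> ring
  map_update_smul' := by
    intro inst y i u w
    obtain rfl : inst = instDecidableEqFin 5 := Subsingleton.elim _ _
    unfold wedgeTwoThreeFun
    fin_cases i <;> simp [two_smul_left, two_smul_right, three_smul_fst,
      three_smul_snd, three_smul_thd] <;> ring
  map_eq_zero_of_eq' := by
    intro y i j h hij
    have key : ∀ i j : Fin 5, i < j → y i = y j → wedgeTwoThreeFun β γ y = 0 := by
      intro i j hij h
      have s2 := fun a b => β.two_swap (y a) (y b)
      have s3 := fun a b c => γ.three_swap_left (y a) (y b) (y c)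
      have s3' := fun a b c => γ.three_swap_right (y a) (y b) (y c)
      unfold wedgeTwoThreeFun
      fin_cases i <;> fin_cases j <;> first
        | exact absurd hij (by decide)
        | (simp only [Fin.zero_eta, Fin.mk_one, Fin.reduceFinMk] at h
           simp only [h, two_self, three_self_left, three_self_right, three_self_outer]
           grind)
    rcases lt_or_gt_of_ne hij with hl | hl
    · exact key i j hl h
    · exact key j i hl h.symm

lemma wedgeTwoThree_apply (β : V [⋀^Fin 2]→ₗ[ℝ] ℝ) (γ : V [⋀^Fin 3]→ₗ[ℝ] ℝ) (y : Fin 5 → V) :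
    wedgeTwoThree β γ y = wedgeTwoThreeFun β γ y := rfl

/-- The `(k + 1)`-form `α ∧ β`, for a 1-form `α` and a `k`-form `β`. -/
def oneWedge {k : ℕ} (α : V →ₗ[ℝ] ℝ) (β : V [⋀^Fin k]→ₗ[ℝ] ℝ) : V [⋀^Fin (k + 1)]→ₗ[ℝ] ℝ :=
  alternatizeUncurryFin (α.smulRight β)

lemma oneWedge_apply {k : ℕ} (α : V →ₗ[ℝ] ℝ) (β : V [⋀^Fin k]→ₗ[ℝ] ℝ) (y : Fin (k + 1) → V) :
    oneWedge α β y = ∑ i : Fin (k + 1), (-1) ^ (i : ℕ) * (α (y i) * β (i.removeNth y)) := by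
  simp [oneWedge, alternatizeUncurryFin_apply]

lemma oneWedge_six (α : V →ₗ[ℝ] ℝ) (B : V [⋀^Fin 5]→ₗ[ℝ] ℝ) (a b c d e f : V) :
    oneWedge α B ![a, b, c, d, e, f] =
      α a * B ![b, c, d, e, f] - α b * B ![a, c, d, e, f] + α c * B ![a, b, d, e,
          f] - α d * B ![a, b, c, e, f]
        + α e * B ![a, b, c, d, f] - α f * B ![a, b, c, d, e] := by
  have h0 : Fin.removeNth 0 ![a, b, c, d, e, f] = ![b, c, d, e, f] := by
    ext i; fin_cases i <;> rfl
  have h1 : Fin.removeNth 1 ![a, b, c, d, e, f] = ![a, c, d, e, f] := by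
    ext i; fin_cases i <;> rfl
  have h2 : Fin.removeNth 2 ![a, b, c, d, e, f] = ![a, b, d, e, f] := by
    ext i; fin_cases i <;> rfl
  have h3 : Fin.removeNth 3 ![a, b, c, d, e, f] = ![a, b, c, e, f] := by
    ext i; fin_cases i <;> rfl
  have h4 : Fin.removeNth 4 ![a, b, c, d, e, f] = ![a, b, c, d, f] := by
    ext i; fin_cases i <;> rfl
  have h5 : Fin.removeNth 5 ![a, b, c, d, e, f] = ![a, b, c, d, e] := by
    ext i; fin_cases i <;> rfl
  rw [oneWedge_apply, Fin.sum_univ_six, h0, h1, h2, h3, h4, h5]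
  simp
  ring

end AlternatingMap

open AlternatingMap

/-- The 6-form `α ∧ β ∧ γ` on vectors `p, q` that span a plane in the null space of `β`, with
`γ (p, q, ·) = 0`. -/
lemma oneWedge_wedgeTwoThree_of_null (α : V →ₗ[ℝ] ℝ) (β : V [⋀^Fin 2]→ₗ[ℝ] ℝ)
    (γ : V [⋀^Fin 3]→ₗ[ℝ] ℝ) {p q : V} (hp : ∀ u, β ![p, u] = 0) (hq : ∀ u, β ![q, u] = 0)
    (hγ : ∀ u, γ ![p, q, u] = 0) (x : Fin 4 → V) :
    oneWedge α (wedgeTwoThree β γ) ![p, q, x 0, x 1, x 2, x 3] =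
      α p * wedgeTwoTwo β (γ.curryLeft q) x - α q * wedgeTwoTwo β (γ.curryLeft p) x := by
  rw [oneWedge_six]
  simp only [wedgeTwoThree_apply, wedgeTwoThreeFun, wedgeTwoTwo, curryLeft_two, hp, hq, hγ,
    Matrix.cons_val]
  ring

end AlternatingAlgebra

/-! ### Orientations, and the rank of a 2-form read off from its square -/

section Criterion

variable {V : Type*} [AddCommGroup V] [Module ℝ V]

open AlternatingMap

lemma isPosOriented_basis_iff {n : ℕ} (b : Basis (Fin n) ℝ V) (y : Fin n → V) :
    IsPosOriented b.orientation y ↔ 0 < b.det y := by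
  constructor
  · rintro ⟨b', rfl, h⟩
    exact (b.orientation_eq_iff_det_pos b').1 h.symm
  · intro h
    obtain ⟨hl, hs⟩ := (Basis.is_basis_iff_det b).2 (isUnit_iff_ne_zero.2 h.ne')
    refine ⟨Basis.mk hl hs.ge, Basis.coe_mk _ _, ?_⟩
    rw [eq_comm, b.orientation_eq_iff_det_pos, Basis.coe_mk]
    exact h

lemma exists_basis_orientation_eq {n : ℕ} [NeZero n] (h : finrank ℝ V = n)
    (o : Orientation ℝ V (Fin n)) : ∃ b : Basis (Fin n) ℝ V, b.orientation = o :=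
  have : Module.Finite ℝ V := Module.finite_of_finrank_pos (h ▸ Nat.pos_of_ne_zero (NeZero.ne n))
  ⟨o.someBasis (by simp [h]), o.someBasis_orientation _⟩

lemma AlternatingMap.apply_eq_mul_det {n : ℕ} (b : Basis (Fin n) ℝ V) (f : V [⋀^Fin n]→ₗ[ℝ] ℝ)
    (y : Fin n → V) : f y = f b * b.det y := by
  conv_lhs => rw [f.eq_smul_basis_det b]
  simp

/-- The 1-form `i_v η`. -/
def AlternatingMap.contract (η : V [⋀^Fin 2]→ₗ[ℝ] ℝ) (v : V) : V →ₗ[ℝ] ℝ where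
  toFun u := η ![v, u]
  map_add' := η.two_add_right v
  map_smul' r u := η.two_smul_right v u r

@[simp] lemma AlternatingMap.contract_apply (η : V [⋀^Fin 2]→ₗ[ℝ] ℝ) (v u : V) :
    η.contract v u = η ![v, u] := rfl

lemma AlternatingMap.curryLeft_eq_zero_iff (β : V [⋀^Fin 2]→ₗ[ℝ] ℝ) (z : V) :
    β.curryLeft z = 0 ↔ ∀ u, β ![z, u] = 0 := by
  constructor
  · intro h u
    exact congrArg (fun f : V [⋀^Fin 1]→ₗ[ℝ] ℝ => f ![u]) h
  · intro h
    ext u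
    have hu : Matrix.vecCons z u = ![z, u 0] := by
      ext i; fin_cases i <;> rfl
    rw [curryLeft_apply_apply, hu, h, AlternatingMap.zero_apply]

/-- If $\beta\wedge\beta=0$, the Plücker relations hold and make $\beta$ decomposable, so its rank
would be at most $2$. -/
lemma exists_wedgeTwoTwo_ne_zero_of_rank {β : V [⋀^Fin 2]→ₗ[ℝ] ℝ} (h : twoFormRank β = 4) :
    ∃ x, wedgeTwoTwo β β x ≠ 0 := by
  by_contra! hx
  have hpf : ∀ a b c d, β ![a, b] * β ![c, d] - β ![a, c] * β ![b, d]
      + β ![a, d] * β ![b, c] = 0 := by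
    intro a b c d
    have h2 : wedgeTwoTwo β β ![a, b, c, d] = 2 * (β ![a, b] * β ![c, d]
        - β ![a, c] * β ![b, d] + β ![a, d] * β ![b, c]) := by
      simp only [wedgeTwoTwo, Matrix.cons_val]
      ring
    linarith [hx ![a, b, c, d]]
  by_cases h0 : ∀ a b, β ![a, b] = 0
  · have : β.curryLeft = 0 := LinearMap.ext fun z => (β.curryLeft_eq_zero_iff z).2 (h0 z)
    have h2 : twoFormRank β = 0 := by
      rw [twoFormRank, this, LinearMap.range_zero]
      exact finrank_bot ℝ _
    omega
  · push Not at h0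
    obtain ⟨a, b, hab⟩ := h0
    have hle : LinearMap.range β.curryLeft ≤
        Submodule.span ℝ (Set.range ![β.curryLeft a, β.curryLeft b]) := by
      rintro _ ⟨c, rfl⟩
      -- When $\beta(a,b)\neq 0$, the relation `hpf a b c d`, read as an identity in $d$, expresses
      -- $i_c\beta$ through $i_a\beta$ and $i_b\beta$.
      have hc : β.curryLeft c =
          (-(β ![b, c] / β ![a, b])) • β.curryLeft a + (β ![a, c] / β ![a, b]) • β.curryLeft b := by
        have : β.curryLeft (c - ((-(β ![b, c] / β ![a, b])) • a
            + (β ![a, c] / β ![a, b]) • b)) = 0 := by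
          rw [curryLeft_eq_zero_iff]
          intro d
          rw [sub_eq_add_neg, two_add_left, two_neg_left, two_add_left, two_smul_left,
            two_smul_left]
          field_simp
          linear_combination hpf a b c d
        rw [map_sub, sub_eq_zero] at this
        rw [this, map_add, map_smul, map_smul]
      rw [hc]
      refine add_mem (Submodule.smul_mem _ _ (Submodule.subset_span ⟨0, rfl⟩))
        (Submodule.smul_mem _ _ (Submodule.subset_span ⟨1, rfl⟩))
    have hfin : Module.Finite ℝ (Submodule.span ℝ (Set.range ![β.curryLeft a, β.curryLeft b])) :=
      Module.Finite.span_of_finite ℝ (Set.finite_range _)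
    have h1 := Submodule.finrank_mono hle
    have h2 := finrank_range_le_card (R := ℝ) ![β.curryLeft a, β.curryLeft b]
    rw [Set.finrank] at h2
    simp only [Fintype.card_fin] at h2
    unfold twoFormRank at h
    omega

/-- The $x_i$ span a 4-space on which $\beta$ is nondegenerate, and its $\beta$-orthogonal `ker L`
is a plane containing $v$. A skew form on a plane with a nonzero null vector is zero, so this plane
is the whole kernel of $\beta$. -/
lemma twoFormRank_eq_four (hV : finrank ℝ V = 6) {β : V [⋀^Fin 2]→ₗ[ℝ] ℝ} {v : V} (hv : v ≠ 0)
    (hβ : ∀ u, β ![v, u] = 0) {x : Fin 4 → V} (hx : wedgeTwoTwo β β x ≠ 0) :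
    twoFormRank β = 4 := by
  have : Module.Finite ℝ V := Module.finite_of_finrank_pos (by omega)
  set L : V →ₗ[ℝ] Fin 4 → ℝ := LinearMap.pi fun i => β.contract (x i) with hL
  have hLx : ∀ z i, L z i = β ![x i, z] := fun z i => rfl
  obtain ⟨P, hP⟩ : ∃ P, P = β ![x 0, x 1] * β ![x 2, x 3] - β ![x 0, x 2] * β ![x 1, x 3]
      + β ![x 0, x 3] * β ![x 1, x 2] := ⟨_, rfl⟩
  have hP0 : P ≠ 0 := by
    intro h0
    apply hx
    rw [wedgeTwoTwo]
    linear_combination -2 * hP + 2 * h0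
  have hsurj : ∀ g : Fin 4 → ℝ, ∃ c : Fin 4 → ℝ,
      L (c 0 • x 0 + c 1 • x 1 + c 2 • x 2 + c 3 • x 3) = g := by
    intro g
    -- The inverse of the skew $4\times4$ matrix $(\beta(x_i,x_j))$, whose common denominator is its
    -- Pfaffian $P$.
    refine ⟨![(-β ![x 2, x 3] * g 1 + β ![x 1, x 3] * g 2 - β ![x 1, x 2] * g 3) / P,
      (β ![x 2, x 3] * g 0 - β ![x 0, x 3] * g 2 + β ![x 0, x 2] * g 3) / P,
      (-β ![x 1, x 3] * g 0 + β ![x 0, x 3] * g 1 - β ![x 0, x 1] * g 3) / P,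
      (β ![x 1, x 2] * g 0 - β ![x 0, x 2] * g 1 + β ![x 0, x 1] * g 2) / P], ?_⟩
    ext i
    rw [hLx]
    simp only [two_add_right, two_smul_right, Matrix.cons_val]
    have s2 := fun a b => β.two_swap (x a) (x b)
    fin_cases i <;> simp only [Fin.zero_eta, Fin.mk_one, Fin.reduceFinMk, two_self,
      s2 1 0, s2 2 0, s2 3 0, s2 2 1, s2 3 1, s2 3 2] <;> field_simp <;> rw [hP] <;> ring
  have hker : finrank ℝ (LinearMap.ker L) = 2 := by
    have h1 := L.finrank_range_add_finrank_ker
    rw [LinearMap.range_eq_top.2 fun g => (hsurj g).imp' _ fun c hc => hc, finrank_top, hV] at h1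
    simp at h1
    omega
  have hK : LinearMap.ker β.curryLeft = LinearMap.ker L := by
    apply le_antisymm
    · intro z hz
      rw [LinearMap.mem_ker, curryLeft_eq_zero_iff] at hz
      rw [LinearMap.mem_ker]
      ext i
      rw [hLx, two_swap, hz]
      simp
    · intro u hu
      rw [LinearMap.mem_ker] at hu
      have hu' : ∀ i, β ![u, x i] = 0 := fun i => by
        rw [two_swap, ← hLx, hu]; simp
      rw [LinearMap.mem_ker, curryLeft_eq_zero_iff]
      by_contra! hy
      obtain ⟨y, hy⟩ := hy
      obtain ⟨c, hc⟩ := hsurj (L y)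
      -- Projecting $y$ to `ker L` leaves $\beta(u,y)$ unchanged up to terms $\beta(u,x_i)=0$. Then
      -- $v,u,y'$ would be three independent vectors in a plane.
      set y' := y - (c 0 • x 0 + c 1 • x 1 + c 2 • x 2 + c 3 • x 3) with hy'
      have hLy' : L y' = 0 := by rw [hy', map_sub, hc, sub_self]
      have huy : β ![u, y'] ≠ 0 := by
        rw [hy', sub_eq_add_neg, two_add_right, two_neg_right]
        simp only [two_add_right, two_smul_right, hu']
        simpa using hy
      have hli : LinearIndependent ℝ (![⟨v, by
          rw [LinearMap.mem_ker]; ext i; rw [hLx, two_swap, hβ]; simp⟩, ⟨u, hu⟩, ⟨y', hLy'⟩] :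
          Fin 3 → LinearMap.ker L) := by
        rw [Fintype.linearIndependent_iff]
        intro g hg
        have hg' := congrArg Subtype.val hg
        simp only [Fin.sum_univ_three, Matrix.cons_val, Submodule.coe_add, Submodule.coe_smul,
          Submodule.coe_zero] at hg'
        have h2 : g 2 = 0 := by
          have := congrArg (fun z => β ![u, z]) hg'
          simpa [two_add_right, two_smul_right, two_self, two_swap β u v, hβ, huy,
            two_zero_right] using this
        have h1 : g 1 = 0 := by
          have := congrArg (fun z => β ![z, y']) hg'
          simpa [two_add_left, two_smul_left, two_self, hβ, huy, two_zero_left] using this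
        have h0 : g 0 = 0 := by
          simpa [h1, h2, hv] using hg'
        intro i
        fin_cases i <;> assumption
      have := hli.fintype_card_le_finrank
      simp [hker] at this
  have := β.curryLeft.finrank_range_add_finrank_ker
  rw [hK, hker, hV] at this
  unfold twoFormRank
  omega

end Criterion

/-! ### Tameness as a sign condition on a 6-form -/

section TamedPair

variable {V : Type*} [AddCommGroup V] [Module ℝ V]

open AlternatingMap

/-- The 6-form `i_v η ∧ i_v ρ ∧ ρ`. -/
def tamingSixForm (ρ : V [⋀^Fin 3]→ₗ[ℝ] ℝ) (η : V [⋀^Fin 2]→ₗ[ℝ] ℝ) (v : V) :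
    V [⋀^Fin 6]→ₗ[ℝ] ℝ :=
  oneWedge (η.contract v) (wedgeTwoThree (ρ.curryLeft v) ρ)

/-- A definite 3-form `ρ` together with a taming form `η`, expressed by the nonvanishing of
`(i_v ρ)²` and the sign of the 6-form `i_v η ∧ i_v ρ ∧ ρ` for `v ≠ 0`. -/
def IsTamedPair (o : Orientation ℝ V (Fin 6)) (ρ : V [⋀^Fin 3]→ₗ[ℝ] ℝ)
    (η : V [⋀^Fin 2]→ₗ[ℝ] ℝ) : Prop :=
  ∀ v : V, v ≠ 0 → (∃ x, wedgeTwoTwo (ρ.curryLeft v) (ρ.curryLeft v) x ≠ 0) ∧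
    ∀ y, IsPosOriented o y → tamingSixForm ρ η v y < 0

lemma wedgeTwoTwo_swap (β γ : V [⋀^Fin 2]→ₗ[ℝ] ℝ) (a b c d : V) :
    wedgeTwoTwo β γ ![b, a, c, d] = -wedgeTwoTwo β γ ![a, b, c, d] := by
  simp only [wedgeTwoTwo, Matrix.cons_val, β.two_swap b a, γ.two_swap b a]
  ring

lemma vecFour_eq {X : Type*} (x : Fin 4 → X) : ![x 0, x 1, x 2, x 3] = x := by
  ext i; fin_cases i <;> rfl

lemma exists_wedgeTwoTwo_pos {β γ : V [⋀^Fin 2]→ₗ[ℝ] ℝ} (h : ∃ x, wedgeTwoTwo β γ x ≠ 0) :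
    ∃ x, 0 < wedgeTwoTwo β γ x := by
  obtain ⟨x, hx⟩ := h
  rcases lt_or_gt_of_ne hx with hx | hx
  · refine ⟨![x 1, x 0, x 2, x 3], ?_⟩
    rw [wedgeTwoTwo_swap, vecFour_eq]
    linarith
  · exact ⟨x, hx⟩

/-- Links the sign of the 6-form to that of $\eta(v,w)$: with $w=I_\rho v$ and $(i_v\rho)^2(x)>0$
the vectors $(v,w,x)$ are positively oriented, so $\eta(v,I_\rho v)>0$ amounts to the 6-form being
negative. The term in $\eta(v,v)$ drops out. -/
lemma tamingSixForm_of_null {ρ : V [⋀^Fin 3]→ₗ[ℝ] ℝ} (η : V [⋀^Fin 2]→ₗ[ℝ] ℝ) {v w : V}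
    (hw : ∀ u, ρ ![v, w, u] = 0) (x : Fin 4 → V) :
    tamingSixForm ρ η v ![v, w, x 0, x 1, x 2, x 3] =
      -η ![v, w] * wedgeTwoTwo (ρ.curryLeft v) (ρ.curryLeft v) x := by
  rw [tamingSixForm, oneWedge_wedgeTwoThree_of_null _ _ _ (fun u => ?_) hw hw]
  · simp [two_self]
  · rw [curryLeft_two, three_self_left]

lemma isTamedPair_of_isTamingForm (hV : finrank ℝ V = 6) {o : Orientation ℝ V (Fin 6)}
    {ρ : V [⋀^Fin 3]→ₗ[ℝ] ℝ} {η : V [⋀^Fin 2]→ₗ[ℝ] ℝ} (hρ : IsDefiniteSix ρ)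
    (hη : IsTamingForm o ρ η) : IsTamedPair o ρ η := by
  intro v hv
  have hx := exists_wedgeTwoTwo_ne_zero_of_rank (hρ v hv)
  refine ⟨hx, fun y hy => ?_⟩
  obtain ⟨x, hx⟩ := exists_wedgeTwoTwo_pos hx
  obtain ⟨b, rfl⟩ := exists_basis_orientation_eq hV o
  obtain ⟨w, ⟨hnull, -, -, hpos⟩, hvw⟩ := hη v hv
  have h1 := (isPosOriented_basis_iff b _).1 (hpos x hx)
  have h2 := tamingSixForm_of_null η hnull x
  rw [apply_eq_mul_det b] at h2 ⊢
  have h3 := (isPosOriented_basis_iff b _).1 hy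
  have h4 : 0 < η ![v, w] * wedgeTwoTwo (ρ.curryLeft v) (ρ.curryLeft v) x := mul_pos hvw hx
  have h5 : tamingSixForm ρ η v b < 0 := by
    by_contra! hc
    nlinarith [mul_nonneg hc h1.le]
  exact mul_neg_of_neg_of_pos h5 h3

lemma IsTamedPair.isDefiniteSix (hV : finrank ℝ V = 6) {o : Orientation ℝ V (Fin 6)}
    {ρ : V [⋀^Fin 3]→ₗ[ℝ] ℝ} {η : V [⋀^Fin 2]→ₗ[ℝ] ℝ} (h : IsTamedPair o ρ η) :
    IsDefiniteSix ρ := by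
  intro v hv
  obtain ⟨⟨x, hx⟩, -⟩ := h v hv
  exact twoFormRank_eq_four hV hv (fun u => ρ.three_self_left v u) hx

/-- A definite binary quadratic form `r² a + 2 r c + d` with `a ≠ 0` has positive discriminant
`a d - c²`. -/
lemma discrim_pos_of_ne_zero {a c d : ℝ} (ha : a ≠ 0) (h : ∀ r : ℝ, r ^ 2 * a + 2 * r * c + d ≠ 0) :
    0 < a * d - c ^ 2 := by
  by_contra! hle
  apply h ((-c + √(c ^ 2 - a * d)) / a)
  have hs : √(c ^ 2 - a * d) ^ 2 = c ^ 2 - a * d := Real.sq_sqrt (by linarith)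
  field_simp
  linear_combination hs

lemma wedgeTwoTwo_comm (β γ : V [⋀^Fin 2]→ₗ[ℝ] ℝ) (x : Fin 4 → V) :
    wedgeTwoTwo β γ x = wedgeTwoTwo γ β x := by
  unfold wedgeTwoTwo
  ring

lemma wedgeTwoTwo_add_right (β γ γ' : V [⋀^Fin 2]→ₗ[ℝ] ℝ) (x : Fin 4 → V) :
    wedgeTwoTwo β (γ + γ') x = wedgeTwoTwo β γ x + wedgeTwoTwo β γ' x := by
  simp only [wedgeTwoTwo, AlternatingMap.add_apply]
  ring

lemma wedgeTwoTwo_smul_right (β γ : V [⋀^Fin 2]→ₗ[ℝ] ℝ) (r : ℝ) (x : Fin 4 → V) :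
    wedgeTwoTwo β (r • γ) x = r * wedgeTwoTwo β γ x := by
  simp only [wedgeTwoTwo, AlternatingMap.smul_apply, smul_eq_mul]
  ring

lemma wedgeTwoTwo_add_left (β β' γ : V [⋀^Fin 2]→ₗ[ℝ] ℝ) (x : Fin 4 → V) :
    wedgeTwoTwo (β + β') γ x = wedgeTwoTwo β γ x + wedgeTwoTwo β' γ x := by
  simp only [wedgeTwoTwo, AlternatingMap.add_apply]
  ring

lemma wedgeTwoTwo_smul_left (β γ : V [⋀^Fin 2]→ₗ[ℝ] ℝ) (r : ℝ) (x : Fin 4 → V) :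
    wedgeTwoTwo (r • β) γ x = r * wedgeTwoTwo β γ x := by
  simp only [wedgeTwoTwo, AlternatingMap.smul_apply, smul_eq_mul]
  ring

/-- For `v, u` spanning a plane on which `ρ (v, u, ·) = 0`, the 4-forms `i_p ρ ∧ i_q ρ` with
`p, q` in that plane are multiples of `vol (v, u, ·)`. -/
lemma exists_wedgeTwoTwo_eq_mul_det (b : Basis (Fin 6) ℝ V) {ρ : V [⋀^Fin 3]→ₗ[ℝ] ℝ} {v u : V}
    (huv : LinearIndependent ℝ ![v, u]) (hnull : ∀ z, ρ ![v, u, z] = 0) :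
    ∃ a c d : ℝ, ∀ x : Fin 4 → V,
      wedgeTwoTwo (ρ.curryLeft v) (ρ.curryLeft v) x = a * b.det ![v, u, x 0, x 1, x 2, x 3] ∧
      wedgeTwoTwo (ρ.curryLeft v) (ρ.curryLeft u) x = c * b.det ![v, u, x 0, x 1, x 2, x 3] ∧
      wedgeTwoTwo (ρ.curryLeft u) (ρ.curryLeft u) x = d * b.det ![v, u, x 0, x 1, x 2, x 3] := by
  have hdual : ∀ r s : ℝ, ∃ α : V →ₗ[ℝ] ℝ, α v = r ∧ α u = s := by
    intro r s
    obtain ⟨α, hα⟩ := ((Basis.span huv).constr ℝ ![r, s]).exists_extend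
    refine ⟨α, ?_, ?_⟩
    · have := LinearMap.congr_fun hα (Basis.span huv 0)
      rw [LinearMap.comp_apply, Basis.constr_basis, Submodule.subtype_apply,
        Basis.span_apply] at this
      simpa using this
    · have := LinearMap.congr_fun hα (Basis.span huv 1)
      rw [LinearMap.comp_apply, Basis.constr_basis, Submodule.subtype_apply,
        Basis.span_apply] at this
      simpa using this
  obtain ⟨α₁, h1v, h1u⟩ := hdual 1 0
  obtain ⟨α₂, h2v, h2u⟩ := hdual 0 1
  have hnull' : ∀ z, ρ ![u, v, z] = 0 := fun z => by rw [three_swap_left, hnull, neg_zero]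
  have hv := fun α (x : Fin 4 → V) => oneWedge_wedgeTwoThree_of_null α (ρ.curryLeft v) ρ (p := v)
    (q := u) (fun z => ρ.three_self_left v z) hnull hnull x
  have hu := fun α (x : Fin 4 → V) => oneWedge_wedgeTwoThree_of_null α (ρ.curryLeft u) ρ (p := v)
    (q := u) hnull' (fun z => ρ.three_self_left u z) hnull x
  -- Each 6-form $\alpha\wedge i_p\rho\wedge\rho$ is a multiple of `b.det`. On $(v,u,x)$ it equals
  -- $\alpha(v)\,i_p\rho\wedge i_u\rho-\alpha(u)\,i_p\rho\wedge i_v\rho$, and the dual pair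
  -- $\alpha_1,\alpha_2$ isolates one term at a time.
  refine ⟨-oneWedge α₂ (wedgeTwoThree (ρ.curryLeft v) ρ) b,
    oneWedge α₁ (wedgeTwoThree (ρ.curryLeft v) ρ) b,
    oneWedge α₁ (wedgeTwoThree (ρ.curryLeft u) ρ) b, fun x => ⟨?_, ?_, ?_⟩⟩
  · have := hv α₂ x
    rw [apply_eq_mul_det b, h2v, h2u] at this
    linarith
  · have := hv α₁ x
    rw [apply_eq_mul_det b, h1v, h1u] at this
    linarith
  · have := hu α₁ x
    rw [apply_eq_mul_det b, h1v, h1u] at this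
    linarith

/-- Constructs $I_\rho v$. On the null plane of $i_v\rho$ the map $p\mapsto(i_p\rho)^2$ is a
quadratic form with values in a line; it has no nonzero isotropic vector, hence is definite, and $v$
can be rotated by a right angle with respect to it. The sign of the 6-form then gives $\eta(v,I_\rho
v)>0$. -/
lemma IsTamedPair.isTamingForm (hV : finrank ℝ V = 6) {o : Orientation ℝ V (Fin 6)}
    {ρ : V [⋀^Fin 3]→ₗ[ℝ] ℝ} {η : V [⋀^Fin 2]→ₗ[ℝ] ℝ} (h : IsTamedPair o ρ η) :
    IsTamingForm o ρ η := by
  have : Module.Finite ℝ V := Module.finite_of_finrank_pos (by omega)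
  intro v hv
  obtain ⟨b, rfl⟩ := exists_basis_orientation_eq hV o
  have hrank := h.isDefiniteSix hV v hv
  -- Rank $4$ in dimension $6$ leaves a null plane, which is larger than the line through $v$.
  obtain ⟨u, hu, huv⟩ : ∃ u, (ρ.curryLeft v).curryLeft u = 0 ∧ u ∉ Submodule.span ℝ {v} := by
    by_contra! hc
    have hle : LinearMap.ker (ρ.curryLeft v).curryLeft ≤ Submodule.span ℝ {v} :=
      fun u hu => hc u hu
    have h1 := Submodule.finrank_mono hle
    rw [finrank_span_singleton hv] at h1
    have h2 := (ρ.curryLeft v).curryLeft.finrank_range_add_finrank_ker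
    unfold twoFormRank at hrank
    omega
  have hnull : ∀ z, ρ ![v, u, z] = 0 := (curryLeft_eq_zero_iff _ _).1 hu
  have hli : LinearIndependent ℝ ![v, u] := by
    rw [LinearIndependent.pair_iff' hv]
    intro r hr
    exact huv (Submodule.mem_span_singleton.2 ⟨r, hr⟩)
  obtain ⟨a, c, d, hacd⟩ := exists_wedgeTwoTwo_eq_mul_det b hli hnull
  set D : (Fin 4 → V) → ℝ := fun x => b.det ![v, u, x 0, x 1, x 2, x 3] with hD
  have ha : a ≠ 0 := by
    rintro rfl
    obtain ⟨⟨x, hx⟩, -⟩ := h v hv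
    apply hx
    rw [(hacd x).1, zero_mul]
  obtain ⟨x₀, hx₀⟩ := (h v hv).1
  have hD₀ : D x₀ ≠ 0 := by
    intro h0
    apply hx₀
    rw [(hacd x₀).1]
    exact mul_eq_zero_of_right _ h0
  have hquad : ∀ (r s : ℝ) x, wedgeTwoTwo (ρ.curryLeft (r • v + s • u))
      (ρ.curryLeft (r • v + s • u)) x = (r ^ 2 * a + 2 * r * s * c + s ^ 2 * d) * D x := by
    intro r s x
    obtain ⟨e1, e2, e3⟩ := hacd x
    simp only [map_add, map_smul, wedgeTwoTwo_add_left, wedgeTwoTwo_add_right,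
      wedgeTwoTwo_smul_left, wedgeTwoTwo_smul_right, wedgeTwoTwo_comm (ρ.curryLeft u)
      (ρ.curryLeft v), e1, e2, e3]
    ring
  have hdisc : 0 < a * d - c ^ 2 := by
    refine discrim_pos_of_ne_zero ha fun r hr => ?_
    have hne : r • v + (1 : ℝ) • u ≠ 0 := by
      intro h0
      apply huv
      rw [Submodule.mem_span_singleton]
      refine ⟨-r, ?_⟩
      rw [neg_smul, neg_eq_iff_add_eq_zero, ← h0, one_smul]
    obtain ⟨⟨x, hx⟩, -⟩ := h _ hne
    apply hx
    rw [hquad]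
    linear_combination D x * hr
  set S := √(a * d - c ^ 2) with hS
  have hS0 : 0 < S := Real.sqrt_pos.2 hdisc
  have hS2 : S ^ 2 = a * d - c ^ 2 := Real.sq_sqrt hdisc.le
  -- In the basis $v,u$ the quadratic form has Gram matrix $\begin{pmatrix}a&c\\c&d\end{pmatrix}$.
  -- The vector $-cv+au$ is orthogonal to $v$, and division by $S=\sqrt{ad-c^2}$ gives it the same
  -- norm $a$; the sign is the one for which $(v,w,x)$ is positive when $(i_v\rho)^2(x)>0$.
  set w := (-(c / S)) • v + (a / S) • u with hw
  have hnullw : ∀ z, ρ ![v, w, z] = 0 := by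
    intro z
    rw [hw, three_add_snd, three_smul_snd, three_smul_snd, three_self_left, hnull]
    ring
  have hdet : ∀ x : Fin 4 → V, b.det ![v, w, x 0, x 1, x 2, x 3] = (a / S) * D x := by
    intro x
    have e1 := (b.det).map_update_add ![v, u, x 0, x 1, x 2, x 3] 1 ((-(c / S)) • v) ((a / S) • u)
    have e2 := (b.det).map_update_smul ![v, u, x 0, x 1, x 2, x 3] 1 (-(c / S)) v
    have e3 := (b.det).map_update_smul ![v, u, x 0, x 1, x 2, x 3] 1 (a / S) u
    have hup : ∀ z, Function.update ![v, u, x 0, x 1, x 2, x 3] 1 z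
        = ![v, z, x 0, x 1, x 2, x 3] := by
      intro z
      ext i
      fin_cases i <;> rfl
    simp only [hup] at e1 e2 e3
    have e4 : b.det ![v, v, x 0, x 1, x 2, x 3] = 0 :=
      (b.det).map_eq_zero_of_eq _ (i := 0) (j := 1) rfl (by decide)
    rw [hw, e1, e2, e3, e4]
    simp [hD]
  refine ⟨w, ⟨hnullw, fun x => ?_, fun x => ?_, fun x hx => ?_⟩, ?_⟩
  · rw [hw]
    simp only [map_add, map_smul, wedgeTwoTwo_add_right, wedgeTwoTwo_smul_right, (hacd x).1,
      (hacd x).2.1]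
    ring
  · rw [hw, hquad, (hacd x).1]
    change _ = a * D x
    field_simp
    linear_combination (-D x) * hS2
  · rw [isPosOriented_basis_iff, hdet]
    have h1 : 0 < a * D x := by rw [← (hacd x).1]; exact hx
    have h2 : a / S * D x = (a * D x) / S := by ring
    rw [h2]
    positivity
  · have h1 := tamingSixForm_of_null η hnullw x₀
    rw [apply_eq_mul_det b, hdet, (hacd x₀).1] at h1
    have h2 : tamingSixForm ρ η v b < 0 := (h v hv).2 b ⟨b, rfl, rfl⟩
    -- Evaluating the 6-form on $(v,w,x_0)$ both as a multiple of the determinant and by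
    -- `tamingSixForm_of_null`, the nonzero factor $a\,D(x_0)$ cancels.
    have h3 : η ![v, w] * S = -tamingSixForm ρ η v b := by
      change _ = _ * (a * D x₀) at h1
      have : (η ![v, w] * S + tamingSixForm ρ η v b) * (a * D x₀) = 0 := by
        field_simp at h1
        linear_combination (a * D x₀) * h1
      rcases mul_eq_zero.1 this with h | h
      · linarith
      · exact absurd h (mul_ne_zero ha hD₀)
    by_contra! hc
    nlinarith

section Naturality

variable {V' : Type*} [AddCommGroup V'] [Module ℝ V']

lemma vecThree_comp (L : V' →ₗ[ℝ] V) (a b c : V') :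
    (fun i => L (![a, b, c] i)) = ![L a, L b, L c] := by
  ext i; fin_cases i <;> rfl

lemma vecTwo_comp (L : V' →ₗ[ℝ] V) (a b : V') : (fun i => L (![a, b] i)) = ![L a, L b] := by
  ext i; fin_cases i <;> rfl

lemma compLinearMap_three (ρ : V [⋀^Fin 3]→ₗ[ℝ] ℝ) (L : V' →ₗ[ℝ] V) (a b c : V') :
    ρ.compLinearMap L ![a, b, c] = ρ ![L a, L b, L c] := by
  rw [compLinearMap_apply, vecThree_comp]

lemma compLinearMap_two (ρ : V [⋀^Fin 2]→ₗ[ℝ] ℝ) (L : V' →ₗ[ℝ] V) (a b : V') :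
    ρ.compLinearMap L ![a, b] = ρ ![L a, L b] := by
  rw [compLinearMap_apply, vecTwo_comp]

lemma tamingSixForm_compLinearMap (ρ : V [⋀^Fin 3]→ₗ[ℝ] ℝ) (η : V [⋀^Fin 2]→ₗ[ℝ] ℝ)
    (L : V' →ₗ[ℝ] V) (v : V') (y : Fin 6 → V') :
    tamingSixForm (ρ.compLinearMap L) (η.compLinearMap L) v y =
      tamingSixForm ρ η (L v) (L ∘ y) := by
  simp only [tamingSixForm, oneWedge_apply, wedgeTwoThree_apply, wedgeTwoThreeFun, curryLeft_two,
    contract_apply, compLinearMap_three, compLinearMap_two, Function.comp_def, Fin.removeNth]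

lemma wedgeTwoTwo_compLinearMap (ρ : V [⋀^Fin 3]→ₗ[ℝ] ℝ) (L : V' →ₗ[ℝ] V) (v w : V')
    (x : Fin 4 → V') :
    wedgeTwoTwo ((ρ.compLinearMap L).curryLeft v) ((ρ.compLinearMap L).curryLeft w) x =
      wedgeTwoTwo (ρ.curryLeft (L v)) (ρ.curryLeft (L w)) (L ∘ x) := by
  simp only [wedgeTwoTwo, curryLeft_two, compLinearMap_three, Function.comp_def]

lemma IsTamedPair.compLinearEquiv {o : Orientation ℝ V (Fin 6)} {o' : Orientation ℝ V' (Fin 6)}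
    {ρ : V [⋀^Fin 3]→ₗ[ℝ] ℝ} {η : V [⋀^Fin 2]→ₗ[ℝ] ℝ} (h : IsTamedPair o ρ η) (L : V' ≃ₗ[ℝ] V)
    (ho : ∀ y, IsPosOriented o' y → IsPosOriented o (L ∘ y)) :
    IsTamedPair o' (ρ.compLinearMap (L : V' →ₗ[ℝ] V)) (η.compLinearMap (L : V' →ₗ[ℝ] V)) := by
  intro v hv
  obtain ⟨⟨x, hx⟩, hy⟩ := h (L v) (by simpa using hv)
  constructor
  · refine ⟨L.symm ∘ x, ?_⟩
    rw [wedgeTwoTwo_compLinearMap]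
    have hLx : L ∘ (L.symm ∘ x) = x := funext fun i => L.apply_symm_apply _
    rw [LinearEquiv.coe_coe, hLx]
    exact hx
  · intro y hpos
    rw [tamingSixForm_compLinearMap]
    exact hy _ (ho y hpos)

end Naturality

lemma tamingSixForm_smul (ρ : V [⋀^Fin 3]→ₗ[ℝ] ℝ) (η : V [⋀^Fin 2]→ₗ[ℝ] ℝ) (r : ℝ) (v : V)
    (y : Fin 6 → V) : tamingSixForm ρ (r • η) v y = r * tamingSixForm ρ η v y := by
  simp only [tamingSixForm, oneWedge_apply, contract_apply, AlternatingMap.smul_apply,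
    smul_eq_mul, Finset.mul_sum]
  exact Finset.sum_congr rfl fun i _ => by ring

lemma IsTamedPair.smul {o : Orientation ℝ V (Fin 6)}
    {ρ : V [⋀^Fin 3]→ₗ[ℝ] ℝ} {η : V [⋀^Fin 2]→ₗ[ℝ] ℝ} (h : IsTamedPair o ρ η) {r : ℝ}
    (hr : 0 < r) : IsTamedPair o ρ (r • η) := fun v hv =>
  ⟨(h v hv).1, fun y hy => by
    rw [tamingSixForm_smul]; exact mul_neg_of_pos_of_neg hr ((h v hv).2 y hy)⟩

end TamedPair

/-! ### Openness of tameness at a point -/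

section Openness

variable {E : Type*} [NormedAddCommGroup E] [NormedSpace ℝ E]

open AlternatingMap

/-- Both conditions are homogeneous of degree $2$ in $v$, and a top form has the same sign on all
positive bases. Only a compact set of $v$ and a single basis remain to be tested. -/
lemma isTamedPair_basis_iff_sphere (b : Basis (Fin 6) ℝ E) (ρ : E [⋀^Fin 3]→ₗ[ℝ] ℝ)
    (η : E [⋀^Fin 2]→ₗ[ℝ] ℝ) : IsTamedPair b.orientation ρ η ↔ ∀ v ∈ Metric.sphere (0 : E) 1,
      (∃ x, wedgeTwoTwo (ρ.curryLeft v) (ρ.curryLeft v) x ≠ 0) ∧ tamingSixForm ρ η v b < 0 := by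
  constructor
  · intro h v hv
    obtain ⟨h1, h2⟩ := h v (by rintro rfl; simp at hv)
    exact ⟨h1, h2 b ⟨b, rfl, rfl⟩⟩
  · intro h v hv
    have hn : 0 < ‖v‖ := norm_pos_iff.2 hv
    obtain ⟨⟨x, hx⟩, h2⟩ := h (‖v‖⁻¹ • v) (by simp [norm_smul, hn.ne'])
    refine ⟨⟨x, fun h0 => hx ?_⟩, fun y hy => ?_⟩
    · rw [map_smul, wedgeTwoTwo_smul_left, wedgeTwoTwo_smul_right, h0]
      simp
    · rw [apply_eq_mul_det b]
      refine mul_neg_of_neg_of_pos ?_ ((isPosOriented_basis_iff b y).1 hy)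
      have h3 : tamingSixForm ρ η (‖v‖⁻¹ • v) b = ‖v‖⁻¹ * ‖v‖⁻¹ * tamingSixForm ρ η v b := by
        simp only [tamingSixForm, oneWedge_apply, contract_apply, wedgeTwoThree_apply,
          wedgeTwoThreeFun, curryLeft_two, three_smul_fst, two_smul_left, Finset.mul_sum]
        exact Finset.sum_congr rfl fun i _ => by ring
      rw [h3] at h2
      by_contra! hc
      have : 0 ≤ ‖v‖⁻¹ * ‖v‖⁻¹ * tamingSixForm ρ η v b := by positivity
      linarith

lemma continuous_threeForm_apply {X : Type*} [TopologicalSpace X] {f : X → E [⋀^Fin 3]→L[ℝ] ℝ}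
    {a b c : X → E} (hf : Continuous f) (ha : Continuous a) (hb : Continuous b)
    (hc : Continuous c) : Continuous fun x => (f x).toAlternatingMap ![a x, b x, c x] := by
  refine hf.eval (continuous_pi fun i => ?_)
  fin_cases i <;> assumption

lemma continuous_twoForm_apply {X : Type*} [TopologicalSpace X] {f : X → E [⋀^Fin 2]→L[ℝ] ℝ}
    {a b : X → E} (hf : Continuous f) (ha : Continuous a) (hb : Continuous b) :
    Continuous fun x => (f x).toAlternatingMap ![a x, b x] := by
  refine hf.eval (continuous_pi fun i => ?_)
  fin_cases i <;> assumption

/-- Being a tamed pair is an open condition. -/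
lemma isOpen_isTamedPair [FiniteDimensional ℝ E] (hE : finrank ℝ E = 6)
    (o : Orientation ℝ E (Fin 6)) :
    IsOpen {p : (E [⋀^Fin 3]→L[ℝ] ℝ) × (E [⋀^Fin 2]→L[ℝ] ℝ) |
      IsTamedPair o p.1.toAlternatingMap p.2.toAlternatingMap} := by
  obtain ⟨b, rfl⟩ := exists_basis_orientation_eq hE o
  have : ProperSpace E := FiniteDimensional.proper_real E
  simp only [isTamedPair_basis_iff_sphere]
  rw [isOpen_iff_mem_nhds]
  rintro p hp
  -- The tube lemma: it suffices that the conditions, which are strict inequalities between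
  -- continuous functions, persist near each pair (forms, $v$). The witness $x$ can be kept fixed.
  refine (isCompact_sphere (0 : E) 1).eventually_forall_of_forall_eventually fun v hv => ?_
  obtain ⟨⟨x, hx⟩, hT⟩ := hp v hv
  have c1 : Continuous fun z : ((E [⋀^Fin 3]→L[ℝ] ℝ) × (E [⋀^Fin 2]→L[ℝ] ℝ)) × E =>
      wedgeTwoTwo (z.1.1.toAlternatingMap.curryLeft z.2) (z.1.1.toAlternatingMap.curryLeft z.2)
        x := by
    have h := fun a b => continuous_threeForm_apply (X := ((E [⋀^Fin 3]→L[ℝ] ℝ) ×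
      (E [⋀^Fin 2]→L[ℝ] ℝ)) × E) (f := fun z => z.1.1) (a := fun z => z.2) (b := fun _ => a)
      (c := fun _ => b) (by fun_prop) (by fun_prop) (by fun_prop) (by fun_prop)
    simp only [wedgeTwoTwo, curryLeft_two]
    fun_prop
  have c2 : Continuous fun z : ((E [⋀^Fin 3]→L[ℝ] ℝ) × (E [⋀^Fin 2]→L[ℝ] ℝ)) × E =>
      tamingSixForm z.1.1.toAlternatingMap z.1.2.toAlternatingMap z.2 b := by
    have h := fun a b => continuous_threeForm_apply (X := ((E [⋀^Fin 3]→L[ℝ] ℝ) ×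
      (E [⋀^Fin 2]→L[ℝ] ℝ)) × E) (f := fun z => z.1.1) (a := fun z => z.2) (b := fun _ => a)
      (c := fun _ => b) (by fun_prop) (by fun_prop) (by fun_prop) (by fun_prop)
    have h' := fun a b c => continuous_threeForm_apply (X := ((E [⋀^Fin 3]→L[ℝ] ℝ) ×
      (E [⋀^Fin 2]→L[ℝ] ℝ)) × E) (f := fun z => z.1.1) (a := fun _ => a) (b := fun _ => b)
      (c := fun _ => c) (by fun_prop) (by fun_prop) (by fun_prop) (by fun_prop)
    have h'' := fun a => continuous_twoForm_apply (X := ((E [⋀^Fin 3]→L[ℝ] ℝ) ×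
      (E [⋀^Fin 2]→L[ℝ] ℝ)) × E) (f := fun z => z.1.2) (a := fun z => z.2) (b := fun _ => a)
      (by fun_prop) (by fun_prop) (by fun_prop)
    simp only [tamingSixForm, oneWedge_apply, contract_apply, wedgeTwoThree_apply,
      wedgeTwoThreeFun, curryLeft_two]
    refine continuous_finsetSum _ fun i _ => ?_
    fun_prop
  filter_upwards [c1.continuousAt.eventually_ne hx,
    c2.continuousAt.eventually_lt continuousAt_const hT] with z h1 h2 using ⟨⟨x, h1⟩, h2⟩

end Openness

/-! ### From tamed pairs in dimension 6 to positive forms in dimension 7 -/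

section Positive

variable {U : Type*} [AddCommGroup U] [Module ℝ U]

open AlternatingMap

/-- In the null plane of `i_v ρ`, a taming form is nondegenerate. -/
lemma IsTamedPair.mem_span_of_null {P : Type*} [AddCommGroup P] [Module ℝ P]
    (hP : finrank ℝ P = 6) {o : Orientation ℝ P (Fin 6)} {ρ : P [⋀^Fin 3]→ₗ[ℝ] ℝ}
    {η : P [⋀^Fin 2]→ₗ[ℝ] ℝ} (h : IsTamedPair o ρ η) {p q : P} (hp : p ≠ 0)
    (hpq : ∀ x, ρ ![p, q, x] = 0) (hη : η ![p, q] = 0) : ∃ r : ℝ, r • p = q := by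
  by_contra! hc
  have hli : LinearIndependent ℝ ![p, q] := (LinearIndependent.pair_iff' hp).2 hc
  obtain ⟨b, rfl⟩ := exists_basis_orientation_eq hP o
  obtain ⟨a, c, d, hacd⟩ := exists_wedgeTwoTwo_eq_mul_det b hli hpq
  obtain ⟨⟨x, hx⟩, hT⟩ := h p hp
  have h1 := tamingSixForm_of_null η hpq x
  -- The 6-form, which is nonzero on `b`, vanishes on $(p,q,x)$; so this family has determinant $0$,
  -- and $(i_p\rho)^2(x)$ is a multiple of that determinant.
  rw [hη, neg_zero, zero_mul, apply_eq_mul_det b] at h1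
  rcases mul_eq_zero.1 h1 with h1 | h1
  · exact (hT b ⟨b, rfl, rfl⟩).ne h1
  · rw [(hacd x).1, h1, mul_zero] at hx
    exact hx rfl

/-- The content is rank $6$ of $i_u\phi$, i.e. that its kernel is the line through $u$. Testing
kernel vectors against $I_\rho$-images isolates a value $\eta(\cdot,I_\rho\,\cdot)>0$, since
$\rho(p,I_\rho p,\cdot)=0$. -/
lemma isPositiveForm_of_isTamedPair (hU : finrank ℝ U = 7) {o : Orientation ℝ U (Fin 7)}
    {φ : U [⋀^Fin 3]→ₗ[ℝ] ℝ} {ν : U} (hν : ν ≠ 0) {P : Submodule ℝ U}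
    (hc : IsCompl (Submodule.span ℝ {ν}) P) {oP : Orientation ℝ P (Fin 6)}
    (ho : ∀ x : Fin 6 → P, IsPosOriented oP x ↔
      IsPosOriented o (Fin.cons ν (fun i => (x i : U)) : Fin 7 → U))
    (h : IsTamedPair oP (φ.compLinearMap P.subtype)
      ((φ.curryLeft ν).compLinearMap P.subtype)) : IsPositiveForm o φ := by
  have : Module.Finite ℝ U := Module.finite_of_finrank_pos (by omega)
  have hP : finrank ℝ P = 6 := by
    have := Submodule.finrank_add_eq_of_isCompl hc
    rw [finrank_span_singleton hν] at this
    omega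
  have htame := h.isTamingForm hP
  refine ⟨fun u hu => ?_, ν, P, oP, hν, hc, ho, h.isDefiniteSix hP, htame⟩
  have hdec : ∀ z : U, ∃ (a : ℝ) (p : P), z = a • ν + p := by
    intro z
    have hz : z ∈ Submodule.span ℝ {ν} ⊔ P := by rw [hc.sup_eq_top]; trivial
    obtain ⟨y, hy, p, hp, rfl⟩ := Submodule.mem_sup.1 hz
    obtain ⟨a, rfl⟩ := Submodule.mem_span_singleton.1 hy
    exact ⟨a, ⟨p, hp⟩, rfl⟩
  have hρ : ∀ a b c : P, φ.compLinearMap P.subtype ![a, b, c] = φ ![(a : U), b, c] :=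
    fun a b c => compLinearMap_three _ _ _ _ _
  have hη : ∀ a b : P, (φ.curryLeft ν).compLinearMap P.subtype ![a, b] = φ ![ν, a, b] :=
    fun a b => compLinearMap_two _ _ _ _
  have hker : ∀ z, (∀ y, φ ![u, z, y] = 0) → ∃ r : ℝ, r • u = z := by
    intro z hz
    obtain ⟨a, p, rfl⟩ := hdec u
    obtain ⟨b, q, rfl⟩ := hdec z
    by_cases ha : a = 0
    · subst ha
      have hp : p ≠ 0 := by
        rintro rfl
        simp at hu
      obtain ⟨w, ⟨hnull, -⟩, hw⟩ := htame p hp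
      -- With $u=p\in P$ and $w=I_\rho p$: $0=\phi(p,b\nu+q,w)=-b\,\eta(p,w)$.
      have hb : b = 0 := by
        have h1 := hz w
        have h2 := hnull q
        rw [hρ, three_swap_right] at h2
        rw [hη] at hw
        simp only [zero_smul, zero_add, three_add_snd, three_smul_snd] at h1
        rw [three_swap_left] at h1
        by_contra hb
        have : b * φ ![ν, (p : U), w] = 0 := by linarith
        rcases mul_eq_zero.1 this with h | h
        · exact hb h
        · linarith
      subst hb
      simp only [zero_smul, zero_add] at hz ⊢
      -- Testing against $\nu$ gives $\eta(p,q)=0$, so $q$ lies in the null plane of $i_p\rho$ and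
      -- pairs to zero with $p$.
      obtain ⟨r, hr⟩ := h.mem_span_of_null hP (q := q) hp (fun x => by rw [hρ]; exact hz x) (by
        rw [hη, three_swap_left, three_swap_right, hz]; simp)
      exact ⟨r, by rw [← hr]; rfl⟩
    · refine ⟨b / a, ?_⟩
      -- Subtracting $(b/a)u$ removes the $\nu$-component of the kernel vector. If $q'\neq0$ and
      -- $w=I_\rho q'$, then $0=\phi(u,q',w)=a\,\eta(q',w)$, a contradiction.
      set q' : P := q - (b / a) • p with hq'
      have hqq : (q : U) = q' + (b / a) • p := by simp [hq']
      have hq0 : q' = 0 := by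
        by_contra hne
        obtain ⟨w, ⟨hnull, -⟩, hw⟩ := htame q' hne
        have h1 : φ ![a • ν + p, (q' : U), w] = 0 := by
          have e : b • ν + (q : U) = q' + (b / a) • (a • ν + p) := by
            rw [hqq, smul_add, smul_smul, div_mul_cancel₀ _ ha]
            abel
          have := hz w
          rw [e, three_add_snd, three_smul_snd, three_self_left] at this
          linarith
        have h2 := hnull p
        rw [hρ, three_swap_right, three_swap_left] at h2
        rw [hη] at hw
        rw [three_add_fst, three_smul_fst] at h1
        have : a * φ ![ν, (q' : U), w] = 0 := by linarith
        rcases mul_eq_zero.1 this with h | h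
        · exact ha h
        · linarith
      rw [hqq, hq0, smul_add, smul_smul, div_mul_cancel₀ _ ha]
      simp
  have hkereq : LinearMap.ker (φ.curryLeft u).curryLeft = Submodule.span ℝ {u} := by
    apply le_antisymm
    · intro z hz
      rw [LinearMap.mem_ker, curryLeft_eq_zero_iff] at hz
      exact Submodule.mem_span_singleton.2 (hker z hz)
    · rw [Submodule.span_singleton_le_iff_mem, LinearMap.mem_ker, curryLeft_eq_zero_iff]
      exact fun y => φ.three_self_left u y
  have := (φ.curryLeft u).curryLeft.finrank_range_add_finrank_ker
  rw [hkereq, finrank_span_singleton hu] at this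
  unfold twoFormRank
  omega

end Positive

/-! ### Forms in charts; uniform tameness over a compact manifold -/

section ChartForms

variable {E : Type*} [NormedAddCommGroup E] [NormedSpace ℝ E]
  {H : Type*} [TopologicalSpace H] {I : ModelWithCorners ℝ E H}
  {M : Type*} [TopologicalSpace M] [ChartedSpace H M]

namespace DForm

lemma inChart_add {k : ℕ} (η η' : DForm I M k) (x₀ : M) (y : E) :
    inChart I (η + η') x₀ y = inChart I η x₀ y + inChart I η' x₀ y := rfl

lemma inChart_smul {k : ℕ} (r : ℝ) (η : DForm I M k) (x₀ : M) (y : E) :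
    inChart I (r • η) x₀ y = r • inChart I η x₀ y := rfl

lemma inChart_sum {k : ℕ} {ι : Type*} (s : Finset ι) (η : ι → DForm I M k) (x₀ : M) (y : E) :
    inChart I (∑ i ∈ s, η i) x₀ y = ∑ i ∈ s, inChart I (η i) x₀ y := by
  classical
  induction s using Finset.induction_on with
  | empty => rfl
  | insert a s ha ih => rw [Finset.sum_insert ha, Finset.sum_insert ha, inChart_add, ih]

lemma inChart_extChartAt {k : ℕ} (η : DForm I M k) {x₀ x : M}
    (hx : x ∈ (extChartAt I x₀).source) :
    inChart I η x₀ (extChartAt I x₀ x) = (η x).compContinuousLinearMap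
      (mfderivWithin 𝓘(ℝ, E) I (extChartAt I x₀).symm (range I) (extChartAt I x₀ x)) := by
  -- The type of `η x'` depends on `x'`, so the point is generalised before it is replaced.
  have h : ∀ x', x' = x → ∀ B : E →L[ℝ] E,
      ((η x' : E [⋀^Fin k]→L[ℝ] ℝ)).compContinuousLinearMap B =
        ((η x : E [⋀^Fin k]→L[ℝ] ℝ)).compContinuousLinearMap B := by
    rintro _ rfl B
    rfl
  exact h _ ((extChartAt I x₀).left_inv hx) _

lemma IsSmooth.add {k : ℕ} {η η' : DForm I M k} (h : IsSmooth I η) (h' : IsSmooth I η') :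
    IsSmooth I (η + η') := fun x₀ => (h x₀).add (h' x₀)

lemma IsSmooth.sub {k : ℕ} {η η' : DForm I M k} (h : IsSmooth I η) (h' : IsSmooth I η') :
    IsSmooth I (η - η') := fun x₀ => (h x₀).sub (h' x₀)

lemma IsSmooth.smul {k : ℕ} {η : DForm I M k} (h : IsSmooth I η) (r : ℝ) :
    IsSmooth I (r • η) := fun x₀ => (h x₀).const_smul r

lemma IsSmooth.sum {k : ℕ} {ι : Type*} {s : Finset ι} {η : ι → DForm I M k}
    (h : ∀ i ∈ s, IsSmooth I (η i)) : IsSmooth I (∑ i ∈ s, η i) := by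
  intro x₀
  have : inChart I (∑ i ∈ s, η i) x₀ = fun y => ∑ i ∈ s, inChart I (η i) x₀ y :=
    funext fun y => inChart_sum s η x₀ y
  rw [this]
  exact ContDiffOn.sum fun i hi => h i hi x₀

end DForm

/-- The tangent map of a chart as a linear equivalence. -/
lemma exists_chartEquiv [IsManifold I 1 M] {x₀ x : M} (hx : x ∈ (extChartAt I x₀).source) :
    ∃ L : TangentSpace I x ≃ₗ[ℝ] E, (∀ v, L v = mfderiv I 𝓘(ℝ, E) (extChartAt I x₀) x v) ∧
      ∀ w, L.symm w = mfderivWithin 𝓘(ℝ, E) I (extChartAt I x₀).symm (range I)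
        (extChartAt I x₀ x) w := by
  have h1 := mfderiv_extChartAt_comp_mfderivWithin_extChartAt_symm' (I := I) hx
  have h2 := mfderivWithin_extChartAt_symm_comp_mfderiv_extChartAt' (I := I) hx
  refine ⟨{ toFun := mfderiv I 𝓘(ℝ, E) (extChartAt I x₀) x
            map_add' := map_add _
            map_smul' := map_smul _
            invFun := mfderivWithin 𝓘(ℝ, E) I (extChartAt I x₀).symm (range I) (extChartAt I x₀ x)
            left_inv := fun v => DFunLike.congr_fun h2 v
            right_inv := fun v => DFunLike.congr_fun h1 v }, fun v => rfl, fun w => rfl⟩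

/-- Moves tameness at all points near $x_0$ into the single space $E$ with one fixed orientation,
where `isOpen_isTamedPair` applies. -/
lemma isTamedPair_inChart_iff [IsManifold I 1 M] (o : ManifoldOrientation I M 6) (x₀ : M) :
    ∃ c : Orientation ℝ E (Fin 6), ∀ᶠ x in 𝓝 x₀, ∀ (ρ : DForm I M 3) (η : DForm I M 2),
      IsTamedPair (o.at' x) (ρ x).toAlternatingMap (η x).toAlternatingMap ↔
      IsTamedPair c (DForm.inChart I ρ x₀ (extChartAt I x₀ x)).toAlternatingMap
        (DForm.inChart I η x₀ (extChartAt I x₀ x)).toAlternatingMap := by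
  obtain ⟨c, hc⟩ := o.locally_constant x₀
  refine ⟨c, ?_⟩
  filter_upwards [hc, extChartAt_source_mem_nhds (I := I) x₀] with x ho hx ρ η
  obtain ⟨L, hL, hL'⟩ := exists_chartEquiv hx
  rw [DForm.inChart_extChartAt ρ hx, DForm.inChart_extChartAt η hx]
  constructor
  · intro h
    convert h.compLinearEquiv (o' := c) L.symm fun y hy => ?_ using 1
    · ext y
      change ρ x _ = ρ x _
      congr 1
      ext i
      exact (hL' _).symm
    · ext y
      change η x _ = η x _
      congr 1
      ext i
      exact (hL' _).symm
    · have e : (fun i => mfderiv I 𝓘(ℝ, E) (extChartAt I x₀) x ((L.symm ∘ y) i)) = y :=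
        funext fun i => (hL _).symm.trans (L.apply_symm_apply _)
      exact (ho _).2 ((congrArg (IsPosOriented c) e).mpr hy)
  · intro h
    convert h.compLinearEquiv (o' := o.at' x) L fun y hy => ?_ using 1
    · ext y
      change ρ x y = ρ x _
      congr 1
      ext i
      exact (((hL' _).symm).trans (L.symm_apply_apply _)).symm
    · ext y
      change η x y = η x _
      congr 1
      ext i
      exact (((hL' _).symm).trans (L.symm_apply_apply _)).symm
    · have e : L ∘ y = fun i => mfderiv I 𝓘(ℝ, E) (extChartAt I x₀) x (y i) :=
        funext fun i => hL _
      exact (congrArg (IsPosOriented c) e).mpr ((ho y).1 hy)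

/-- Tamed pairs form an open condition on forms depending continuously on a parameter. -/
lemma eventually_isTamedPair [IsManifold I 1 M] [FiniteDimensional ℝ E] (hE : finrank ℝ E = 6)
    (o : ManifoldOrientation I M 6) {X : Type*} [TopologicalSpace X] {p₀ : X} {f : X → M}
    (hf : ContinuousAt f p₀) {R : X → DForm I M 3} {S : X → DForm I M 2}
    (hR : ContinuousAt (fun p => DForm.inChart I (R p) (f p₀) (extChartAt I (f p₀) (f p))) p₀)
    (hS : ContinuousAt (fun p => DForm.inChart I (S p) (f p₀) (extChartAt I (f p₀) (f p))) p₀)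
    (h : IsTamedPair (o.at' (f p₀)) (R p₀ (f p₀)).toAlternatingMap
      (S p₀ (f p₀)).toAlternatingMap) :
    ∀ᶠ p in 𝓝 p₀, IsTamedPair (o.at' (f p)) (R p (f p)).toAlternatingMap
      (S p (f p)).toAlternatingMap := by
  obtain ⟨c, hc⟩ := isTamedPair_inChart_iff o (f p₀)
  rw [hc.self_of_nhds] at h
  filter_upwards [hf.eventually hc,
    (hR.prodMk hS).eventually ((isOpen_isTamedPair hE c).mem_nhds h)] with p h1 h2
  rw [h1]
  exact h2

lemma DForm.IsSmooth.continuousAt_inChart [I.Boundaryless] {k : ℕ} {η : DForm I M k}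
    (h : DForm.IsSmooth I η) (x₀ : M) :
    ContinuousAt (fun x => DForm.inChart I η x₀ (extChartAt I x₀ x)) x₀ := by
  have h1 : ContinuousAt (DForm.inChart I η x₀) (extChartAt I x₀ x₀) :=
    (h x₀).continuousOn.continuousAt (extChartAt_target_mem_nhds x₀)
  exact h1.comp (f := extChartAt I x₀) (continuousAt_extChartAt x₀)

lemma DForm.IsContinuousPath.continuousAt_inChart [I.Boundaryless] {k : ℕ}
    {ρ : Icc (0 : ℝ) 1 → DForm I M k} (h : DForm.IsContinuousPath I ρ) (t₀ : Icc (0 : ℝ) 1)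
    (x₀ : M) : ContinuousAt (fun p : Icc (0 : ℝ) 1 × M =>
      DForm.inChart I (ρ p.1) x₀ (extChartAt I x₀ p.2)) (t₀, x₀) := by
  have h1 : ContinuousAt (fun p : Icc (0 : ℝ) 1 × E => DForm.inChart I (ρ p.1) x₀ p.2)
      (t₀, extChartAt I x₀ x₀) :=
    (h x₀).continuousAt (prod_mem_nhds univ_mem (extChartAt_target_mem_nhds x₀))
  have h2 : ContinuousAt (fun p : Icc (0 : ℝ) 1 × M => (p.1, extChartAt I x₀ p.2)) (t₀, x₀) :=
    continuousAt_fst.prodMk ((continuousAt_extChartAt x₀).comp (x := (t₀, x₀))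
      (f := Prod.snd) continuousAt_snd)
  exact h1.comp (f := fun p : Icc (0 : ℝ) 1 × M => (p.1, extChartAt I x₀ p.2)) h2

/-- Along a continuous path of tamed forms, convex combinations of sufficiently close members are
tamed. -/
lemma exists_forall_convexCombination_isTamedPair [IsManifold I 1 M] [I.Boundaryless]
    [CompactSpace M] [FiniteDimensional ℝ E] (hE : finrank ℝ E = 6)
    (o : ManifoldOrientation I M 6) {ρ : Icc (0 : ℝ) 1 → DForm I M 3}
    (hρ : DForm.IsContinuousPath I ρ) {Ω : DForm I M 2} (hΩ : DForm.IsSmooth I Ω)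
    (h : ∀ t x, IsTamedPair (o.at' x) (ρ t x).toAlternatingMap (Ω x).toAlternatingMap) :
    ∃ δ > 0, ∀ s t : Icc (0 : ℝ) 1, dist s t < δ → ∀ (r : Icc (0 : ℝ) 1) (x : M),
      IsTamedPair (o.at' x) (ρ s x + (r : ℝ) • (ρ t x - ρ s x)).toAlternatingMap
        (Ω x).toAlternatingMap := by
  have key : ∀ t₀ : Icc (0 : ℝ) 1, ∀ᶠ p in 𝓝 (t₀, t₀), ∀ q ∈ (univ : Set (Icc (0 : ℝ) 1 × M)),
      IsTamedPair (o.at' q.2) (ρ p.1 q.2 + (q.1 : ℝ) • (ρ p.2 q.2 - ρ p.1 q.2)).toAlternatingMap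
        (Ω q.2).toAlternatingMap := by
    intro t₀
    -- At $s=t=t_0$ the combination is $\rho_{t_0}$ for every $r$, hence tamed; openness and
    -- compactness of $[0,1]\times M$ give a neighbourhood of $(t_0,t_0)$ uniform in $r$ and $x$.
    refine isCompact_univ.eventually_forall_of_forall_eventually fun q _ => ?_
    obtain ⟨r₀, x₀⟩ := q
    have c1 := (hρ.continuousAt_inChart t₀ x₀).comp
      (x := (((t₀, t₀), (r₀, x₀)) : (Icc (0 : ℝ) 1 × Icc (0 : ℝ) 1) × (Icc (0 : ℝ) 1 × M)))
      (f := fun z => (z.1.1, z.2.2)) (by fun_prop)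
    have c2 := (hρ.continuousAt_inChart t₀ x₀).comp
      (x := (((t₀, t₀), (r₀, x₀)) : (Icc (0 : ℝ) 1 × Icc (0 : ℝ) 1) × (Icc (0 : ℝ) 1 × M)))
      (f := fun z => (z.1.2, z.2.2)) (by fun_prop)
    have c3 := (hΩ.continuousAt_inChart x₀).comp
      (x := (((t₀, t₀), (r₀, x₀)) : (Icc (0 : ℝ) 1 × Icc (0 : ℝ) 1) × (Icc (0 : ℝ) 1 × M)))
      (f := fun z => z.2.2) (by fun_prop)
    have cr : ContinuousAt (fun z : (Icc (0 : ℝ) 1 × Icc (0 : ℝ) 1) × (Icc (0 : ℝ) 1 × M) =>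
      (z.2.1 : ℝ)) ((t₀, t₀), (r₀, x₀)) := by fun_prop
    exact eventually_isTamedPair hE o
      (X := (Icc (0 : ℝ) 1 × Icc (0 : ℝ) 1) × (Icc (0 : ℝ) 1 × M))
      (p₀ := ((t₀, t₀), (r₀, x₀))) (f := fun z => z.2.2)
      (R := fun z => ρ z.1.1 + (z.2.1 : ℝ) • (ρ z.1.2 - ρ z.1.1)) (S := fun _ => Ω)
      (by fun_prop) (c1.add (cr.smul (c2.sub c1))) c3 (by simpa using h t₀ x₀)
  have hU : {p : Icc (0 : ℝ) 1 × Icc (0 : ℝ) 1 | ∀ q ∈ (univ : Set (Icc (0 : ℝ) 1 × M)),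
      IsTamedPair (o.at' q.2) (ρ p.1 q.2 + (q.1 : ℝ) • (ρ p.2 q.2 - ρ p.1 q.2)).toAlternatingMap
        (Ω q.2).toAlternatingMap} ∈ uniformity (Icc (0 : ℝ) 1) := by
    -- On the compact interval the neighbourhoods of the diagonal are exactly the entourages, which
    -- yields a uniform $\delta$.
    rw [← nhdsSet_diagonal_eq_uniformity, mem_nhdsSet_iff_forall]
    rintro ⟨s, t⟩ hst
    obtain rfl : s = t := hst
    exact key s
  obtain ⟨δ, hδ, hδ'⟩ := Metric.mem_uniformity_dist.1 hU
  exact ⟨δ, hδ, fun s t hst r x => hδ' hst (r, x) (mem_univ _)⟩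

/-- Adding a large multiple of the taming form restores tameness after a bounded perturbation. -/
lemma exists_forall_isTamedPair_smul_add [IsManifold I 1 M] [I.Boundaryless]
    [CompactSpace M] [FiniteDimensional ℝ E] (hE : finrank ℝ E = 6)
    (o : ManifoldOrientation I M 6) {ρ : Icc (0 : ℝ) 1 → DForm I M 3}
    {β : Icc (0 : ℝ) 1 → DForm I M 2}
    (hρ : DForm.IsContinuousPath I ρ) (hβ : DForm.IsContinuousPath I β)
    {Ω : DForm I M 2} (hΩ : DForm.IsSmooth I Ω)
    (h : ∀ t x, IsTamedPair (o.at' x) (ρ t x).toAlternatingMap (Ω x).toAlternatingMap) :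
    ∃ K₀ : ℝ, ∀ K ≥ K₀, ∀ t x, IsTamedPair (o.at' x) (ρ t x).toAlternatingMap
      (K • Ω x + β t x).toAlternatingMap := by
  have key : ∀ᶠ ε in 𝓝 (0 : ℝ), ∀ q ∈ (univ : Set (Icc (0 : ℝ) 1 × M)),
      IsTamedPair (o.at' q.2) (ρ q.1 q.2).toAlternatingMap
        (Ω q.2 + ε • β q.1 q.2).toAlternatingMap := by
    refine isCompact_univ.eventually_forall_of_forall_eventually fun q _ => ?_
    obtain ⟨t₀, x₀⟩ := q
    have c1 := (hρ.continuousAt_inChart t₀ x₀).comp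
      (x := ((0, (t₀, x₀)) : ℝ × (Icc (0 : ℝ) 1 × M))) (f := fun z => z.2) (by fun_prop)
    have c2 := (hβ.continuousAt_inChart t₀ x₀).comp
      (x := ((0, (t₀, x₀)) : ℝ × (Icc (0 : ℝ) 1 × M))) (f := fun z => z.2) (by fun_prop)
    have c3 := (hΩ.continuousAt_inChart x₀).comp
      (x := ((0, (t₀, x₀)) : ℝ × (Icc (0 : ℝ) 1 × M))) (f := fun z => z.2.2) (by fun_prop)
    have cr : ContinuousAt (fun z : ℝ × (Icc (0 : ℝ) 1 × M) => z.1) (0, (t₀, x₀)) := by fun_prop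
    exact eventually_isTamedPair hE o (X := ℝ × (Icc (0 : ℝ) 1 × M))
      (p₀ := (0, (t₀, x₀))) (f := fun z => z.2.2)
      (R := fun z => ρ z.2.1) (S := fun z => Ω + z.1 • β z.2.1)
      (by fun_prop) c1 (c3.add (cr.smul c2)) (by simpa using h t₀ x₀)
  obtain ⟨ε, hε, hε'⟩ := Metric.eventually_nhds_iff.1 key
  -- Any $K\ge2/\varepsilon$ has $K^{-1}<\varepsilon$, and $K\Omega+\beta=K(\Omega+K^{-1}\beta)$
  -- with $K>0$.
  refine ⟨2 / ε, fun K hK t x => ?_⟩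
  have hK0 : 0 < K := lt_of_lt_of_le (by positivity) hK
  have h1 : dist K⁻¹ 0 < ε := by
    rw [Real.dist_0_eq_abs, abs_of_pos (by positivity)]
    calc K⁻¹ ≤ (2 / ε)⁻¹ := inv_anti₀ (by positivity) hK
      _ < ε := by rw [inv_div]; linarith
  have h2 := (hε' h1 (t, x) (mem_univ _)).smul hK0
  convert h2 using 1
  ext v
  change K * Ω x v + β t x v = K * (Ω x v + K⁻¹ * β t x v)
  field_simp

end ChartForms

/-! ### Exterior calculus on a product of vector spaces -/

noncomputable section

section WedgeCalculus

variable {V W : Type*} [NormedAddCommGroup V] [NormedSpace ℝ V] [NormedAddCommGroup W]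
  [NormedSpace ℝ W] {k : ℕ}

open ContinuousAlternatingMap

/-- The exterior product `β ↦ α ∧ β` with a continuous 1-form `α`. -/
def oneWedgeL (α : V →L[ℝ] ℝ) : (V [⋀^Fin k]→L[ℝ] ℝ) →L[ℝ] (V [⋀^Fin (k + 1)]→L[ℝ] ℝ) :=
  (alternatizeUncurryFinCLM ℝ V ℝ).comp (ContinuousLinearMap.smulRightL ℝ V _ α)

lemma oneWedgeL_eq (α : V →L[ℝ] ℝ) (β : V [⋀^Fin k]→L[ℝ] ℝ) :
    oneWedgeL α β = alternatizeUncurryFin (α.smulRight β) := rfl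

lemma oneWedgeL_apply (α : V →L[ℝ] ℝ) (β : V [⋀^Fin k]→L[ℝ] ℝ) (y : Fin (k + 1) → V) :
    oneWedgeL α β y = ∑ i : Fin (k + 1), (-1) ^ (i : ℕ) * (α (y i) * β (i.removeNth y)) := by
  simp [oneWedgeL_eq, alternatizeUncurryFin_apply]

lemma oneWedgeL_compContinuousLinearMap (α : V →L[ℝ] ℝ) (β : V [⋀^Fin k]→L[ℝ] ℝ)
    (L : W →L[ℝ] V) : (oneWedgeL α β).compContinuousLinearMap L =
      oneWedgeL (α.comp L) (β.compContinuousLinearMap L) := by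
  ext y
  simp only [compContinuousLinearMap_apply, oneWedgeL_apply, ContinuousLinearMap.comp_apply,
    Function.comp_apply]
  rfl

lemma oneWedgeL_smul (r : ℝ) (α : V →L[ℝ] ℝ) (β : V [⋀^Fin k]→L[ℝ] ℝ) :
    oneWedgeL (r • α) β = r • oneWedgeL α β := by
  simp [oneWedgeL]

/-- Double alternation kills $\alpha\otimes\alpha\otimes\beta$, which is symmetric in its first two
slots. -/
lemma oneWedgeL_oneWedgeL_self (α : V →L[ℝ] ℝ) (β : V [⋀^Fin k]→L[ℝ] ℝ) :
    oneWedgeL α (oneWedgeL α β) = 0 := by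
  have h := alternatizeUncurryFin_alternatizeUncurryFinCLM_comp_of_symmetric
    (f := α.smulRight (α.smulRight β)) (fun x y => by
      simp only [ContinuousLinearMap.smulRight_apply, _root_.smul_apply]
      rw [smul_comm])
  rw [← h, oneWedgeL_eq]
  congr 1
  ext x : 1
  simp [oneWedgeL_eq]

/-- The algebra behind $d(\alpha\wedge w)=-\alpha\wedge dw$ for constant $\alpha$, with $\gamma$ the
derivative of $w$. The sum of $\alpha\otimes\gamma$ and its transpose in the first two slots is
symmetric, so its double alternation vanishes; the two summands give the two sides. -/
lemma alternatizeUncurryFin_smulRightL_comp {F : Type*} [NormedAddCommGroup F] [NormedSpace ℝ F]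
    (α : V →L[ℝ] ℝ) (γ : V →L[ℝ] V [⋀^Fin k]→L[ℝ] F) :
    alternatizeUncurryFin ((alternatizeUncurryFinCLM ℝ V F ∘L
      ContinuousLinearMap.smulRightL ℝ V (V [⋀^Fin k]→L[ℝ] F) α) ∘L γ) =
      -alternatizeUncurryFin (α.smulRight (alternatizeUncurryFin γ)) := by
  have h := alternatizeUncurryFin_alternatizeUncurryFinCLM_comp_of_symmetric
    (f := α.smulRight γ + ContinuousLinearMap.smulRightL ℝ V (V [⋀^Fin k]→L[ℝ] F) α ∘L γ)
    (fun x y => by simp [add_comm])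
  have e : alternatizeUncurryFinCLM ℝ V F ∘L
      (α.smulRight γ + ContinuousLinearMap.smulRightL ℝ V (V [⋀^Fin k]→L[ℝ] F) α ∘L γ) =
      α.smulRight (alternatizeUncurryFin γ) + (alternatizeUncurryFinCLM ℝ V F ∘L
      ContinuousLinearMap.smulRightL ℝ V (V [⋀^Fin k]→L[ℝ] F) α) ∘L γ := by
    ext x : 1
    simp only [ContinuousLinearMap.comp_add, _root_.add_apply,
      ContinuousLinearMap.comp_apply, ContinuousLinearMap.smulRight_apply, map_smul]
    rfl
  rw [e, alternatizeUncurryFin_add] at h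
  exact eq_neg_of_add_eq_zero_right h

lemma alternatizeUncurryFin_oneWedgeL_comp (α : V →L[ℝ] ℝ) (γ : V →L[ℝ] V [⋀^Fin k]→L[ℝ] ℝ) :
    alternatizeUncurryFin ((oneWedgeL α).comp γ) = -oneWedgeL α (alternatizeUncurryFin γ) :=
  alternatizeUncurryFin_smulRightL_comp α γ

lemma extDeriv_smul_of_hasFDerivAt {f : V → ℝ} {f' : V →L[ℝ] ℝ} {w : V → V [⋀^Fin k]→L[ℝ] ℝ}
    {x : V} (hf : HasFDerivAt f f' x) (hw : DifferentiableAt ℝ w x) :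
    extDeriv (fun z => f z • w z) x = f x • extDeriv w x + oneWedgeL f' (w x) := by
  have h : fderiv ℝ (fun z => f z • w z) x = f x • fderiv ℝ w x + f'.smulRight (w x) :=
    (hf.smul hw.hasFDerivAt).fderiv
  rw [extDeriv, h, alternatizeUncurryFin_add, alternatizeUncurryFin_smul]
  rfl

lemma extDeriv_oneWedgeL (α : V →L[ℝ] ℝ) {w : V → V [⋀^Fin k]→L[ℝ] ℝ} {x : V}
    (hw : DifferentiableAt ℝ w x) :
    extDeriv (fun z => oneWedgeL α (w z)) x = -oneWedgeL α (extDeriv w x) := by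
  have h : fderiv ℝ (fun z => oneWedgeL α (w z)) x = (oneWedgeL α).comp (fderiv ℝ w x) :=
    ((oneWedgeL α).hasFDerivAt.comp x hw.hasFDerivAt).fderiv
  rw [extDeriv, h, alternatizeUncurryFin_oneWedgeL_comp]
  rfl

lemma extDeriv_comp_fst {w : V → V [⋀^Fin k]→L[ℝ] ℝ} {z : V × W}
    (hw : DifferentiableAt ℝ w z.1) :
    extDeriv (fun z : V × W => (w z.1).compContinuousLinearMap (ContinuousLinearMap.fst ℝ V W)) z =
      (extDeriv w z.1).compContinuousLinearMap (ContinuousLinearMap.fst ℝ V W) := by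
  have h := extDeriv_pullback (f := (Prod.fst : V × W → V)) (x := z) (r := ∞) hw
    contDiffAt_fst (by
      rw [minSmoothness_of_isRCLikeNormedField]; exact WithTop.coe_le_coe.2 le_top)
  simpa only [fderiv_fst] using h

/-- The form `g (b + ℓ s) ω` on `V × W`, where `s` is the coordinate on `W`. -/
def cylFun (g : ℝ → ℝ) (b : ℝ) (ℓ : W →L[ℝ] ℝ) (w : V → V [⋀^Fin k]→L[ℝ] ℝ) (z : V × W) :
    (V × W) [⋀^Fin k]→L[ℝ] ℝ :=
  g (b + ℓ z.2) • (w z.1).compContinuousLinearMap (ContinuousLinearMap.fst ℝ V W)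

/-- The form `g (b + ℓ s) ℓ ∧ ω` on `V × W`, where `s` is the coordinate on `W`. -/
def cylFunWedge (g : ℝ → ℝ) (b : ℝ) (ℓ : W →L[ℝ] ℝ) (w : V → V [⋀^Fin k]→L[ℝ] ℝ) (z : V × W) :
    (V × W) [⋀^Fin (k + 1)]→L[ℝ] ℝ :=
  oneWedgeL (ℓ.comp (ContinuousLinearMap.snd ℝ V W)) (cylFun g b ℓ w z)

variable {g : ℝ → ℝ} {b : ℝ} {ℓ : W →L[ℝ] ℝ} {w : V → V [⋀^Fin k]→L[ℝ] ℝ} {z : V × W}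

lemma differentiableAt_comp_fst (hw : DifferentiableAt ℝ w z.1) : DifferentiableAt ℝ
    (fun z : V × W => (w z.1).compContinuousLinearMap (ContinuousLinearMap.fst ℝ V W)) z :=
  (compContinuousLinearMapCLM (F := ℝ) (ι := Fin k)
    (ContinuousLinearMap.fst ℝ V W)).differentiableAt.comp z
    (hw.comp z differentiableAt_fst)

lemma hasFDerivAt_cylCoord (hg : Differentiable ℝ g) :
    HasFDerivAt (fun z : V × W => g (b + ℓ z.2))
      (deriv g (b + ℓ z.2) • ℓ.comp (ContinuousLinearMap.snd ℝ V W)) z := by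
  have h1 : HasFDerivAt (fun z : V × W => b + ℓ z.2)
      (ℓ.comp (ContinuousLinearMap.snd ℝ V W)) z :=
    (ℓ.hasFDerivAt.comp z hasFDerivAt_snd).const_add b
  exact (hg (b + ℓ z.2)).hasDerivAt.comp_hasFDerivAt z h1

lemma differentiableAt_cylFun (hg : Differentiable ℝ g) (hw : DifferentiableAt ℝ w z.1) :
    DifferentiableAt ℝ (cylFun g b ℓ w) z :=
  (hasFDerivAt_cylCoord hg).differentiableAt.smul (differentiableAt_comp_fst hw)

lemma differentiableAt_cylFunWedge (hg : Differentiable ℝ g) (hw : DifferentiableAt ℝ w z.1) :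
    DifferentiableAt ℝ (cylFunWedge g b ℓ w) z :=
  (oneWedgeL (ℓ.comp (ContinuousLinearMap.snd ℝ V W))).differentiableAt.comp z
    (differentiableAt_cylFun hg hw)

lemma contDiffOn_cylFun {s : Set V} (hg : ContDiff ℝ ∞ g) (hw : ContDiffOn ℝ ∞ w s) :
    ContDiffOn ℝ ∞ (cylFun g b ℓ w) (s ×ˢ univ) := by
  have h1 : ContDiff ℝ ∞ (fun z : V × W => g (b + ℓ z.2)) := by fun_prop
  refine h1.contDiffOn.smul ?_
  exact (compContinuousLinearMapCLM (F := ℝ) (ι := Fin k)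
    (ContinuousLinearMap.fst ℝ V W)).contDiff.comp_contDiffOn
    (hw.comp contDiffOn_fst fun z hz => hz.1)

lemma contDiffOn_cylFunWedge {s : Set V} (hg : ContDiff ℝ ∞ g) (hw : ContDiffOn ℝ ∞ w s) :
    ContDiffOn ℝ ∞ (cylFunWedge g b ℓ w) (s ×ˢ univ) :=
  (oneWedgeL (ℓ.comp (ContinuousLinearMap.snd ℝ V W))).contDiff.comp_contDiffOn
    (contDiffOn_cylFun hg hw)

lemma extDeriv_cylFun (hg : Differentiable ℝ g) (hw : DifferentiableAt ℝ w z.1) :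
    extDeriv (cylFun g b ℓ w) z =
      cylFunWedge (deriv g) b ℓ w z + cylFun g b ℓ (extDeriv w) z := by
  have h := extDeriv_smul_of_hasFDerivAt (hasFDerivAt_cylCoord (b := b) (ℓ := ℓ) (z := z) hg)
    (differentiableAt_comp_fst hw)
  rw [extDeriv_comp_fst hw, oneWedgeL_smul] at h
  rw [cylFunWedge, cylFun, map_smul, cylFun]
  exact h.trans (add_comm _ _)

lemma extDeriv_cylFunWedge (hg : Differentiable ℝ g) (hw : DifferentiableAt ℝ w z.1) :
    extDeriv (cylFunWedge g b ℓ w) z = -cylFunWedge g b ℓ (extDeriv w) z := by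
  have h := extDeriv_oneWedgeL (ℓ.comp (ContinuousLinearMap.snd ℝ V W))
    (differentiableAt_cylFun (b := b) (ℓ := ℓ) hg hw)
  rw [extDeriv_cylFun hg hw, map_add, cylFunWedge, oneWedgeL_oneWedgeL_self, zero_add] at h
  exact h

end WedgeCalculus

end

/-! ### Forms on the cylinder and their chart expressions -/

noncomputable section

section Cylinder

variable {E : Type*} [NormedAddCommGroup E] [NormedSpace ℝ E]
  {H : Type*} [TopologicalSpace H] {I : ModelWithCorners ℝ E H}
  {M : Type*} [TopologicalSpace M] [ChartedSpace H M] {k : ℕ}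

/-- The differential of the coordinate `t` on `[0, 1]`. -/
def dtAt (t : Icc (0 : ℝ) 1) : EuclideanSpace ℝ (Fin 1) →L[ℝ] ℝ :=
  mfderiv (𝓡∂ 1) 𝓘(ℝ, ℝ) (Subtype.val : Icc (0 : ℝ) 1 → ℝ) t

/-- The form `g(t) η` on `M × [0, 1]`. -/
def cylForm (g : ℝ → ℝ) (η : DForm I M k) : DForm (I.prod (𝓡∂ 1)) (M × Icc (0 : ℝ) 1) k :=
  fun p => (g p.2 • (η p.1 : E [⋀^Fin k]→L[ℝ] ℝ).compContinuousLinearMap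
    (ContinuousLinearMap.fst ℝ E (EuclideanSpace ℝ (Fin 1))) :
      (E × EuclideanSpace ℝ (Fin 1)) [⋀^Fin k]→L[ℝ] ℝ)

/-- The form `g(t) dt ∧ η` on `M × [0, 1]`. -/
def cylFormWedge (g : ℝ → ℝ) (η : DForm I M k) :
    DForm (I.prod (𝓡∂ 1)) (M × Icc (0 : ℝ) 1) (k + 1) :=
  fun p => (oneWedgeL ((dtAt p.2).comp
    (ContinuousLinearMap.snd ℝ E (EuclideanSpace ℝ (Fin 1)))) (cylForm g η p :
      (E × EuclideanSpace ℝ (Fin 1)) [⋀^Fin k]→L[ℝ] ℝ) :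
        (E × EuclideanSpace ℝ (Fin 1)) [⋀^Fin (k + 1)]→L[ℝ] ℝ)

/-- In a chart of `[0, 1]`, the coordinate `t` is affine. -/
lemma exists_affine_extChartAt_Icc_symm (t₀ : Icc (0 : ℝ) 1) :
    ∃ (b : ℝ) (ℓ : EuclideanSpace ℝ (Fin 1) →L[ℝ] ℝ),
      ∀ s ∈ (extChartAt (𝓡∂ 1) t₀).target, (((extChartAt (𝓡∂ 1) t₀).symm s : Icc (0 : ℝ) 1) : ℝ)
        = b + ℓ s := by
  by_cases h : (t₀ : ℝ) < 1
  -- The chart at a point $t_0<1$ is $s=t$; the chart at the endpoint $1$ is $s=1-t$.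
  · refine ⟨0, EuclideanSpace.proj 0, fun s hs => ?_⟩
    obtain ⟨⟨u, rfl⟩, hu⟩ :
        (∃ y, ⇑(𝓡∂ 1) y = s) ∧ ⇑(𝓡∂ 1).symm s ∈ (IccLeftChart 0 1).target := by
      simpa [h] using! hs
    have hu' : u ∈ (IccLeftChart 0 1).target := by
      simpa [modelWithCornersEuclideanHalfSpace_symm_apply, max_eq_left u.property] using! hu
    replace hu : u.val 0 ≤ 1 - 0 := le_of_lt hu'
    simp [h, modelWithCornersEuclideanHalfSpace_symm_apply, u.property,
      IccLeftChart_symm_apply_of_le hu]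
  · refine ⟨1, -EuclideanSpace.proj 0, fun s hs => ?_⟩
    obtain ⟨⟨u, rfl⟩, hu⟩ :
        (∃ y, ⇑(𝓡∂ 1) y = s) ∧ ⇑(𝓡∂ 1).symm s ∈ (IccRightChart 0 1).target := by
      simpa [h] using! hs
    have hu' : u ∈ (IccRightChart 0 1).target := by
      simpa [modelWithCornersEuclideanHalfSpace_symm_apply, max_eq_left u.property] using! hu
    replace hu : u.val 0 ≤ 1 - 0 := le_of_lt hu'
    simp [h, modelWithCornersEuclideanHalfSpace_symm_apply, u.property,
      IccRightChart_symm_apply_of_le hu]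
    ring

lemma mdifferentiableAt_subtypeVal_Icc (t : Icc (0 : ℝ) 1) :
    MDifferentiableAt (𝓡∂ 1) 𝓘(ℝ, ℝ) (Subtype.val : Icc (0 : ℝ) 1 → ℝ) t :=
  (contMDiff_subtypeVal_Icc (n := 1) t).mdifferentiableAt one_ne_zero

lemma dtAt_comp_mfderivWithin_symm {t₀ : Icc (0 : ℝ) 1} {b : ℝ}
    {ℓ : EuclideanSpace ℝ (Fin 1) →L[ℝ] ℝ}
    (h : ∀ s ∈ (extChartAt (𝓡∂ 1) t₀).target,
      (((extChartAt (𝓡∂ 1) t₀).symm s : Icc (0 : ℝ) 1) : ℝ) = b + ℓ s)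
    {s : EuclideanSpace ℝ (Fin 1)} (hs : s ∈ (extChartAt (𝓡∂ 1) t₀).target) :
    (dtAt ((extChartAt (𝓡∂ 1) t₀).symm s)).comp
      (mfderivWithin 𝓘(ℝ, EuclideanSpace ℝ (Fin 1)) (𝓡∂ 1) (extChartAt (𝓡∂ 1) t₀).symm
        (range (𝓡∂ 1)) s) = ℓ := by
  have hr : s ∈ range (𝓡∂ 1) := extChartAt_target_subset_range t₀ hs
  have hu : UniqueMDiffWithinAt 𝓘(ℝ, EuclideanSpace ℝ (Fin 1)) (range (𝓡∂ 1)) s :=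
    (𝓡∂ 1).uniqueMDiffOn s hr
  have h1 : HasMFDerivWithinAt 𝓘(ℝ, EuclideanSpace ℝ (Fin 1)) 𝓘(ℝ, ℝ)
      ((Subtype.val : Icc (0 : ℝ) 1 → ℝ) ∘ (extChartAt (𝓡∂ 1) t₀).symm) (range (𝓡∂ 1)) s
      ((dtAt ((extChartAt (𝓡∂ 1) t₀).symm s)).comp
      (mfderivWithin 𝓘(ℝ, EuclideanSpace ℝ (Fin 1)) (𝓡∂ 1) (extChartAt (𝓡∂ 1) t₀).symm
        (range (𝓡∂ 1)) s)) :=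
    HasMFDerivAt.comp_hasMFDerivWithinAt s (mdifferentiableAt_subtypeVal_Icc _).hasMFDerivAt
      (mdifferentiableWithinAt_extChartAt_symm hs).hasMFDerivWithinAt
  have h2 : HasFDerivWithinAt (fun s => b + ℓ s) ℓ (range (𝓡∂ 1)) s :=
    (ℓ.hasFDerivAt.const_add b).hasFDerivWithinAt
  have h3 : HasFDerivWithinAt ((Subtype.val : Icc (0 : ℝ) 1 → ℝ) ∘ (extChartAt (𝓡∂ 1) t₀).symm)
      ℓ (range (𝓡∂ 1)) s := by
    refine h2.congr_of_eventuallyEq ?_ (h s hs)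
    filter_upwards [extChartAt_target_mem_nhdsWithin_of_mem hs] with z hz using h z hz
  exact (hu.eq h1 h3.hasMFDerivWithinAt)

lemma mfderivWithin_extChartAt_prod_symm [IsManifold I 1 M] (p₀ : M × Icc (0 : ℝ) 1)
    {z : E × EuclideanSpace ℝ (Fin 1)} (hz : z ∈ (extChartAt (I.prod (𝓡∂ 1)) p₀).target) :
    mfderivWithin 𝓘(ℝ, E × EuclideanSpace ℝ (Fin 1)) (I.prod (𝓡∂ 1))
      (extChartAt (I.prod (𝓡∂ 1)) p₀).symm (range (I.prod (𝓡∂ 1))) z =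
    ((mfderivWithin 𝓘(ℝ, E) I (extChartAt I p₀.1).symm (range I) z.1).comp
      (ContinuousLinearMap.fst ℝ E (EuclideanSpace ℝ (Fin 1)))).prod
    ((mfderivWithin 𝓘(ℝ, EuclideanSpace ℝ (Fin 1)) (𝓡∂ 1) (extChartAt (𝓡∂ 1) p₀.2).symm
      (range (𝓡∂ 1)) z.2).comp (ContinuousLinearMap.snd ℝ E (EuclideanSpace ℝ (Fin 1)))) := by
  have hr : z ∈ range (I.prod (𝓡∂ 1)) := extChartAt_target_subset_range p₀ hz
  have hz' := hz
  rw [extChartAt_prod] at hz'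
  obtain ⟨hz1, hz2⟩ := hz'
  have hsub : range (I.prod (𝓡∂ 1)) ⊆ range I ×ˢ range (𝓡∂ 1) := by
    rw [modelWithCorners_prod_coe, range_prodMap]
  refine HasMFDerivWithinAt.mfderivWithin ?_ ((I.prod (𝓡∂ 1)).uniqueMDiffOn z hr)
  have h1 : HasMFDerivWithinAt 𝓘(ℝ, E × EuclideanSpace ℝ (Fin 1)) 𝓘(ℝ, E) Prod.fst
      (range (I.prod (𝓡∂ 1))) z (ContinuousLinearMap.fst ℝ E (EuclideanSpace ℝ (Fin 1))) :=
    hasFDerivWithinAt_fst.hasMFDerivWithinAt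
  have h2 : HasMFDerivWithinAt 𝓘(ℝ, E × EuclideanSpace ℝ (Fin 1))
      𝓘(ℝ, EuclideanSpace ℝ (Fin 1)) Prod.snd
      (range (I.prod (𝓡∂ 1))) z (ContinuousLinearMap.snd ℝ E (EuclideanSpace ℝ (Fin 1))) :=
    hasFDerivWithinAt_snd.hasMFDerivWithinAt
  have h3 := (mdifferentiableWithinAt_extChartAt_symm (I := I) hz1).hasMFDerivWithinAt
  have h4 := (mdifferentiableWithinAt_extChartAt_symm (I := 𝓡∂ 1) hz2).hasMFDerivWithinAt
  have h5 := (HasMFDerivWithinAt.comp z h3 h1 fun y hy => (hsub hy).1)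
  have h6 := (HasMFDerivWithinAt.comp z h4 h2 fun y hy => (hsub hy).2)
  have h7 := h5.prodMk h6
  rw [extChartAt_prod]
  exact h7

/-- Since $t$ is affine in the chart coordinate $s$, the chart expression of $g(t)\eta$ is given by
a formula that makes sense for all $s$, also beyond the boundary. This reduces smoothness and $d$ to
calculus on open sets. -/
lemma inChart_cylForm [IsManifold I 1 M] (g : ℝ → ℝ) (η : DForm I M k)
    (p₀ : M × Icc (0 : ℝ) 1) {b : ℝ} {ℓ : EuclideanSpace ℝ (Fin 1) →L[ℝ] ℝ}
    (h : ∀ s ∈ (extChartAt (𝓡∂ 1) p₀.2).target,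
      (((extChartAt (𝓡∂ 1) p₀.2).symm s : Icc (0 : ℝ) 1) : ℝ) = b + ℓ s)
    {z : E × EuclideanSpace ℝ (Fin 1)} (hz : z ∈ (extChartAt (I.prod (𝓡∂ 1)) p₀).target) :
    DForm.inChart (I.prod (𝓡∂ 1)) (cylForm g η) p₀ z =
      cylFun g b ℓ (DForm.inChart I η p₀.1) z := by
  have hz' := hz
  rw [extChartAt_prod] at hz'
  have hz2 : z.2 ∈ (extChartAt (𝓡∂ 1) p₀.2).target := hz'.2
  rw [DForm.inChart, mfderivWithin_extChartAt_prod_symm p₀ hz]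
  rw [cylFun, ← h z.2 hz2]
  rfl

lemma inChart_cylFormWedge [IsManifold I 1 M] (g : ℝ → ℝ) (η : DForm I M k)
    (p₀ : M × Icc (0 : ℝ) 1) {b : ℝ} {ℓ : EuclideanSpace ℝ (Fin 1) →L[ℝ] ℝ}
    (h : ∀ s ∈ (extChartAt (𝓡∂ 1) p₀.2).target,
      (((extChartAt (𝓡∂ 1) p₀.2).symm s : Icc (0 : ℝ) 1) : ℝ) = b + ℓ s)
    {z : E × EuclideanSpace ℝ (Fin 1)} (hz : z ∈ (extChartAt (I.prod (𝓡∂ 1)) p₀).target) :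
    DForm.inChart (I.prod (𝓡∂ 1)) (cylFormWedge g η) p₀ z =
      cylFunWedge g b ℓ (DForm.inChart I η p₀.1) z := by
  have hz' := hz
  rw [extChartAt_prod] at hz'
  have hz2 : z.2 ∈ (extChartAt (𝓡∂ 1) p₀.2).target := hz'.2
  have h1 := inChart_cylForm g η p₀ h hz
  rw [DForm.inChart, mfderivWithin_extChartAt_prod_symm p₀ hz] at h1
  rw [DForm.inChart, mfderivWithin_extChartAt_prod_symm p₀ hz, cylFunWedge, ← h1,
    ← dtAt_comp_mfderivWithin_symm h hz2]
  exact oneWedgeL_compContinuousLinearMap (V := E × EuclideanSpace ℝ (Fin 1))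
    (W := E × EuclideanSpace ℝ (Fin 1)) _ _ _

lemma extChartAt_prod_target_subset (p₀ : M × Icc (0 : ℝ) 1) :
    (extChartAt (I.prod (𝓡∂ 1)) p₀).target ⊆ (extChartAt I p₀.1).target ×ˢ univ := by
  rw [extChartAt_prod]
  exact fun z hz => ⟨hz.1, mem_univ _⟩

lemma isSmooth_cylForm [IsManifold I 1 M] {g : ℝ → ℝ} (hg : ContDiff ℝ ∞ g) {η : DForm I M k}
    (hη : DForm.IsSmooth I η) : DForm.IsSmooth (I.prod (𝓡∂ 1)) (cylForm g η) := by
  intro p₀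
  obtain ⟨b, ℓ, h⟩ := exists_affine_extChartAt_Icc_symm p₀.2
  exact ((contDiffOn_cylFun hg (hη p₀.1)).mono (extChartAt_prod_target_subset p₀)).congr
    fun z hz => inChart_cylForm g η p₀ h hz

lemma isSmooth_cylFormWedge [IsManifold I 1 M] {g : ℝ → ℝ} (hg : ContDiff ℝ ∞ g)
    {η : DForm I M k} (hη : DForm.IsSmooth I η) :
    DForm.IsSmooth (I.prod (𝓡∂ 1)) (cylFormWedge g η) := by
  intro p₀
  obtain ⟨b, ℓ, h⟩ := exists_affine_extChartAt_Icc_symm p₀.2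
  exact ((contDiffOn_cylFunWedge hg (hη p₀.1)).mono (extChartAt_prod_target_subset p₀)).congr
    fun z hz => inChart_cylFormWedge g η p₀ h hz

/-- At boundary points the one-sided derivative agrees with the full derivative of any
differentiable extension $w$ past the boundary, because the range of the model has unique
derivatives. -/
lemma extDerivWithin_range_eq_extDeriv {J : ModelWithCorners ℝ E H} {x : M}
    {η : DForm J M k} {w : E → E [⋀^Fin k]→L[ℝ] ℝ}
    (h : ∀ y ∈ (extChartAt J x).target, DForm.inChart J η x y = w y)
    (hw : DifferentiableAt ℝ w (extChartAt J x x)) :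
    extDerivWithin (DForm.inChart J η x) (range J) (extChartAt J x x) =
      extDeriv w (extChartAt J x x) := by
  have hu : UniqueDiffWithinAt ℝ (range J) (extChartAt J x x) :=
    J.uniqueDiffOn _ (mem_range_self _)
  have he : DForm.inChart J η x =ᶠ[𝓝[range J] (extChartAt J x x)] w := by
    filter_upwards [extChartAt_target_mem_nhdsWithin x] with y hy using h y hy
  rw [he.extDerivWithin_eq (h _ (mem_extChartAt_target x)), extDerivWithin, extDeriv,
    hw.fderivWithin hu]

namespace DForm

variable [I.Boundaryless]

lemma IsSmooth.differentiableAt_inChart {η : DForm I M k} (h : IsSmooth I η) (x : M) :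
    DifferentiableAt ℝ (inChart I η x) (extChartAt I x x) :=
  ((h x).contDiffAt (extChartAt_target_mem_nhds x)).differentiableAt (by simp)

/-- At the centre of a chart, the exterior derivative is the one computed in the chart. -/
lemma d_eq_extDeriv [IsManifold I 1 M] (η : DForm I M k) (x : M) :
    d I η x = (extDeriv (inChart I η x) (extChartAt I x x) : E [⋀^Fin (k + 1)]→L[ℝ] ℝ) := by
  rw [d, I.range_eq_univ, extDerivWithin_univ, mfderiv_extChartAt_self]
  rfl

end DForm

end Cylinder

end

/-! ### The exterior derivative on manifolds and on the cylinder -/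

section ExteriorDerivative

variable {E : Type*} [NormedAddCommGroup E] [NormedSpace ℝ E]
  {H : Type*} [TopologicalSpace H] {I : ModelWithCorners ℝ E H}
  {M : Type*} [TopologicalSpace M] [ChartedSpace H M] {k : ℕ}

namespace DForm

lemma IsSmooth.differentiableWithinAt_inChart {η : DForm I M k} (h : IsSmooth I η) (x : M) :
    DifferentiableWithinAt ℝ (inChart I η x) (range I) (extChartAt I x x) :=
  (((h x).differentiableOn (by simp)) _ (mem_extChartAt_target x)).mono_of_mem_nhdsWithin
    (extChartAt_target_mem_nhdsWithin x)

lemma d_eq_extDerivWithin [IsManifold I 1 M] (η : DForm I M k) (x : M) : d I η x =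
    (extDerivWithin (inChart I η x) (range I) (extChartAt I x x) : E [⋀^Fin (k + 1)]→L[ℝ] ℝ) := by
  rw [d, mfderiv_extChartAt_self]
  rfl

lemma d_add [IsManifold I 1 M] {η η' : DForm I M k} (h : IsSmooth I η) (h' : IsSmooth I η') :
    d I (η + η') = d I η + d I η' := by
  funext x
  rw [Pi.add_apply, d_eq_extDerivWithin, d_eq_extDerivWithin, d_eq_extDerivWithin]
  exact extDerivWithin_add (I.uniqueDiffOn _ (mem_range_self _))
    (h.differentiableWithinAt_inChart x) (h'.differentiableWithinAt_inChart x)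

lemma d_smul [IsManifold I 1 M] (r : ℝ) (η : DForm I M k) : d I (r • η) = r • d I η := by
  funext x
  rw [Pi.smul_apply, d_eq_extDerivWithin, d_eq_extDerivWithin]
  exact extDerivWithin_smul r (inChart I η x) (I.uniqueDiffOn _ (mem_range_self _))

lemma d_sub [IsManifold I 1 M] {η η' : DForm I M k} (h : IsSmooth I η) (h' : IsSmooth I η') :
    d I (η - η') = d I η - d I η' := by
  rw [eq_sub_iff_add_eq, ← d_add (h.sub h') h', sub_add_cancel]

lemma d_sum [IsManifold I 1 M] {ι : Type*} {s : Finset ι} {η : ι → DForm I M k}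
    (h : ∀ i ∈ s, IsSmooth I (η i)) : d I (∑ i ∈ s, η i) = ∑ i ∈ s, d I (η i) := by
  classical
  induction s using Finset.induction_on with
  | empty =>
    have : d I (0 : DForm I M k) = 0 := by
      simpa using d_smul (0 : ℝ) (0 : DForm I M k)
    simpa using this
  | insert a s ha ih =>
    rw [Finset.sum_insert ha, Finset.sum_insert ha,
      d_add (h a (by simp)) (IsSmooth.sum fun i hi => h i (by simp [hi])),
      ih fun i hi => h i (by simp [hi])]

lemma isClosed_iff {η : DForm I M k} : IsClosed I η ↔ d I η = 0 :=
  ⟨fun h => funext h, fun h x => congrFun h x⟩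

lemma inChart_self [IsManifold I 1 M] (η : DForm I M k) (x : M) :
    inChart I η x (extChartAt I x x) = (η x : E [⋀^Fin k]→L[ℝ] ℝ) := by
  rw [inChart_extChartAt η (mem_extChartAt_source x)]
  have h := mfderivWithin_extChartAt_symm_comp_mfderiv_extChartAt' (I := I)
    (mem_extChartAt_source (I := I) x)
  rw [mfderiv_extChartAt_self] at h
  have h' : mfderivWithin 𝓘(ℝ, E) I (extChartAt I x).symm (range I) (extChartAt I x x)
      = ContinuousLinearMap.id ℝ E := h
  rw [h']
  rfl

end DForm

variable [I.Boundaryless] [IsManifold I 1 M]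

lemma d_cylForm {g : ℝ → ℝ} (hg : ContDiff ℝ ∞ g) {η : DForm I M k}
    (hη : DForm.IsSmooth I η) : DForm.d (I.prod (𝓡∂ 1)) (cylForm g η) =
      cylFormWedge (deriv g) η + cylForm g (DForm.d I η) := by
  funext p
  obtain ⟨b, ℓ, h⟩ := exists_affine_extChartAt_Icc_symm p.2
  have hz : (extChartAt (I.prod (𝓡∂ 1)) p p).1 = extChartAt I p.1 p.1 := by
    rw [extChartAt_prod]; rfl
  have hη1 : DifferentiableAt ℝ (DForm.inChart I η p.1) (extChartAt (I.prod (𝓡∂ 1)) p p).1 := by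
    rw [hz]; exact hη.differentiableAt_inChart p.1
  have hg1 : Differentiable ℝ g := hg.differentiable (by simp)
  rw [DForm.d_eq_extDerivWithin, extDerivWithin_range_eq_extDeriv
    (fun y hy => inChart_cylForm g η p h hy) (differentiableAt_cylFun hg1 hη1),
    extDeriv_cylFun hg1 hη1, ← inChart_cylFormWedge _ _ _ h (mem_extChartAt_target p),
    DForm.inChart_self]
  -- The chart at $p$ is used only at its centre, where its derivative is the identity and `DForm.d`
  -- is the exterior derivative of the chart expression.
  have e : cylFun g b ℓ (extDeriv (DForm.inChart I η p.1)) (extChartAt (I.prod (𝓡∂ 1)) p p) =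
      cylFun g b ℓ (DForm.inChart I (DForm.d I η) p.1) (extChartAt (I.prod (𝓡∂ 1)) p p) := by
    rw [cylFun, cylFun, hz, DForm.inChart_self, DForm.d_eq_extDeriv]
  rw [e, ← inChart_cylForm _ _ _ h (mem_extChartAt_target p), DForm.inChart_self]
  rfl

lemma d_cylFormWedge {g : ℝ → ℝ} (hg : ContDiff ℝ ∞ g) {η : DForm I M k}
    (hη : DForm.IsSmooth I η) : DForm.d (I.prod (𝓡∂ 1)) (cylFormWedge g η) =
      -cylFormWedge g (DForm.d I η) := by
  funext p
  obtain ⟨b, ℓ, h⟩ := exists_affine_extChartAt_Icc_symm p.2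
  have hz : (extChartAt (I.prod (𝓡∂ 1)) p p).1 = extChartAt I p.1 p.1 := by
    rw [extChartAt_prod]; rfl
  have hη1 : DifferentiableAt ℝ (DForm.inChart I η p.1) (extChartAt (I.prod (𝓡∂ 1)) p p).1 := by
    rw [hz]; exact hη.differentiableAt_inChart p.1
  have hg1 : Differentiable ℝ g := hg.differentiable (by simp)
  rw [DForm.d_eq_extDerivWithin, extDerivWithin_range_eq_extDeriv
    (fun y hy => inChart_cylFormWedge g η p h hy) (differentiableAt_cylFunWedge hg1 hη1),
    extDeriv_cylFunWedge hg1 hη1]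
  have e : cylFunWedge g b ℓ (extDeriv (DForm.inChart I η p.1))
      (extChartAt (I.prod (𝓡∂ 1)) p p) = cylFunWedge g b ℓ (DForm.inChart I (DForm.d I η) p.1)
      (extChartAt (I.prod (𝓡∂ 1)) p p) := by
    rw [cylFunWedge, cylFunWedge, cylFun, cylFun, hz, DForm.inChart_self, DForm.d_eq_extDeriv]
  rw [e, ← inChart_cylFormWedge _ _ _ h (mem_extChartAt_target p), DForm.inChart_self]
  rfl

end ExteriorDerivative

/-! ### Volume forms and the product orientation -/

noncomputable section

section VolumeForms

variable {V : Type*} [AddCommGroup V] [Module ℝ V]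

open AlternatingMap

lemma isPosOriented_ray_iff {n : ℕ} [NeZero n] (hV : finrank ℝ V = n) {vol : V [⋀^Fin n]→ₗ[ℝ] ℝ}
    (hvol : vol ≠ 0) (y : Fin n → V) :
    IsPosOriented (rayOfNeZero ℝ vol hvol) y ↔ 0 < vol y := by
  constructor
  · rintro ⟨b, rfl, h⟩
    rw [Basis.orientation, ray_eq_iff] at h
    obtain ⟨r₁, r₂, h1, h2, h3⟩ := h.exists_pos b.det_ne_zero hvol
    have h4 : r₁ = r₂ * vol b := by
      simpa [b.det_self] using congrArg (fun f => f b) h3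
    exact pos_of_mul_pos_right (h4 ▸ h1) h2.le
  · intro h
    have hli : LinearIndependent ℝ y := by
      by_contra hc
      exact h.ne' (vol.map_linearDependent y hc)
    have : Nonempty (Fin n) := ⟨0⟩
    refine ⟨basisOfLinearIndependentOfCardEqFinrank hli (by simp [hV]), by simp, ?_⟩
    set b := basisOfLinearIndependentOfCardEqFinrank hli (by simp [hV]) with hb
    rw [Basis.orientation, ray_eq_iff, vol.eq_smul_basis_det b]
    refine SameRay.sameRay_pos_smul_right _ ?_
    simpa [hb] using h

lemma AlternatingMap.oneWedge_cons {n : ℕ} (α : V →ₗ[ℝ] ℝ) (β : V [⋀^Fin n]→ₗ[ℝ] ℝ) (a : V)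
    {x : Fin n → V} (h : ∀ i, α (x i) = 0) :
    oneWedge α β (Fin.cons a x) = α a * β x := by
  rw [oneWedge_apply, Fin.sum_univ_succ]
  simp [h]

end VolumeForms

section CylinderOrientation

variable {E : Type*} [NormedAddCommGroup E] [NormedSpace ℝ E]
  {H : Type*} [TopologicalSpace H] {I : ModelWithCorners ℝ E H}
  {M : Type*} [TopologicalSpace M] [ChartedSpace H M] {n : ℕ}

open AlternatingMap

lemma dtAt_one (t : Icc (0 : ℝ) 1) : dtAt t (oneTangentSpaceIcc t) = 1 :=
  mfderiv_subtypeVal_Icc_one t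

lemma eq_dtAt_smul_one (t : Icc (0 : ℝ) 1) (s : EuclideanSpace ℝ (Fin 1)) :
    s = dtAt t s • (oneTangentSpaceIcc t : EuclideanSpace ℝ (Fin 1)) := by
  set e : EuclideanSpace ℝ (Fin 1) := oneTangentSpaceIcc t with he
  have h1 : dtAt t e = 1 := dtAt_one t
  set a : EuclideanSpace ℝ (Fin 1) := EuclideanSpace.single 0 1 with ha
  have h2 : ∀ s : EuclideanSpace ℝ (Fin 1), s = s 0 • a := by
    intro s
    ext i
    rw [Subsingleton.elim i 0]
    simp [ha]
  have h3 : e 0 * dtAt t a = 1 := by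
    rw [← h1]
    conv_rhs => rw [h2 e, map_smul, smul_eq_mul]
  have h4 : dtAt t s = s 0 * dtAt t a := by
    conv_lhs => rw [h2 s, map_smul, smul_eq_mul]
  rw [h4]
  ext i
  rw [Subsingleton.elim i 0]
  change s 0 = (s 0 * dtAt t a) * e 0
  linear_combination (-s 0) * h3

/-- The form `α ∧ β` on `V × W` for a 1-form `α` on `W` and an `n`-form `β` on `V`. -/
def prodVol {V W : Type*} [AddCommGroup V] [Module ℝ V] [AddCommGroup W] [Module ℝ W]
    (α : W →ₗ[ℝ] ℝ) (β : V [⋀^Fin n]→ₗ[ℝ] ℝ) : (V × W) [⋀^Fin (n + 1)]→ₗ[ℝ] ℝ :=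
  oneWedge (α ∘ₗ LinearMap.snd ℝ V W) (β.compLinearMap (LinearMap.fst ℝ V W))

lemma prodVol_cons {V W : Type*} [AddCommGroup V] [Module ℝ V] [AddCommGroup W] [Module ℝ W]
    (α : W →ₗ[ℝ] ℝ) (β : V [⋀^Fin n]→ₗ[ℝ] ℝ) (s : W) (v : Fin n → V) :
    prodVol α β (Fin.cons (0, s) fun i => (v i, 0)) = α s * β v := by
  rw [prodVol, oneWedge_cons _ _ _ (fun i => by simp)]
  rfl

lemma prodVol_ne_zero {V W : Type*} [AddCommGroup V] [Module ℝ V] [AddCommGroup W] [Module ℝ W]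
    {α : W →ₗ[ℝ] ℝ} {β : V [⋀^Fin n]→ₗ[ℝ] ℝ} (hα : α ≠ 0) (hβ : β ≠ 0) : prodVol α β ≠ 0 := by
  intro h
  apply hα
  ext s
  by_contra hs
  apply hβ
  ext v
  have h1 := prodVol_cons α β s v
  rw [h] at h1
  exact (mul_eq_zero.1 h1.symm).resolve_left hs

/-- A positive basis of the tangent space. -/
def posBasis [NeZero n] (hE : finrank ℝ E = n) (o : ManifoldOrientation I M n) (x : M) :
    Basis (Fin n) ℝ (TangentSpace I x) :=
  Classical.choose (exists_basis_orientation_eq (V := TangentSpace I x) hE (o.at' x))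

lemma posBasis_orientation [NeZero n] (hE : finrank ℝ E = n) (o : ManifoldOrientation I M n)
    (x : M) : (posBasis hE o x).orientation = o.at' x :=
  Classical.choose_spec (exists_basis_orientation_eq (V := TangentSpace I x) hE (o.at' x))

lemma isPosOriented_iff_posBasis [NeZero n] (hE : finrank ℝ E = n) (o : ManifoldOrientation I M n)
    (x : M) (v : Fin n → TangentSpace I x) :
    IsPosOriented (o.at' x) v ↔ 0 < (posBasis hE o x).det v := by
  rw [← isPosOriented_basis_iff, posBasis_orientation]

/-- A positive volume form on `M × [0, 1]`. -/
def cylVol [NeZero n] (hE : finrank ℝ E = n) (o : ManifoldOrientation I M n)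
    (p : M × Icc (0 : ℝ) 1) : (E × EuclideanSpace ℝ (Fin 1)) [⋀^Fin (n + 1)]→ₗ[ℝ] ℝ :=
  prodVol (dtAt p.2 : EuclideanSpace ℝ (Fin 1) →ₗ[ℝ] ℝ)
    ((posBasis hE o p.1).det : E [⋀^Fin n]→ₗ[ℝ] ℝ)

lemma dtAt_ne_zero (t : Icc (0 : ℝ) 1) : (dtAt t : EuclideanSpace ℝ (Fin 1) →ₗ[ℝ] ℝ) ≠ 0 := by
  intro h
  have h1 := dtAt_one t
  have h2 : dtAt t (oneTangentSpaceIcc t) = 0 := LinearMap.congr_fun h _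
  rw [h1] at h2
  exact one_ne_zero h2

lemma cylVol_ne_zero [NeZero n] (hE : finrank ℝ E = n) (o : ManifoldOrientation I M n)
    (p : M × Icc (0 : ℝ) 1) : cylVol hE o p ≠ 0 :=
  prodVol_ne_zero (dtAt_ne_zero _) (posBasis hE o p.1).det_ne_zero

lemma finrank_prod_euclidean [NeZero n] (hE : finrank ℝ E = n) :
    finrank ℝ (E × EuclideanSpace ℝ (Fin 1)) = n + 1 := by
  have : Module.Finite ℝ E := Module.finite_of_finrank_pos (hE ▸ Nat.pos_of_ne_zero (NeZero.ne n))
  simp [hE]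

variable [IsManifold I 1 M]

/-- Obtained by inverting the formula for the derivative of the inverse chart,
`mfderivWithin_extChartAt_prod_symm`. -/
lemma mfderiv_extChartAt_prod (p₀ : M × Icc (0 : ℝ) 1) {p : M × Icc (0 : ℝ) 1}
    (hp : p ∈ (extChartAt (I.prod (𝓡∂ 1)) p₀).source) (v : E) (s : EuclideanSpace ℝ (Fin 1)) :
    mfderiv (I.prod (𝓡∂ 1)) 𝓘(ℝ, E × EuclideanSpace ℝ (Fin 1))
      (extChartAt (I.prod (𝓡∂ 1)) p₀) p (v, s) =
    (mfderiv I 𝓘(ℝ, E) (extChartAt I p₀.1) p.1 v,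
      mfderiv (𝓡∂ 1) 𝓘(ℝ, EuclideanSpace ℝ (Fin 1)) (extChartAt (𝓡∂ 1) p₀.2) p.2 s) := by
  have hz := (extChartAt (I.prod (𝓡∂ 1)) p₀).map_source hp
  have hp' := hp
  rw [extChartAt_prod] at hp'
  obtain ⟨hp1, hp2⟩ := hp'
  have hp1 : p.1 ∈ (extChartAt I p₀.1).source := hp1
  have hp2 : p.2 ∈ (extChartAt (𝓡∂ 1) p₀.2).source := hp2
  obtain ⟨L, hL, hL'⟩ := exists_chartEquiv hp
  obtain ⟨L₁, hL₁, hL₁'⟩ := exists_chartEquiv (I := I) hp1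
  obtain ⟨L₂, hL₂, hL₂'⟩ := exists_chartEquiv (I := 𝓡∂ 1) hp2
  have e1 : (extChartAt (I.prod (𝓡∂ 1)) p₀ p).1 = extChartAt I p₀.1 p.1 := by
    rw [extChartAt_prod]; rfl
  have e2 : (extChartAt (I.prod (𝓡∂ 1)) p₀ p).2 = extChartAt (𝓡∂ 1) p₀.2 p.2 := by
    rw [extChartAt_prod]; rfl
  have key : ∀ w : E × EuclideanSpace ℝ (Fin 1), L.symm w = (L₁.symm w.1, L₂.symm w.2) := by
    intro w
    rw [hL', mfderivWithin_extChartAt_prod_symm p₀ hz, hL₁', hL₂', ← e1, ← e2]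
    rfl
  have h1 : L (v, s) = (L₁ v, L₂ s) := by
    apply L.symm.injective
    have h2 : ((L₁.symm (L₁ v), L₂.symm (L₂ s)) : E × EuclideanSpace ℝ (Fin 1)) = (v, s) :=
      congrArg₂ Prod.mk (L₁.symm_apply_apply v) (L₂.symm_apply_apply s)
    exact (L.symm_apply_apply (v, s)).trans (h2.symm.trans (key (L₁ v, L₂ s)).symm)
  exact (hL (v, s)).symm.trans (h1.trans (Prod.ext (hL₁ v) (hL₂ s)))

lemma dtAt_eq_comp_mfderiv {t₀ : Icc (0 : ℝ) 1} {b : ℝ} {ℓ : EuclideanSpace ℝ (Fin 1) →L[ℝ] ℝ}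
    (h : ∀ s ∈ (extChartAt (𝓡∂ 1) t₀).target,
      (((extChartAt (𝓡∂ 1) t₀).symm s : Icc (0 : ℝ) 1) : ℝ) = b + ℓ s)
    {t : Icc (0 : ℝ) 1} (ht : t ∈ (extChartAt (𝓡∂ 1) t₀).source)
    (s : EuclideanSpace ℝ (Fin 1)) :
    dtAt t s = ℓ (mfderiv (𝓡∂ 1) 𝓘(ℝ, EuclideanSpace ℝ (Fin 1)) (extChartAt (𝓡∂ 1) t₀) t s) := by
  obtain ⟨L, hL, hL'⟩ := exists_chartEquiv (I := 𝓡∂ 1) ht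
  have h1 := dtAt_comp_mfderivWithin_symm h ((extChartAt (𝓡∂ 1) t₀).map_source ht)
  rw [(extChartAt (𝓡∂ 1) t₀).left_inv ht] at h1
  have h2 : ℓ (L s) = dtAt t (L.symm (L s)) := by
    rw [hL', ← h1]
    rfl
  exact (h2.trans (congrArg (dtAt t) (L.symm_apply_apply s))).symm.trans (congrArg ℓ (hL s))

/-- The product orientation of `M × [0, 1]`. -/
def cylOrientation [NeZero n] (hE : finrank ℝ E = n) (o : ManifoldOrientation I M n) :
    ManifoldOrientation (I.prod (𝓡∂ 1)) (M × Icc (0 : ℝ) 1) (n + 1) where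
  at' p := (rayOfNeZero ℝ (cylVol hE o p) (cylVol_ne_zero hE o p) :
    Orientation ℝ (E × EuclideanSpace ℝ (Fin 1)) (Fin (n + 1)))
  locally_constant := by
    intro p₀
    obtain ⟨c, hc⟩ := o.locally_constant p₀.1
    obtain ⟨bc, rfl⟩ := exists_basis_orientation_eq hE c
    obtain ⟨b, ℓ, h⟩ := exists_affine_extChartAt_Icc_symm p₀.2
    have hℓ : (ℓ : EuclideanSpace ℝ (Fin 1) →ₗ[ℝ] ℝ) ≠ 0 := by
      intro h0
      refine dtAt_ne_zero p₀.2 (LinearMap.ext fun s => ?_)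
      have h1 := dtAt_eq_comp_mfderiv h (mem_extChartAt_source p₀.2) s
      exact h1.trans (LinearMap.congr_fun h0 _)
    refine ⟨rayOfNeZero ℝ (prodVol (ℓ : EuclideanSpace ℝ (Fin 1) →ₗ[ℝ] ℝ) bc.det)
      (prodVol_ne_zero hℓ bc.det_ne_zero), ?_⟩
    filter_upwards [extChartAt_source_mem_nhds (I := I.prod (𝓡∂ 1)) p₀,
      continuousAt_fst.eventually hc] with p hp hcp v
    have hp' := hp
    rw [extChartAt_prod] at hp'
    have hp2 : p.2 ∈ (extChartAt (𝓡∂ 1) p₀.2).source := hp'.2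
    let D₀ : E →L[ℝ] E := mfderiv I 𝓘(ℝ, E) (extChartAt I p₀.1) p.1
    let D : E →ₗ[ℝ] E := D₀
    let D' : EuclideanSpace ℝ (Fin 1) →L[ℝ] EuclideanSpace ℝ (Fin 1) :=
      mfderiv (𝓡∂ 1) 𝓘(ℝ, EuclideanSpace ℝ (Fin 1)) (extChartAt (𝓡∂ 1) p₀.2) p.2
    set B : Basis (Fin n) ℝ E := posBasis hE o p.1 with hB
    have hdet : ∀ y : Fin n → E, bc.det (fun i => D (y i)) = bc.det (fun i => D (B i)) * B.det y :=
      fun y => apply_eq_mul_det B (bc.det.compLinearMap D) y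
    -- The basis `posBasis` is chosen pointwise with no continuity, but only its sign matters: by
    -- the orientation of $M$ near $p_0$, the chart carries it to a positive multiple of the fixed
    -- volume form.
    have hr : 0 < bc.det (fun i => D (B i)) := by
      rw [← isPosOriented_basis_iff]
      exact (hcp _).1 ⟨posBasis hE o p.1, rfl, posBasis_orientation hE o p.1⟩
    have hdt : ∀ s, dtAt p.2 s = ℓ (D' s) := fun s => dtAt_eq_comp_mfderiv h hp2 s
    have key : ∀ v : Fin (n + 1) → E × EuclideanSpace ℝ (Fin 1),
        prodVol (ℓ : EuclideanSpace ℝ (Fin 1) →ₗ[ℝ] ℝ) bc.det (fun i => (D (v i).1, D' (v i).2)) =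
          bc.det (fun i => D (B i)) * cylVol hE o p v := by
      intro v
      simp only [prodVol, cylVol, oneWedge_apply, Finset.mul_sum]
      refine Finset.sum_congr rfl fun i _ => ?_
      have h1 := hdet fun j => (i.removeNth v j).1
      have h2 := hdt (v i).2
      simp only [LinearMap.comp_apply, LinearMap.snd_apply, ContinuousLinearMap.coe_coe,
        compLinearMap_apply]
      rw [h2]
      have h3 : (bc.det fun j => (LinearMap.fst ℝ E (EuclideanSpace ℝ (Fin 1)))
          (i.removeNth (fun i => (D (v i).1, D' (v i).2)) j)) =
          bc.det fun j => D ((i.removeNth v j).1) := rfl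
      rw [h3, h1]
      change _ = _ * (_ * (_ * B.det fun j => (i.removeNth v j).1))
      ring
    have hv : (fun i => (mfderiv (I.prod (𝓡∂ 1)) 𝓘(ℝ, E × EuclideanSpace ℝ (Fin 1))
        (extChartAt (I.prod (𝓡∂ 1)) p₀) p (v i) : E × EuclideanSpace ℝ (Fin 1))) =
        fun i => (D (v i).1, D' (v i).2) :=
      funext fun i => mfderiv_extChartAt_prod p₀ hp (v i).1 (v i).2
    rw [hv, isPosOriented_ray_iff (finrank_prod_euclidean hE)]
    refine (isPosOriented_ray_iff (finrank_prod_euclidean hE) (cylVol_ne_zero hE o p) v).trans ?_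
    exact (mul_pos_iff_of_pos_left hr).symm.trans (by rw [← key v])

lemma isPosOriented_cylOrientation_iff [NeZero n] (hE : finrank ℝ E = n)
    (o : ManifoldOrientation I M n) (p : M × Icc (0 : ℝ) 1)
    (v : Fin n → TangentSpace I p.1) :
    IsPosOriented ((cylOrientation hE o).at' p)
      (Fin.cons ((0, oneTangentSpaceIcc p.2) : E × EuclideanSpace ℝ (Fin 1))
        (fun i => ((v i, 0) : E × EuclideanSpace ℝ (Fin 1))) :
          Fin (n + 1) → E × EuclideanSpace ℝ (Fin 1)) ↔ IsPosOriented (o.at' p.1) v := by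
  refine (isPosOriented_ray_iff (finrank_prod_euclidean hE) (cylVol_ne_zero hE o p) _).trans ?_
  have h1 : cylVol hE o p (Fin.cons ((0, oneTangentSpaceIcc p.2) : E × EuclideanSpace ℝ (Fin 1))
      (fun i => ((v i, 0) : E × EuclideanSpace ℝ (Fin 1)))) =
      dtAt p.2 (oneTangentSpaceIcc p.2) * (posBasis hE o p.1).det v := prodVol_cons _ _ _ _
  rw [h1, dtAt_one, one_mul, isPosOriented_iff_posBasis hE]

end CylinderOrientation

end

/-! ### Positivity of $\rho+dt\wedge\eta$ and evaluation of cylinder forms -/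

noncomputable section

section PositiveProduct

variable {E : Type*} [NormedAddCommGroup E] [NormedSpace ℝ E]
  {H : Type*} [TopologicalSpace H] {I : ModelWithCorners ℝ E H}
  {M : Type*} [TopologicalSpace M] [ChartedSpace H M] {k : ℕ}

lemma isCompl_span_oneTangentSpaceIcc_range_inl (t : Icc (0 : ℝ) 1) :
    IsCompl (Submodule.span ℝ {((0, oneTangentSpaceIcc t) : E × EuclideanSpace ℝ (Fin 1))})
      (LinearMap.range (LinearMap.inl ℝ E (EuclideanSpace ℝ (Fin 1)))) := by
  constructor
  · rw [Submodule.disjoint_def]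
    rintro x hx ⟨v, rfl⟩
    obtain ⟨c, hc⟩ := Submodule.mem_span_singleton.1 hx
    have : v = 0 := by simpa using (congrArg Prod.fst hc).symm
    rw [this, map_zero]
  · rw [codisjoint_iff, eq_top_iff]
    rintro ⟨v, s⟩ -
    have h : ((v, s) : E × EuclideanSpace ℝ (Fin 1)) =
        dtAt t s • ((0, oneTangentSpaceIcc t) : E × EuclideanSpace ℝ (Fin 1)) +
          LinearMap.inl ℝ E (EuclideanSpace ℝ (Fin 1)) v := by
      refine Prod.ext ?_ ?_
      · simp
      · exact (eq_dtAt_smul_one t s).trans (add_zero _).symm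
    rw [h]
    exact Submodule.add_mem_sup (Submodule.smul_mem _ _ (Submodule.mem_span_singleton_self _))
      (LinearMap.mem_range_self _ v)

/-- The 3-form `ρ + dt ∧ η` is positive if `ρ` is definite and tamed by `η`. -/
lemma isPositiveForm_cylOrientation [IsManifold I 1 M] (hE : finrank ℝ E = 6)
    (o : ManifoldOrientation I M 6) (p : M × Icc (0 : ℝ) 1)
    {φ : (E × EuclideanSpace ℝ (Fin 1)) [⋀^Fin 3]→ₗ[ℝ] ℝ}
    {ρ : E [⋀^Fin 3]→ₗ[ℝ] ℝ} {η : E [⋀^Fin 2]→ₗ[ℝ] ℝ}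
    (hρ : ∀ v : Fin 3 → E, φ (fun i => (v i, 0)) = ρ v)
    (hη : ∀ v : Fin 2 → E, φ (Fin.cons (0, oneTangentSpaceIcc p.2) fun i => (v i, 0)) = η v)
    (h : IsTamedPair (o.at' p.1 : Orientation ℝ E (Fin 6)) ρ η) :
    IsPositiveForm ((cylOrientation hE o).at' p :
      Orientation ℝ (E × EuclideanSpace ℝ (Fin 1)) (Fin 7)) φ := by
  set P := LinearMap.range (LinearMap.inl ℝ E (EuclideanSpace ℝ (Fin 1))) with hP
  let L : E ≃ₗ[ℝ] P := LinearEquiv.ofInjective _ LinearMap.inl_injective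
  have hL : ∀ x : P, (x : E × EuclideanSpace ℝ (Fin 1)) = (L.symm x, 0) := by
    intro x
    obtain ⟨v, rfl⟩ := L.surjective x
    rw [L.symm_apply_apply]
    rfl
  let B : Basis (Fin 6) ℝ E := posBasis hE o p.1
  have hB : ∀ y : Fin 6 → E, IsPosOriented (o.at' p.1 : Orientation ℝ E (Fin 6)) y ↔
    0 < B.det y := isPosOriented_iff_posBasis hE o p.1
  have hBL : ∀ y : Fin 6 → P, IsPosOriented (B.map L).orientation y ↔
      IsPosOriented (o.at' p.1 : Orientation ℝ E (Fin 6)) (L.symm ∘ y) := by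
    intro y
    refine Iff.trans ?_ (hB _).symm
    rw [isPosOriented_basis_iff, Basis.det_map]
    rfl
  have hν : ((0, oneTangentSpaceIcc p.2) : E × EuclideanSpace ℝ (Fin 1)) ≠ 0 := by
    intro h0
    have h1 : dtAt p.2 (oneTangentSpaceIcc p.2) = dtAt p.2 0 :=
      congrArg (dtAt p.2) (congrArg Prod.snd h0)
    rw [dtAt_one, map_zero] at h1
    exact one_ne_zero h1
  refine isPositiveForm_of_isTamedPair (finrank_prod_euclidean hE) hν
    (isCompl_span_oneTangentSpaceIcc_range_inl p.2) (oP := (B.map L).orientation) ?_ ?_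
  · intro x
    rw [hBL]
    refine (isPosOriented_cylOrientation_iff hE o p (L.symm ∘ x)).symm.trans ?_
    have hx : (fun i => (x i : E × EuclideanSpace ℝ (Fin 1))) = fun i => (L.symm (x i), 0) :=
      funext fun i => hL (x i)
    rw [hx]
    rfl
  · have h1 := h.compLinearEquiv L.symm (fun y hy => (hBL y).1 hy)
    convert h1 using 1
    · ext y
      refine Eq.trans (congrArg φ (funext fun i => hL (y i))) (hρ fun i => L.symm (y i))
    · ext y
      refine Eq.trans (congrArg φ ?_) (hη fun i => L.symm (y i))
      refine congrArg _ (funext fun i => hL (y i))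

lemma oneWedgeL_cons {V : Type*} [NormedAddCommGroup V] [NormedSpace ℝ V] (α : V →L[ℝ] ℝ)
    (β : V [⋀^Fin k]→L[ℝ] ℝ) (a : V) {x : Fin k → V} (h : ∀ i, α (x i) = 0) :
    oneWedgeL α β (Fin.cons a x) = α a * β x := by
  rw [oneWedgeL_apply, Fin.sum_univ_succ]
  simp [h]

lemma cylForm_apply_inl (g : ℝ → ℝ) (η : DForm I M k) (p : M × Icc (0 : ℝ) 1) (v : Fin k → E) :
    cylForm g η p (fun i => ((v i, 0) : E × EuclideanSpace ℝ (Fin 1))) = g p.2 * η p.1 v := rfl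

lemma cylFormWedge_apply_inl (g : ℝ → ℝ) (η : DForm I M k) (p : M × Icc (0 : ℝ) 1)
    (v : Fin (k + 1) → E) :
    cylFormWedge g η p (fun i => ((v i, 0) : E × EuclideanSpace ℝ (Fin 1))) = 0 := by
  refine (oneWedgeL_apply _ _ _).trans (Finset.sum_eq_zero fun i _ => ?_)
  simp

lemma cylForm_apply_cons (g : ℝ → ℝ) (η : DForm I M (k + 1)) (p : M × Icc (0 : ℝ) 1)
    (s : EuclideanSpace ℝ (Fin 1)) (v : Fin k → E) :
    cylForm g η p (Fin.cons ((0, s) : E × EuclideanSpace ℝ (Fin 1))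
      fun i => ((v i, 0) : E × EuclideanSpace ℝ (Fin 1))) = 0 := by
  have h : (η p.1 : E [⋀^Fin (k + 1)]→L[ℝ] ℝ) (fun i =>
      ((Fin.cons ((0, s) : E × EuclideanSpace ℝ (Fin 1))
      fun i => ((v i, 0) : E × EuclideanSpace ℝ (Fin 1)) :
        Fin (k + 1) → E × EuclideanSpace ℝ (Fin 1)) i).1) = 0 :=
    ContinuousAlternatingMap.map_coord_zero _ 0 rfl
  exact (congrArg (g p.2 * ·) h).trans (mul_zero _)

lemma cylFormWedge_apply_cons (g : ℝ → ℝ) (η : DForm I M k) (p : M × Icc (0 : ℝ) 1)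
    (v : Fin k → E) :
    cylFormWedge g η p (Fin.cons ((0, oneTangentSpaceIcc p.2) : E × EuclideanSpace ℝ (Fin 1))
      fun i => ((v i, 0) : E × EuclideanSpace ℝ (Fin 1))) = g p.2 * η p.1 v := by
  have h0 : ∀ i, ((dtAt p.2).comp (ContinuousLinearMap.snd ℝ E (EuclideanSpace ℝ (Fin 1))))
      (v i, 0) = 0 := fun i => map_zero (dtAt p.2)
  refine (oneWedgeL_cons _ _ ((0, oneTangentSpaceIcc p.2) :
      E × EuclideanSpace ℝ (Fin 1)) h0).trans ?_
  have h1 : dtAt p.2 (oneTangentSpaceIcc p.2 : EuclideanSpace ℝ (Fin 1)) = 1 := dtAt_one p.2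
  refine (congrArg (· * _) h1).trans ((one_mul _).trans ?_)
  exact cylForm_apply_inl g η p v

lemma isContinuousPath_sum_smul [I.Boundaryless] {ι : Type*} {s : Finset ι} {g : ι → ℝ → ℝ}
    (hg : ∀ i ∈ s, Continuous (g i)) {η : ι → DForm I M k} (hη : ∀ i ∈ s, DForm.IsSmooth I (η i)) :
    DForm.IsContinuousPath I fun t => ∑ i ∈ s, g i t • η i := by
  intro x₀
  simp only [DForm.inChart_sum, DForm.inChart_smul]
  refine continuousOn_finsetSum _ fun i hi => ContinuousOn.fun_smul ?_ ?_
  · exact ((hg i hi).comp (continuous_subtype_val.comp continuous_fst)).continuousOn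
  · exact ((hη i hi x₀).continuousOn).comp continuousOn_snd fun z hz => hz.2

/-- With all weights $1$ before $j$ and $0$ after $j$, the sum collapses to one segment: on the
$j$-th interval the path through the $\sigma_i$ runs from $\sigma_j$ to $\sigma_{j+1}$. -/
lemma telescope_smul {V : Type*} [AddCommGroup V] [Module ℝ V] (σ : ℕ → V) {c : ℕ → ℝ} {j n : ℕ}
    (hj : j < n) (h1 : ∀ i < j, c i = 1) (h0 : ∀ i, j < i → c i = 0) :
    σ 0 + ∑ i ∈ Finset.range n, c i • (σ (i + 1) - σ i) = σ j + c j • (σ (j + 1) - σ j) := by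
  have h2 : ∑ i ∈ Finset.range n, c i • (σ (i + 1) - σ i) =
      ∑ i ∈ Finset.range (j + 1), c i • (σ (i + 1) - σ i) := by
    refine (Finset.sum_subset (Finset.range_subset_range.2 hj) fun i _ hi => ?_).symm
    rw [h0 i (by simpa using hi), zero_smul]
  have h3 : ∑ i ∈ Finset.range j, c i • (σ (i + 1) - σ i) = σ j - σ 0 := by
    rw [← Finset.sum_range_sub]
    exact Finset.sum_congr rfl fun i hi => by rw [h1 i (Finset.mem_range.1 hi), one_smul]
  rw [h2, Finset.sum_range_succ, h3]
  abel

lemma exists_lt_le_of_mem_Icc {n : ℕ} (hn : 0 < n) {t : ℝ} (ht : t ∈ Icc (0 : ℝ) 1) :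
    ∃ j < n, (j : ℝ) ≤ n * t ∧ n * t ≤ j + 1 := by
  have hn' : (0 : ℝ) < n := Nat.cast_pos.2 hn
  by_cases h : t = 1
  -- The endpoint $t=1$ belongs to the last interval; the floor would give $j=n$.
  · refine ⟨n - 1, by omega, ?_, ?_⟩ <;> rw [h, Nat.cast_sub hn] <;> push_cast <;> linarith
  · have h0 : 0 ≤ n * t := mul_nonneg hn'.le ht.1
    refine ⟨⌊n * t⌋₊, ?_, Nat.floor_le h0, (Nat.lt_floor_add_one _).le⟩
    rw [Nat.floor_lt h0]
    have := lt_of_le_of_ne ht.2 h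
    nlinarith

end PositiveProduct

end

/-! ### Construction of the closed $G_2$-cobordisms -/

noncomputable section

/-- Evaluation of forms at given tangent vectors. -/
def DForm.evalL {E : Type*} [NormedAddCommGroup E] [NormedSpace ℝ E]
    {H : Type*} [TopologicalSpace H] {I : ModelWithCorners ℝ E H}
    {M : Type*} [TopologicalSpace M] [ChartedSpace H M] {k : ℕ} (p : M)
    (w : Fin k → TangentSpace I p) : DForm I M k →ₗ[ℝ] ℝ where
  toFun φ := φ p w
  map_add' _ _ := rfl
  map_smul' _ _ := rfl

section Cobordism

variable {N : Type*} [TopologicalSpace N] [ChartedSpace (EuclideanSpace ℝ (Fin 6)) N]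

lemma mfderiv_slice (t : Icc (0 : ℝ) 1) (x : N) (v : TangentSpace (𝓡 6) x) :
    mfderiv (𝓡 6) cylModel (slice t) x v = ((v, 0) : EuclideanSpace ℝ (Fin 6) ×
        EuclideanSpace ℝ (Fin 1)) :=
  DFunLike.congr_fun (mfderiv_prod_left (I := 𝓡 6) (I' := 𝓡∂ 1) (x₀ := x) (y₀ := t)) v

lemma timeVector_eq (p : N × Icc (0 : ℝ) 1) :
    timeVector p = ((0, oneTangentSpaceIcc p.2) : EuclideanSpace ℝ (Fin 6) ×
        EuclideanSpace ℝ (Fin 1)) :=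
  DFunLike.congr_fun (mfderiv_prod_right (I := 𝓡 6) (I' := 𝓡∂ 1) (x₀ := p.1) (y₀ := p.2)) _

lemma isProductOrientation_cylOrientation [IsManifold (𝓡 6) 1 N]
    (o : ManifoldOrientation (𝓡 6) N 6) :
    IsProductOrientation o (cylOrientation finrank_euclideanSpace_fin o) := by
  intro p v hv
  have h := (isPosOriented_cylOrientation_iff finrank_euclideanSpace_fin o p v).2 hv
  have h1 : (fun i => mfderiv (𝓡 6) cylModel (slice p.2) p.1 (v i)) =
      fun i => ((v i, 0) : EuclideanSpace ℝ (Fin 6) × EuclideanSpace ℝ (Fin 1)) :=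
          funext fun i => mfderiv_slice p.2 p.1 (v i)
  rw [h1, timeVector_eq]
  exact h

/-- A closed form `ρ_t + dt ∧ β_t` for which every `ρ_t` is definite and tamed by `β_t` is a closed
`G₂`-cobordism. -/
lemma isClosedG2Cobordism_of_isTamedPair [IsManifold (𝓡 6) 1 N]
    (o : ManifoldOrientation (𝓡 6) N 6)
    {φ : DForm cylModel (N × Icc (0 : ℝ) 1) 3} (hs : DForm.IsSmooth cylModel φ)
    (hd : DForm.IsClosed cylModel φ)
    {ρ : Icc (0 : ℝ) 1 → DForm (𝓡 6) N 3} {β : Icc (0 : ℝ) 1 → DForm (𝓡 6) N 2}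
    (hρ : ∀ p (v : Fin 3 → EuclideanSpace ℝ (Fin 6)), φ p (fun i => ((v i, 0) :
        EuclideanSpace ℝ (Fin 6) × EuclideanSpace ℝ (Fin 1))) = ρ p.2 p.1 v)
    (hβ : ∀ p (v : Fin 2 → EuclideanSpace ℝ (Fin 6)), φ p (Fin.cons ((0,
        oneTangentSpaceIcc p.2) : EuclideanSpace ℝ (Fin 6) × EuclideanSpace ℝ (Fin 1))
      fun i => ((v i, 0) : EuclideanSpace ℝ (Fin 6) × EuclideanSpace ℝ (Fin 1))) = β p.2 p.1 v)
    (h : ∀ t x, IsTamedPair (o.at' x) (ρ t x).toAlternatingMap (β t x).toAlternatingMap) :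
    IsClosedG2Cobordism o (ρ 0) (ρ 1) φ := by
  have hslice : ∀ t, DForm.pullback (𝓡 6) cylModel (slice t) φ = ρ t := by
    intro t
    funext x
    ext v
    have h1 : (fun i => mfderiv (𝓡 6) cylModel (slice t) x (v i)) =
        fun i => ((v i, 0) : EuclideanSpace ℝ (Fin 6) × EuclideanSpace ℝ (Fin 1)) :=
            funext fun i => mfderiv_slice t x (v i)
    exact (congrArg (φ (x, t)) h1).trans (hρ (x, t) v)
  exact ⟨hs, hd, ⟨cylOrientation finrank_euclideanSpace_fin o,
    isProductOrientation_cylOrientation o, fun p =>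
      isPositiveForm_cylOrientation finrank_euclideanSpace_fin o p (ρ :=
          (ρ p.2 p.1).toAlternatingMap)
        (η := (β p.2 p.1).toAlternatingMap) (hρ p) (hβ p) (h p.2 p.1)⟩,
    hslice 0, hslice 1⟩

/-- The `i`-th cutoff function of a subdivision of `[0, 1]` into `n` intervals. -/
def stepCutoff (n i : ℕ) (t : ℝ) : ℝ := Real.smoothTransition (n * t - i)

lemma contDiff_stepCutoff (n i : ℕ) : ContDiff ℝ ∞ (stepCutoff n i) :=
  Real.smoothTransition.contDiff.comp (by fun_prop)

/-- The smooth path `σ 0 + ∑ i < n, s_i (t) (σ (i + 1) - σ i)` of forms through `σ 0, …, σ n`. -/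
def stepPath (σ : ℕ → DForm (𝓡 6) N 3) (n : ℕ) (t : ℝ) : DForm (𝓡 6) N 3 :=
  σ 0 + ∑ i ∈ Finset.range n, stepCutoff n i t • (σ (i + 1) - σ i)

lemma stepPath_eq (σ : ℕ → DForm (𝓡 6) N 3) {n j : ℕ} {t : ℝ} (hj : j < n)
    (h1 : (j : ℝ) ≤ n * t) (h2 : n * t ≤ j + 1) :
    stepPath σ n t = σ j + stepCutoff n j t • (σ (j + 1) - σ j) := by
  refine telescope_smul σ hj (fun i hi => ?_) fun i hi => ?_
  · have : (i : ℝ) + 1 ≤ j := by exact_mod_cast hi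
    exact Real.smoothTransition.one_of_one_le (by linarith)
  · have : (j : ℝ) + 1 ≤ i := by exact_mod_cast hi
    exact Real.smoothTransition.zero_of_nonpos (by linarith)

lemma stepPath_zero (σ : ℕ → DForm (𝓡 6) N 3) {n : ℕ} (hn : 0 < n) :
    stepPath σ n 0 = σ 0 := by
  rw [stepPath_eq σ hn (by simp) (by simp), stepCutoff,
    Real.smoothTransition.zero_of_nonpos (by simp), zero_smul, add_zero]

lemma stepPath_one (σ : ℕ → DForm (𝓡 6) N 3) {n : ℕ} (hn : 0 < n) :
    stepPath σ n 1 = σ n := by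
  obtain ⟨m, rfl⟩ := Nat.exists_eq_succ_of_ne_zero hn.ne'
  rw [stepPath_eq σ m.lt_succ_self (by simp) (by simp), stepCutoff,
    Real.smoothTransition.one_of_one_le (by simp), one_smul, add_sub_cancel]

/-- The form `ρ_t + dt ∧ (∑ i < n, s_i'(t) a_i)`, with `ρ_t` the smooth path through the `σ i`. -/
def stepForm (σ : ℕ → DForm (𝓡 6) N 3) (a : ℕ → DForm (𝓡 6) N 2) (n : ℕ) :
    DForm cylModel (N × Icc (0 : ℝ) 1) 3 :=
  cylForm (fun _ => 1) (σ 0) + ∑ i ∈ Finset.range n,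
    (cylForm (stepCutoff n i) (σ (i + 1) - σ i) + cylFormWedge (deriv (stepCutoff n i)) (a i))

lemma contDiff_deriv_stepCutoff (n i : ℕ) : ContDiff ℝ ∞ (deriv (stepCutoff n i)) :=
  ((contDiff_infty_iff_deriv).1 (contDiff_stepCutoff n i)).2

variable {σ : ℕ → DForm (𝓡 6) N 3} {a : ℕ → DForm (𝓡 6) N 2}

lemma isSmooth_stepForm_summand [IsManifold (𝓡 6) 1 N] (hσ : ∀ i, DForm.IsSmooth (𝓡 6) (σ i))
    (ha : ∀ i, DForm.IsSmooth (𝓡 6) (a i)) (n i : ℕ) : DForm.IsSmooth cylModel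
      (cylForm (stepCutoff n i) (σ (i + 1) - σ i) + cylFormWedge (deriv (stepCutoff n i)) (a i)) :=
  (isSmooth_cylForm (contDiff_stepCutoff n i) ((hσ (i + 1)).sub (hσ i))).add
    (isSmooth_cylFormWedge (contDiff_deriv_stepCutoff n i) (ha i))

lemma isSmooth_stepForm [IsManifold (𝓡 6) 1 N] (hσ : ∀ i, DForm.IsSmooth (𝓡 6) (σ i))
    (ha : ∀ i, DForm.IsSmooth (𝓡 6) (a i)) (n : ℕ) :
    DForm.IsSmooth cylModel (stepForm σ a n) :=
  (isSmooth_cylForm contDiff_const (hσ 0)).add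
    (DForm.IsSmooth.sum fun i _ => isSmooth_stepForm_summand hσ ha n i)

lemma cylForm_zero (g : ℝ → ℝ) (k : ℕ) : cylForm g (0 : DForm (𝓡 6) N k) = 0 := by
  funext p
  ext v
  exact mul_zero _

lemma cylFormWedge_zero (g : ℝ → ℝ) (k : ℕ) : cylFormWedge g (0 : DForm (𝓡 6) N k) = 0 := by
  funext p
  have h : (cylForm g (0 : DForm (𝓡 6) N k) p : (EuclideanSpace ℝ (Fin 6) ×
      EuclideanSpace ℝ (Fin 1)) [⋀^Fin k]→L[ℝ] ℝ) = 0 :=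
    congrFun (cylForm_zero g k) p
  exact (congrArg (oneWedgeL _) h).trans (map_zero _)

lemma cylFormWedge_zero_fun {k : ℕ} (η : DForm (𝓡 6) N k) : cylFormWedge (fun _ => 0) η = 0 := by
  funext p
  have h : (cylForm (fun _ => 0) η p : (EuclideanSpace ℝ (Fin 6) ×
      EuclideanSpace ℝ (Fin 1)) [⋀^Fin k]→L[ℝ] ℝ) = 0 := zero_smul ℝ _
  exact (congrArg (oneWedgeL _) h).trans (map_zero _)

/-- Each summand is closed: $d(s_i\,da_i)=s_i'\,dt\wedge da_i$ cancels against $d(s_i'\,dt\wedge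
a_i)=-s_i'\,dt\wedge da_i$. -/
lemma d_stepForm [IsManifold (𝓡 6) 1 N] [IsManifold cylModel 1 (N × Icc (0 : ℝ) 1)]
    (hσ : ∀ i, DForm.IsSmooth (𝓡 6) (σ i))
    (ha : ∀ i, DForm.IsSmooth (𝓡 6) (a i)) (hd : ∀ i, DForm.d (𝓡 6) (σ i) = 0)
    (had : ∀ i, DForm.d (𝓡 6) (a i) = σ (i + 1) - σ i) (n : ℕ) :
    DForm.d cylModel (stepForm σ a n) = 0 := by
  rw [stepForm, DForm.d_add (isSmooth_cylForm contDiff_const (hσ 0))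
    (DForm.IsSmooth.sum fun i _ => isSmooth_stepForm_summand hσ ha n i),
    DForm.d_sum fun i _ => isSmooth_stepForm_summand hσ ha n i,
    d_cylForm contDiff_const (hσ 0), hd, cylForm_zero]
  have h0 : deriv (fun _ : ℝ => (1 : ℝ)) = fun _ => 0 := by simp
  rw [h0, cylFormWedge_zero_fun, add_zero, zero_add]
  refine Finset.sum_eq_zero fun i _ => ?_
  rw [DForm.d_add (isSmooth_cylForm (contDiff_stepCutoff n i) ((hσ (i + 1)).sub (hσ i)))
    (isSmooth_cylFormWedge (contDiff_deriv_stepCutoff n i) (ha i)),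
    d_cylForm (contDiff_stepCutoff n i) ((hσ (i + 1)).sub (hσ i)),
    d_cylFormWedge (contDiff_deriv_stepCutoff n i) (ha i), DForm.d_sub (hσ (i + 1)) (hσ i), hd, hd,
    sub_zero, cylForm_zero, had, add_zero, add_neg_cancel]

/-- Tamed paths of closed definite forms in a fixed cohomology class yield closed
`G₂`-cobordisms. -/
lemma exists_stepForm_isClosedG2Cobordism [IsManifold (𝓡 6) 1 N] [CompactSpace N]
    [IsManifold cylModel 1 (N × Icc (0 : ℝ) 1)]
    (o : ManifoldOrientation (𝓡 6) N 6) {Ω : DForm (𝓡 6) N 2} (hΩ : DForm.IsSmooth (𝓡 6) Ω)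
    (hΩd : DForm.IsClosed (𝓡 6) Ω) {ρ : Icc (0 : ℝ) 1 → DForm (𝓡 6) N 3}
    (hρ : DForm.IsContinuousPath (𝓡 6) ρ)
    (h : ∀ t, IsClosedSL3Structure (ρ t) ∧ DForm.Cohomologous (𝓡 6) (ρ 0) (ρ t) ∧
        IsTamedBy o (ρ t) Ω) :
    ∃ (φ : DForm cylModel (N × Icc (0 : ℝ) 1) 3) (K₀ : ℝ), DForm.IsSmooth cylModel φ ∧
      ∀ K ≥ K₀, IsClosedG2Cobordism o (ρ 0) (ρ 1) (φ + K • cylFormWedge (fun _ => 1) Ω) := by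
  have hE : finrank ℝ (EuclideanSpace ℝ (Fin 6)) = 6 := finrank_euclideanSpace_fin
  have htame : ∀ t x, IsTamedPair (o.at' x) (ρ t x).toAlternatingMap (Ω x).toAlternatingMap :=
    fun t x => isTamedPair_of_isTamingForm hE ((h t).1.2.2 x) ((h t).2.2 x)
  obtain ⟨δ, hδ, hconv⟩ := exists_forall_convexCombination_isTamedPair hE o hρ hΩ htame
  obtain ⟨m, hm⟩ := exists_nat_one_div_lt hδ
  set n := m + 1 with hn
  have hn0 : (0 : ℝ) < n := by positivity
  -- Clamping to $[0,1]$ defines $\tau_i$ for every natural $i$ and is 1-Lipschitz, so consecutive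
  -- times are at most $1/n<\delta$ apart.
  set τ : ℕ → Icc (0 : ℝ) 1 := fun i => projIcc 0 1 zero_le_one (i / n) with hτ
  have hτ0 : τ 0 = 0 := by
    simp only [hτ, Nat.cast_zero, zero_div]
    exact projIcc_left (zero_le_one' ℝ)
  have hτn : τ n = 1 := by
    simp only [hτ, div_self hn0.ne']
    exact projIcc_right (zero_le_one' ℝ)
  have hτd : ∀ i, dist (τ i) (τ (i + 1)) < δ := by
    intro i
    have h1 : dist (τ i) (τ (i + 1)) ≤ |(i : ℝ) / n - ((i + 1 : ℕ) : ℝ) / n| :=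
      abs_projIcc_sub_projIcc zero_le_one
    refine h1.trans_lt ?_
    have h2 : (i : ℝ) / n - ((i + 1 : ℕ) : ℝ) / n = -(1 / n) := by push_cast; ring
    rw [h2, abs_neg, abs_of_pos (by positivity)]
    rw [hn]
    exact_mod_cast hm
  -- Primitives of $\sigma_i-\rho_0$; their successive differences are primitives of
  -- $\sigma_{i+1}-\sigma_i$.
  choose α hα hαd using fun i => (h (τ i)).2.1
  set σ : ℕ → DForm (𝓡 6) N 3 := fun i => ρ (τ i) with hσdef
  set a : ℕ → DForm (𝓡 6) N 2 := fun i => α (i + 1) - α i with hadef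
  have hσ : ∀ i, DForm.IsSmooth (𝓡 6) (σ i) := fun i => (h (τ i)).1.1
  have hσd : ∀ i, DForm.d (𝓡 6) (σ i) = 0 := fun i => DForm.isClosed_iff.1 (h (τ i)).1.2.1
  have ha : ∀ i, DForm.IsSmooth (𝓡 6) (a i) := fun i => (hα (i + 1)).sub (hα i)
  have hαd' : ∀ i, DForm.d (𝓡 6) (α i) = σ i - ρ 0 := fun i => funext fun x => (hαd i x).symm
  have had : ∀ i, DForm.d (𝓡 6) (a i) = σ (i + 1) - σ i := by
    intro i
    rw [hadef, DForm.d_sub (hα (i + 1)) (hα i), hαd', hαd', sub_sub_sub_cancel_right]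
  set ρ' : Icc (0 : ℝ) 1 → DForm (𝓡 6) N 3 := fun t => stepPath σ n t with hρ'
  set β : Icc (0 : ℝ) 1 → DForm (𝓡 6) N 2 := fun t =>
    ∑ i ∈ Finset.range n, deriv (stepCutoff n i) t • a i with hβ
  have hρ'c : DForm.IsContinuousPath (𝓡 6) ρ' := by
    intro x₀
    have h1 : DForm.IsContinuousPath (𝓡 6) fun t : Icc (0 : ℝ) 1 =>
        ∑ i ∈ Finset.range n, stepCutoff n i t • (σ (i + 1) - σ i) :=
      isContinuousPath_sum_smul (fun i _ => (contDiff_stepCutoff n i).continuous)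
        fun i _ => (hσ (i + 1)).sub (hσ i)
    refine ContinuousOn.congr (ContinuousOn.add ?_ (h1 x₀)) fun p _ => DForm.inChart_add _ _ _ _
    exact (hσ 0 x₀).continuousOn.comp continuousOn_snd fun z hz => hz.2
  have hβc : DForm.IsContinuousPath (𝓡 6) β :=
    isContinuousPath_sum_smul (fun i _ => (contDiff_deriv_stepCutoff n i).continuous)
      fun i _ => ha i
  have htame' : ∀ t x, IsTamedPair (o.at' x) (ρ' t x).toAlternatingMap (Ω x).toAlternatingMap := by
    intro t x
    -- For $t\in[j/n,(j+1)/n]$ the new path is a convex combination of $\rho_{\tau_j}$ and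
    -- $\rho_{\tau_{j+1}}$, to which the choice of $\delta$ applies.
    obtain ⟨j, hj, h1, h2⟩ := exists_lt_le_of_mem_Icc m.succ_pos t.2
    have h3 : ρ' t = σ j + stepCutoff n j t • (σ (j + 1) - σ j) := stepPath_eq σ hj h1 h2
    rw [h3]
    exact hconv (τ j) (τ (j + 1)) (hτd j) ⟨stepCutoff n j t,
      Real.smoothTransition.nonneg _, Real.smoothTransition.le_one _⟩ x
  obtain ⟨K₀, hK₀⟩ := exists_forall_isTamedPair_smul_add hE o hρ'c hβc hΩ htame'
  have hsm := isSmooth_stepForm hσ ha n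
  have hsΩ : DForm.IsSmooth cylModel (cylFormWedge (fun _ => 1) Ω) :=
    isSmooth_cylFormWedge contDiff_const hΩ
  refine ⟨stepForm σ a n, K₀, hsm, fun K hK => ?_⟩
  have h0 : ρ' 0 = ρ 0 := by
    refine (stepPath_zero σ m.succ_pos).trans ?_
    rw [hσdef]
    simp only [hτ0]
  have h1 : ρ' 1 = ρ 1 := by
    refine (stepPath_one σ m.succ_pos).trans ?_
    change ρ (τ n) = ρ 1
    rw [hτn]
  rw [← h0, ← h1]
  refine isClosedG2Cobordism_of_isTamedPair o (hsm.add (hsΩ.smul K)) ?_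
    (ρ := ρ') (β := fun t x => K • Ω x + β t x) ?_ ?_ (hK₀ K hK)
  · rw [DForm.isClosed_iff, DForm.d_add hsm (hsΩ.smul K), d_stepForm hσ ha hσd had,
      DForm.d_smul, d_cylFormWedge contDiff_const hΩ, DForm.isClosed_iff.1 hΩd]
    rw [cylFormWedge_zero, neg_zero, smul_zero, add_zero]
  · intro p v
    have e1 : ∀ (g : ℝ → ℝ) (η : DForm (𝓡 6) N 3), DForm.evalL (I := cylModel) p
        (fun i => ((v i, 0) : EuclideanSpace ℝ (Fin 6) ×
            EuclideanSpace ℝ (Fin 1))) (cylForm g η) = g p.2 * DForm.evalL (I := 𝓡 6) p.1 v η :=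
      fun g η => cylForm_apply_inl g η p v
    have e2 : ∀ (g : ℝ → ℝ) (η : DForm (𝓡 6) N 2), DForm.evalL (I := cylModel) p
        (fun i => ((v i, 0) : EuclideanSpace ℝ (Fin 6) ×
            EuclideanSpace ℝ (Fin 1))) (cylFormWedge g η) = 0 :=
      fun g η => cylFormWedge_apply_inl g η p v
    -- Evaluation at fixed vectors is phrased as a linear map on forms, so that it passes through
    -- the sum.
    change DForm.evalL (I := cylModel) p _ (stepForm σ a n + K • cylFormWedge (fun _ => 1) Ω) =
      DForm.evalL (I := 𝓡 6) p.1 v (stepPath σ n p.2)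
    simp only [stepForm, stepPath, map_add, map_sum, map_smul, e1, e2, smul_eq_mul, one_mul,
      mul_zero, add_zero]
  · intro p v
    have e1 : ∀ (g : ℝ → ℝ) (η : DForm (𝓡 6) N 3), DForm.evalL (I := cylModel) p
        (Fin.cons ((0, oneTangentSpaceIcc p.2) : EuclideanSpace ℝ (Fin 6) ×
            EuclideanSpace ℝ (Fin 1)) fun i => ((v i, 0) :
                EuclideanSpace ℝ (Fin 6) × EuclideanSpace ℝ (Fin 1)))
        (cylForm g η) = 0 := fun g η => cylForm_apply_cons g η p _ v
    have e2 : ∀ (g : ℝ → ℝ) (η : DForm (𝓡 6) N 2), DForm.evalL (I := cylModel) p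
        (Fin.cons ((0, oneTangentSpaceIcc p.2) : EuclideanSpace ℝ (Fin 6) ×
            EuclideanSpace ℝ (Fin 1)) fun i => ((v i, 0) :
                EuclideanSpace ℝ (Fin 6) × EuclideanSpace ℝ (Fin 1)))
        (cylFormWedge g η) = g p.2 * DForm.evalL (I := 𝓡 6) p.1 v η :=
      fun g η => cylFormWedge_apply_cons g η p v
    change DForm.evalL (I := cylModel) p _ (stepForm σ a n + K • cylFormWedge (fun _ => 1) Ω) =
      DForm.evalL (I := 𝓡 6) p.1 v (K • Ω + β p.2)
    simp only [stepForm, hβ, map_add, map_sum, map_smul, e1, e2, smul_eq_mul, one_mul, zero_add]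
    rw [add_comm]

end Cobordism

end

/-! ### Pullback of forms to subsets of a vector space -/

noncomputable section

section PullbackWithin

variable {E : Type*} [NormedAddCommGroup E] [NormedSpace ℝ E]
  {H : Type*} [TopologicalSpace H] {I : ModelWithCorners ℝ E H}
  {M : Type*} [TopologicalSpace M] [ChartedSpace H M] {k : ℕ}
  {V : Type*} [NormedAddCommGroup V] [NormedSpace ℝ V] {f : V → M} {C : Set V}

/-- The pullback of a form under a map that is defined on a subset `C` of a vector space. -/
def DForm.pullbackWithin (I : ModelWithCorners ℝ E H) (η : DForm I M k) (f : V → M) (C : Set V)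
    (y : V) : V [⋀^Fin k]→L[ℝ] ℝ :=
  (η (f y) : E [⋀^Fin k]→L[ℝ] ℝ).compContinuousLinearMap (mfderivWithin 𝓘(ℝ, V) I f C y : V →L[ℝ] E)

lemma mapsTo_extChartAt_comp_range {V : Type*} {f : V → M} {C : Set V} (q : M) :
    MapsTo (extChartAt I q ∘ f) C (range I) := by
  intro z _
  rw [Function.comp_apply, extChartAt_coe]
  exact mem_range_self _

lemma DForm.IsSmooth.differentiableWithinAt_inChart_of_mem {η : DForm I M k} (hη :
    DForm.IsSmooth I η)
    {q : M} {z : E} (hz : z ∈ (extChartAt I q).target) :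
    DifferentiableWithinAt ℝ (DForm.inChart I η q) (range I) z :=
  (((hη q).differentiableOn (by simp)) z hz).mono_of_mem_nhdsWithin
    (extChartAt_target_mem_nhdsWithin_of_mem hz)

section Local

variable [IsManifold I ∞ M]

lemma contDiffWithinAt_extChartAt_comp (hf : ContMDiffOn 𝓘(ℝ, V) I ∞ f C) {q : M} {y : V}
    (hy : y ∈ C) (hq : f y ∈ (extChartAt I q).source) :
    ContDiffWithinAt ℝ ∞ (extChartAt I q ∘ f) C y := by
  rw [← contMDiffWithinAt_iff_contDiffWithinAt]
  exact (contMDiffAt_extChartAt' (by rwa [← extChartAt_source I])).comp_contMDiffWithinAt y (hf y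
      hy)

lemma fderivWithin_extChartAt_comp (hC : UniqueDiffOn ℝ C) (hf : ContMDiffOn 𝓘(ℝ, V) I ∞ f C)
    {q : M} {y : V} (hy : y ∈ C) (hq : f y ∈ (extChartAt I q).source) :
    fderivWithin ℝ (extChartAt I q ∘ f) C y =
      (mfderiv I 𝓘(ℝ, E) (extChartAt I q) (f y) : E →L[ℝ] E).comp
        (mfderivWithin 𝓘(ℝ, V) I f C y : V →L[ℝ] E) := by
  have : IsManifold I 1 M := IsManifold.of_le (n := ∞) (by simp)
  rw [← mfderivWithin_eq_fderivWithin]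
  exact mfderiv_comp_mfderivWithin y (mdifferentiableAt_extChartAt (by rwa [← extChartAt_source I]))
    ((hf y hy).mdifferentiableWithinAt (by simp)) (uniqueMDiffWithinAt_iff_uniqueDiffWithinAt.2 (hC
        y hy))

/-- Factors the pullback through a fixed chart, the derivatives of the chart and of its inverse
cancelling. Regularity and $d$ can then be computed between vector spaces. -/
lemma pullbackWithin_eq_inChart (hC : UniqueDiffOn ℝ C) (hf : ContMDiffOn 𝓘(ℝ, V) I ∞ f C)
    (η : DForm I M k) {q : M} {y : V} (hy : y ∈ C) (hq : f y ∈ (extChartAt I q).source) :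
    DForm.pullbackWithin I η f C y =
      (DForm.inChart I η q ((extChartAt I q ∘ f) y)).compContinuousLinearMap
        (fderivWithin ℝ (extChartAt I q ∘ f) C y) := by
  have : IsManifold I 1 M := IsManifold.of_le (n := ∞) (by simp)
  have h := mfderivWithin_extChartAt_symm_comp_mfderiv_extChartAt' hq
  rw [fderivWithin_extChartAt_comp hC hf hy hq, Function.comp_apply,
    DForm.inChart_extChartAt η hq]
  ext v
  refine congrArg (η (f y)) (funext fun i => ?_)
  exact (DFunLike.congr_fun h (mfderivWithin 𝓘(ℝ, V) I f C y (v i))).symm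

lemma eventually_pullbackWithin_eq (hC : UniqueDiffOn ℝ C) (hf : ContMDiffOn 𝓘(ℝ, V) I ∞ f C)
    (η : DForm I M k) {q : M} {y : V} (hy : y ∈ C) (hq : f y ∈ (extChartAt I q).source) :
    DForm.pullbackWithin I η f C =ᶠ[𝓝[C] y] fun z =>
      (DForm.inChart I η q ((extChartAt I q ∘ f) z)).compContinuousLinearMap
        (fderivWithin ℝ (extChartAt I q ∘ f) C z) := by
  have h := (hf.continuousOn y hy).eventually ((isOpen_extChartAt_source q).mem_nhds hq)
  filter_upwards [h, self_mem_nhdsWithin] with z hz hzC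
  exact pullbackWithin_eq_inChart hC hf η hzC hz

lemma differentiableOn_pullbackWithin (hC : UniqueDiffOn ℝ C) (hf : ContMDiffOn 𝓘(ℝ, V) I ∞ f C)
    {η : DForm I M k} (hη : DForm.IsSmooth I η) :
    DifferentiableOn ℝ (DForm.pullbackWithin I η f C) C := by
  intro y hy
  have hq := mem_extChartAt_source (I := I) (f y)
  have hF := contDiffWithinAt_extChartAt_comp hf hy hq
  have h1 : DifferentiableWithinAt ℝ
      (fun z => DForm.inChart I η (f y) ((extChartAt I (f y) ∘ f) z)) C y :=
    DifferentiableWithinAt.comp (f := extChartAt I (f y) ∘ f) y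
      (hη.differentiableWithinAt_inChart_of_mem (mem_extChartAt_target (f y)))
      (hF.differentiableWithinAt (by simp)) (mapsTo_extChartAt_comp_range _)
  have h2 : DifferentiableWithinAt ℝ (fderivWithin ℝ (extChartAt I (f y) ∘ f) C) C y :=
    (hF.fderivWithin_right hC (m := ∞) (by simp) hy).differentiableWithinAt (by simp)
  exact (h1.continuousAlternatingMapCompContinuousLinearMap h2).congr_of_eventuallyEq
    (eventually_pullbackWithin_eq hC hf η hy hq) (pullbackWithin_eq_inChart hC hf η hy hq)

/-- The exterior derivative commutes with pullbacks. -/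
lemma extDerivWithin_pullbackWithin (hC : UniqueDiffOn ℝ C) (hf : ContMDiffOn 𝓘(ℝ, V) I ∞ f C)
    {η : DForm I M k} (hη : DForm.IsSmooth I η) {y : V} (hy : y ∈ C)
    (hy' : y ∈ closure (interior C)) :
    extDerivWithin (DForm.pullbackWithin I η f C) C y =
      DForm.pullbackWithin I (DForm.d I η) f C y := by
  have : IsManifold I 1 M := IsManifold.of_le (n := ∞) (by simp)
  have hq := mem_extChartAt_source (I := I) (f y)
  have hF := contDiffWithinAt_extChartAt_comp hf hy hq
  -- The chart is the one centred at $f(y)$, by which `DForm.d` is defined there; naturality of $d$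
  -- in vector spaces then gives the two sides literally equal.
  rw [(eventually_pullbackWithin_eq hC hf η hy hq).extDerivWithin_eq
    (pullbackWithin_eq_inChart hC hf η hy hq), extDerivWithin_pullback (f := extChartAt I (f y) ∘ f)
    (t := range I)
    (hη.differentiableWithinAt_inChart_of_mem (mem_extChartAt_target (f y))) hF
    (by rw [minSmoothness_of_isRCLikeNormedField]; exact WithTop.coe_le_coe.2 le_top) hC hy' hy
    (mapsTo_extChartAt_comp_range _), fderivWithin_extChartAt_comp hC hf hy hq]
  rfl

end Local

end PullbackWithin

end

/-! ### Stokes' theorem on the unit cube -/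

noncomputable section

section CubeGeometry

lemma interior_Icc_zero_one_pi (n : ℕ) :
    interior (Icc (0 : Fin n → ℝ) 1) = univ.pi fun _ => Ioo (0 : ℝ) 1 := by
  rw [← pi_univ_Icc, interior_pi_set finite_univ]
  simp

lemma nonempty_interior_Icc_zero_one_pi (n : ℕ) : (interior (Icc (0 : Fin n → ℝ) 1)).Nonempty := by
  rw [interior_Icc_zero_one_pi]
  exact ⟨fun _ => 1 / 2, fun _ _ => ⟨by norm_num, by norm_num⟩⟩

lemma uniqueDiffOn_Icc_zero_one_pi (n : ℕ) : UniqueDiffOn ℝ (Icc (0 : Fin n → ℝ) 1) :=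
  uniqueDiffOn_convex (convex_Icc _ _) (nonempty_interior_Icc_zero_one_pi n)

lemma mem_closure_interior_Icc_zero_one_pi {n : ℕ} {x : Fin n → ℝ} (hx : x ∈ Icc 0 1) :
    x ∈ closure (interior (Icc (0 : Fin n → ℝ) 1)) := by
  rw [(convex_Icc (𝕜 := ℝ) (0 : Fin n → ℝ) 1).closure_interior_eq_closure_of_nonempty_interior
    (nonempty_interior_Icc_zero_one_pi n)]
  exact subset_closure hx

/-- The linear map that inserts a zero at the `i`-th place. -/
def insertZero {n : ℕ} (i : Fin (n + 1)) : (Fin n → ℝ) →L[ℝ] (Fin (n + 1) → ℝ) :=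
  LinearMap.toContinuousLinearMap
    { toFun := fun v => i.insertNth 0 v
      map_add' := fun v w => by
        ext j
        refine Fin.succAboveCases i ?_ (fun j => ?_) j <;> simp
      map_smul' := fun r v => by
        ext j
        refine Fin.succAboveCases i ?_ (fun j => ?_) j <;> simp }

lemma insertZero_single {n : ℕ} (i : Fin (n + 1)) (j : Fin n) :
    insertZero i (Pi.single j 1) = Pi.single (i.succAbove j) 1 := by
  change (i.insertNth (0 : ℝ) (Pi.single j 1 : Fin n → ℝ) : Fin (n + 1) → ℝ) = _
  ext l
  refine Fin.succAboveCases i ?_ (fun l => ?_) l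
  · simp
  · simp [Pi.single_apply]

lemma hasFDerivAt_insertNth {n : ℕ} (i : Fin (n + 1)) (a : ℝ) (x : Fin n → ℝ) :
    HasFDerivAt (fun x : Fin n → ℝ => (i.insertNth a x : Fin (n + 1) → ℝ)) (insertZero i) x := by
  have h : (fun x : Fin n → ℝ => (i.insertNth a x : Fin (n + 1) → ℝ)) =
      fun x => insertZero i x + Pi.single i a := by
    funext x
    change _ = (i.insertNth (0 : ℝ) x : Fin (n + 1) → ℝ) + _
    ext j
    refine Fin.succAboveCases i ?_ (fun j => ?_) j <;> simp
  rw [h]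
  exact (insertZero i).hasFDerivAt.add_const _

lemma insertNth_mem_Icc_zero_one {n : ℕ} (i : Fin (n + 1)) (a : Icc (0 : ℝ) 1) {x : Fin n → ℝ}
    (hx : x ∈ Icc 0 1) : (i.insertNth (a : ℝ) x : Fin (n + 1) → ℝ) ∈ Icc 0 1 := by
  rw [Fin.insertNth_mem_Icc]
  exact ⟨a.2, hx⟩

/-- Stokes' theorem on the unit cube. -/
lemma integral_extDerivWithin_Icc {n : ℕ}
    {w : (Fin (n + 1) → ℝ) → (Fin (n + 1) → ℝ) [⋀^Fin n]→L[ℝ] ℝ}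
    (hw : DifferentiableOn ℝ w (Icc 0 1))
    (hi : IntegrableOn (fun x => extDerivWithin w (Icc 0 1) x fun i => Pi.single i 1) (Icc 0 1)) :
    ∫ x in Icc 0 1, extDerivWithin w (Icc 0 1) x (fun i => Pi.single i 1) =
      ∑ i : Fin (n + 1), (-1) ^ (i : ℕ) *
        ((∫ x in Icc 0 1, w (i.insertNth 1 x) fun j => Pi.single (i.succAbove j) 1) -
          ∫ x in Icc 0 1, w (i.insertNth 0 x) fun j => Pi.single (i.succAbove j) 1) := by
  set e : Fin (n + 1) → Fin (n + 1) → ℝ := fun i => Pi.single i 1 with he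
  have hd : ∀ i : Fin (n + 1), DifferentiableOn ℝ (fun x => (-1 : ℝ) ^ (i :
      ℕ) * w x (i.removeNth e)) (Icc 0 1) :=
    fun i x hx => ((hw x hx).continuousAlternatingMap_apply_const _).const_mul _
  have hext : ∀ x ∈ Icc (0 : Fin (n + 1) → ℝ) 1, extDerivWithin w (Icc 0 1) x e =
      ∑ i : Fin (n + 1), fderivWithin ℝ (fun x => (-1 : ℝ) ^ (i :
          ℕ) * w x (i.removeNth e)) (Icc 0 1) x
        (Pi.single i 1) := by
    intro x hx
    have hu := uniqueDiffOn_Icc_zero_one_pi (n + 1) x hx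
    rw [extDerivWithin_apply (hw x hx) hu]
    refine Finset.sum_congr rfl fun i _ => ?_
    rw [fderivWithin_const_mul hu ((hw x hx).continuousAlternatingMap_apply_const _)]
    rw [_root_.smul_apply, smul_eq_mul, zsmul_eq_mul]
    simp [he]
  -- The divergence theorem for the vector field with components
  -- $(-1)^i\,w(e_0,\dots,\widehat{e_i},\dots,e_n)$, whose divergence is $dw(e_0,\dots,e_n)$.
  -- Two-sided derivatives are needed only in the interior.
  have key := integral_divergence_of_hasFDerivAt_off_countable' (0 : Fin (n + 1) → ℝ) 1
    (fun i => zero_le_one) (fun i x => (-1 : ℝ) ^ (i : ℕ) * w x (i.removeNth e))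
    (fun i x => fderivWithin ℝ (fun x => (-1 : ℝ) ^ (i : ℕ) * w x (i.removeNth e)) (Icc 0 1) x)
    ∅ countable_empty (fun i => (hd i).continuousOn) (fun x hx i => by
      have hx' : x ∈ interior (Icc (0 : Fin (n + 1) → ℝ) 1) := by
        rw [interior_Icc_zero_one_pi]; exact hx.1
      exact ((hd i x (interior_subset hx')).hasFDerivWithinAt).hasFDerivAt
        (mem_interior_iff_mem_nhds.1 hx')) (hi.congr_fun hext measurableSet_Icc)
  rw [setIntegral_congr_fun measurableSet_Icc hext, key]
  refine Finset.sum_congr rfl fun i _ => ?_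
  simp only [integral_const_mul, mul_sub]
  rfl

end CubeGeometry

/-! ### Stokes' theorem and degenerate cubes for singular cubes -/

section CubePullback

variable {E : Type*} [NormedAddCommGroup E] [NormedSpace ℝ E]
  {H : Type*} [TopologicalSpace H] {I : ModelWithCorners ℝ E H}
  {M : Type*}

lemma SingularCube.extend_face {n : ℕ} (σ : SingularCube (n + 1) M) (i : Fin (n + 1))
    (a : Icc (0 : ℝ) 1) : SingularCube.extend (SingularCube.face σ i a) =
      SingularCube.extend σ ∘ fun x : Fin n → ℝ => (i.insertNth (a : ℝ) x : Fin (n + 1) → ℝ) := by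
  funext x
  refine congrArg σ (funext fun j => ?_)
  refine Fin.succAboveCases i ?_ (fun j => ?_) j <;> simp

variable [TopologicalSpace M] [ChartedSpace H M]

/-- A smooth singular cube. -/
def SingularCube.IsSmooth {n : ℕ} (I : ModelWithCorners ℝ E H) (σ : SingularCube n M) : Prop :=
  ContMDiffOn 𝓘(ℝ, Fin n → ℝ) I ∞ (SingularCube.extend σ) (Icc 0 1)

lemma SingularCube.integral_eq {n : ℕ} (η : DForm I M n) (σ : SingularCube n M) :
    SingularCube.integral I η σ = ∫ x in Icc (0 : Fin n → ℝ) 1,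
      DForm.pullbackWithin I η (SingularCube.extend σ) (Icc 0 1) x fun i => Pi.single i 1 := rfl

lemma SingularCube.IsSmooth.mdifferentiableWithinAt {n : ℕ} {σ : SingularCube n M}
    (hσ : SingularCube.IsSmooth I σ) {x : Fin n → ℝ} (hx : x ∈ Icc 0 1) :
    MDifferentiableWithinAt 𝓘(ℝ, Fin n → ℝ) I (SingularCube.extend σ) (Icc 0 1) x :=
  (hσ x hx).mdifferentiableWithinAt (by simp)

lemma uniqueMDiffWithinAt_Icc_zero_one_pi {n : ℕ} {x : Fin n → ℝ} (hx : x ∈ Icc 0 1) :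
    UniqueMDiffWithinAt 𝓘(ℝ, Fin n → ℝ) (Icc 0 1) x :=
  uniqueMDiffWithinAt_iff_uniqueDiffWithinAt.2 (uniqueDiffOn_Icc_zero_one_pi n x hx)

/-- The chain rule for the face inclusion, whose derivative sends $e_j$ to the $j$-th basis vector
other than $e_i$. This matches the boundary terms of the cube theorem with integrals over faces. -/
lemma SingularCube.integral_face {n : ℕ} {σ : SingularCube (n + 1) M}
    (hσ : SingularCube.IsSmooth I σ) (η : DForm I M n) (i : Fin (n + 1)) (a : Icc (0 : ℝ) 1) :
    SingularCube.integral I η (SingularCube.face σ i a) = ∫ x in Icc (0 : Fin n → ℝ) 1,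
      DForm.pullbackWithin I η (SingularCube.extend σ) (Icc 0 1) (i.insertNth (a : ℝ) x)
        fun j => Pi.single (i.succAbove j) 1 := by
  rw [SingularCube.integral_eq, SingularCube.extend_face]
  refine setIntegral_congr_fun measurableSet_Icc fun x hx => ?_
  have h1 : HasMFDerivWithinAt 𝓘(ℝ, Fin n → ℝ) 𝓘(ℝ, Fin (n + 1) → ℝ)
      (fun x : Fin n → ℝ => (i.insertNth (a : ℝ) x : Fin (n + 1) → ℝ)) (Icc 0 1) x
      (insertZero i) := (hasFDerivAt_insertNth i a x).hasFDerivWithinAt.hasMFDerivWithinAt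
  have h2 := (hσ.mdifferentiableWithinAt (insertNth_mem_Icc_zero_one i a hx)).hasMFDerivWithinAt
  have h3 := (HasMFDerivWithinAt.comp x h2 h1 fun y hy =>
    insertNth_mem_Icc_zero_one i a hy).mfderivWithin (uniqueMDiffWithinAt_Icc_zero_one_pi hx)
  refine congrArg (η _) (funext fun j => ?_)
  refine (DFunLike.congr_fun h3 _).trans ?_
  exact congrArg (mfderivWithin 𝓘(ℝ, Fin (n + 1) → ℝ) I (SingularCube.extend σ) (Icc 0 1)
    (i.insertNth (a : ℝ) x)) (insertZero_single i j)

lemma SingularCube.IsSmooth.continuousOn [IsManifold I ∞ M] {n : ℕ} {σ : SingularCube n M}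
    (hσ : SingularCube.IsSmooth I σ) {η : DForm I M n} (hη : DForm.IsSmooth I η) :
    ContinuousOn (fun x => DForm.pullbackWithin I η (SingularCube.extend σ) (Icc 0 1) x
      fun i => Pi.single i 1) (Icc 0 1) := fun x hx =>
  ((differentiableOn_pullbackWithin (uniqueDiffOn_Icc_zero_one_pi n) hσ hη x
    hx).continuousAlternatingMap_apply_const _).continuousWithinAt

lemma SingularCube.IsSmooth.integrableOn [IsManifold I ∞ M] {n : ℕ} {σ : SingularCube n M}
    (hσ : SingularCube.IsSmooth I σ) {η : DForm I M n} (hη : DForm.IsSmooth I η) :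
    IntegrableOn (fun x => DForm.pullbackWithin I η (SingularCube.extend σ) (Icc 0 1) x
      fun i => Pi.single i 1) (Icc 0 1) :=
  (hσ.continuousOn hη).integrableOn_compact isCompact_Icc

/-- Stokes' theorem for a smooth singular cube. -/
lemma SingularCube.IsSmooth.integral_d [IsManifold I ∞ M] {n : ℕ} {σ : SingularCube (n + 1) M}
    (hσ : SingularCube.IsSmooth I σ) {η : DForm I M n} (hη : DForm.IsSmooth I η)
    (hdη : DForm.IsSmooth I (DForm.d I η)) :
    SingularCube.integral I (DForm.d I η) σ = ∑ i : Fin (n + 1), (-1) ^ (i : ℕ) *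
      (SingularCube.integral I η (SingularCube.face σ i 1) -
        SingularCube.integral I η (SingularCube.face σ i 0)) := by
  have hext : ∀ x ∈ Icc (0 : Fin (n + 1) → ℝ) 1,
      DForm.pullbackWithin I (DForm.d I η) (SingularCube.extend σ) (Icc 0 1) x
        (fun i => Pi.single i 1) = extDerivWithin (DForm.pullbackWithin I η
          (SingularCube.extend σ) (Icc 0 1)) (Icc 0 1) x fun i => Pi.single i 1 := fun x hx => by
    rw [extDerivWithin_pullbackWithin (uniqueDiffOn_Icc_zero_one_pi _) hσ hη hx
      (mem_closure_interior_Icc_zero_one_pi hx)]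
  rw [SingularCube.integral_eq, setIntegral_congr_fun measurableSet_Icc hext,
    integral_extDerivWithin_Icc
      (differentiableOn_pullbackWithin (uniqueDiffOn_Icc_zero_one_pi _) hσ hη)
      ((hσ.integrableOn hdη).congr_fun hext measurableSet_Icc)]
  simp only [SingularCube.integral_face hσ]
  rfl

lemma SingularCube.IsSmooth.integral_add_smul [IsManifold I ∞ M] {n : ℕ} {σ : SingularCube n M}
    (hσ : SingularCube.IsSmooth I σ) {η θ : DForm I M n} (hη : DForm.IsSmooth I η)
    (hθ : DForm.IsSmooth I θ) (r : ℝ) :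
    SingularCube.integral I (η + r • θ) σ =
      SingularCube.integral I η σ + r * SingularCube.integral I θ σ := by
  rw [SingularCube.integral_eq, SingularCube.integral_eq, SingularCube.integral_eq,
    ← integral_const_mul, ← integral_add (hσ.integrableOn hη) ((hσ.integrableOn hθ).const_mul r)]
  rfl

/-- The integral of a form over a degenerate cube vanishes. -/
lemma SingularCube.IsDegenerate.integral_eq_zero {n : ℕ} {σ : SingularCube n M}
    (hσ : SingularCube.IsDegenerate σ) (η : DForm I M n) : SingularCube.integral I η σ = 0 := by
  obtain ⟨i, hi⟩ := hσ
  refine setIntegral_eq_zero_of_forall_eq_zero fun x hx => ?_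
  refine ContinuousAlternatingMap.map_coord_zero (η (SingularCube.extend σ x)) i ?_
  -- No smoothness is assumed: where the cube is not differentiable its derivative is $0$ by
  -- convention, and elsewhere the derivative along the idle coordinate $i$ vanishes, because the
  -- cube is constant on that line.
  by_cases hd : MDifferentiableWithinAt 𝓘(ℝ, Fin n → ℝ) I (SingularCube.extend σ) (Icc 0 1) x
  swap
  · rw [mfderivWithin_zero_of_not_mdifferentiableWithinAt hd]
    rfl
  have hxi : x i ∈ Icc (0 : ℝ) 1 := ⟨hx.1 i, hx.2 i⟩
  have hline : HasMFDerivWithinAt 𝓘(ℝ, ℝ) 𝓘(ℝ, Fin n → ℝ) (Function.update x i) (Icc 0 1) (x i)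
      (ContinuousLinearMap.toSpanSingleton ℝ (Pi.single i (1 : ℝ) : Fin n → ℝ)) :=
    (hasDerivAt_update x i (x i)).hasFDerivAt.hasFDerivWithinAt.hasMFDerivWithinAt
  have hmaps : Icc (0 : ℝ) 1 ⊆ Function.update x i ⁻¹' Icc 0 1 := by
    intro t ht
    constructor <;> intro j <;> by_cases hj : j = i
    · subst hj; simpa using ht.1
    · simpa [hj] using hx.1 j
    · subst hj; simpa using ht.2
    · simpa [hj] using hx.2 j
  have hd' : HasMFDerivWithinAt 𝓘(ℝ, Fin n → ℝ) I (SingularCube.extend σ) (Icc 0 1)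
      (Function.update x i (x i))
      (mfderivWithin 𝓘(ℝ, Fin n → ℝ) I (SingularCube.extend σ) (Icc 0 1)
        (Function.update x i (x i))) := by
    rw [Function.update_eq_self]
    exact hd.hasMFDerivWithinAt
  have h1 := HasMFDerivWithinAt.comp (x i) hd' hline hmaps
  have hconst : SingularCube.extend σ ∘ Function.update x i = fun _ => SingularCube.extend σ x := by
    funext t
    refine hi _ _ fun j hj => ?_
    simp [hj]
  rw [hconst] at h1
  have hu : UniqueMDiffWithinAt 𝓘(ℝ, ℝ) (Icc (0 : ℝ) 1) (x i) :=
    uniqueMDiffWithinAt_iff_uniqueDiffWithinAt.2 (uniqueDiffOn_Icc zero_lt_one _ hxi)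
  have h2 := hu.eq h1 (hasMFDerivWithinAt_const _ _ _)
  have h3 : (mfderivWithin 𝓘(ℝ, Fin n → ℝ) I (SingularCube.extend σ) (Icc 0 1)
      (Function.update x i (x i)) : (Fin n → ℝ) →L[ℝ] E) ((1 : ℝ) • Pi.single i 1) = 0 :=
    DFunLike.congr_fun h2 (1 : ℝ)
  have h4 : ∀ y, y = x → (mfderivWithin 𝓘(ℝ, Fin n → ℝ) I (SingularCube.extend σ) (Icc 0 1)
      y : (Fin n → ℝ) →L[ℝ] E) (Pi.single i 1) = 0 →
      (mfderivWithin 𝓘(ℝ, Fin n → ℝ) I (SingularCube.extend σ) (Icc 0 1)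
      x : (Fin n → ℝ) →L[ℝ] E) (Pi.single i 1) = 0 := by
    rintro _ rfl h
    exact h
  exact h4 _ (Function.update_eq_self i x) ((congrArg _ (one_smul ℝ _).symm).trans h3)

end CubePullback

end

/-! ### Integration over chains modulo degenerate cubes -/

noncomputable section

section ChainIntegral

variable {E : Type*} [NormedAddCommGroup E] [NormedSpace ℝ E]
  {H : Type*} [TopologicalSpace H] {I : ModelWithCorners ℝ E H}
  {M : Type*} [TopologicalSpace M] [ChartedSpace H M] {k : ℕ}

namespace CubeChain

lemma integral_eq_linearCombination (η : DForm I M k) (c : CubeChain k M) :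
    integral I η c = Finsupp.linearCombination ℝ (SingularCube.integral I η) c := rfl

/-- The integral depends only on the class of a chain modulo degenerate cubes. -/
lemma Equiv.integral_eq {c c' : CubeChain k M} (h : Equiv c c') (η : DForm I M k) :
    integral I η c = integral I η c' := by
  rw [← sub_eq_zero, integral_eq_linearCombination, integral_eq_linearCombination, ← map_sub,
    Finsupp.linearCombination_apply]
  exact Finset.sum_eq_zero fun σ hσ => by
    simp only [(h σ hσ).integral_eq_zero, smul_zero]

lemma IsSmooth.integral_add_smul [IsManifold I ∞ M] {c : CubeChain k M} (hc : IsSmooth I c)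
    {η θ : DForm I M k} (hη : DForm.IsSmooth I η) (hθ : DForm.IsSmooth I θ) (r : ℝ) :
    integral I (η + r • θ) c = integral I η c + r * integral I θ c := by
  simp only [integral, Finsupp.sum, Finset.mul_sum, ← Finset.sum_add_distrib]
  refine Finset.sum_congr rfl fun σ hσ => ?_
  rw [SingularCube.IsSmooth.integral_add_smul (hc σ hσ) hη hθ]
  ring

/-- Stokes' theorem for smooth singular chains. -/
lemma IsSmooth.integral_d [IsManifold I ∞ M] {c : CubeChain (k + 1) M} (hc : IsSmooth I c)
    {η : DForm I M k} (hη : DForm.IsSmooth I η) (hdη : DForm.IsSmooth I (DForm.d I η)) :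
    integral I (DForm.d I η) c = integral I η (boundary c) := by
  rw [integral_eq_linearCombination η, boundary, map_finsuppSum, integral]
  refine Finset.sum_congr rfl fun σ hσ => ?_
  beta_reduce
  rw [SingularCube.IsSmooth.integral_d (hc σ hσ) hη hdη, map_sum, Finset.mul_sum]
  refine Finset.sum_congr rfl fun i _ => ?_
  simp only [map_smul, map_sub, Finsupp.linearCombination_single, smul_eq_mul, one_mul]
  ring

end CubeChain

end ChainIntegral

/-! ### Periods of $dt\wedge\Omega$ on the cylinder -/

section CylinderIntegral

variable {N : Type*} [TopologicalSpace N] [ChartedSpace (EuclideanSpace ℝ (Fin 6)) N] {k : ℕ}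

lemma SingularCube.IsSmooth.integral_cylForm_slice {τ : SingularCube k N}
    (hτ : SingularCube.IsSmooth (𝓡 6) τ) (g : ℝ → ℝ) (η : DForm (𝓡 6) N k) (t : Icc (0 : ℝ) 1) :
    SingularCube.integral cylModel (cylForm g η) (fun x => slice t (τ x)) =
      g t * SingularCube.integral (𝓡 6) η τ := by
  rw [SingularCube.integral_eq, SingularCube.integral_eq, ← integral_const_mul]
  refine setIntegral_congr_fun measurableSet_Icc fun x hx => ?_
  have h1 := mfderiv_comp_mfderivWithin (I := 𝓘(ℝ, Fin k → ℝ)) (I' := 𝓡 6) (I'' := cylModel)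
    (g := slice t) (f := SingularCube.extend τ) (s := Icc 0 1) x
    ((mdifferentiableAt_id (I := 𝓡 6)).prodMk mdifferentiableAt_const)
    (hτ.mdifferentiableWithinAt hx) (uniqueMDiffWithinAt_Icc_zero_one_pi hx)
  have h2 : ∀ v : Fin k → ℝ, mfderivWithin 𝓘(ℝ, Fin k → ℝ) cylModel
      (SingularCube.extend fun x => slice t (τ x)) (Icc 0 1) x v =
      ((mfderivWithin 𝓘(ℝ, Fin k → ℝ) (𝓡 6) (SingularCube.extend τ) (Icc 0 1) x v, 0) :
        EuclideanSpace ℝ (Fin 6) × EuclideanSpace ℝ (Fin 1)) := fun v =>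
    (DFunLike.congr_fun h1 v).trans (mfderiv_slice t _ _)
  refine Eq.trans (congrArg (cylForm g η (slice t (SingularCube.extend τ x)))
    (funext fun i => h2 (Pi.single i 1))) ?_
  exact cylForm_apply_inl g η _ _

lemma CubeChain.IsSmooth.integral_cylForm_map_slice {S : CubeChain k N}
    (hS : CubeChain.IsSmooth (𝓡 6) S) (g : ℝ → ℝ) (η : DForm (𝓡 6) N k) (t : Icc (0 : ℝ) 1) :
    CubeChain.integral cylModel (cylForm g η) (CubeChain.map (slice t) S) =
      g t * CubeChain.integral (𝓡 6) η S := by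
  rw [CubeChain.integral_eq_linearCombination, CubeChain.map, Finsupp.linearCombination_mapDomain,
    Finsupp.linearCombination_apply, CubeChain.integral, Finsupp.sum, Finsupp.sum, Finset.mul_sum]
  refine Finset.sum_congr rfl fun τ hτ => ?_
  rw [Function.comp_apply, SingularCube.IsSmooth.integral_cylForm_slice (hS τ hτ), smul_eq_mul]
  ring

/-- If `∂W = S₁ × {1} - S₀ × {0}`, the integral of `dt ∧ Ω` over `W` is the integral of the closed
form `Ω` over `S₁`. -/
lemma integral_cylFormWedge_one [IsManifold (𝓡 6) ∞ N] {Ω : DForm (𝓡 6) N k}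
    (hΩ : DForm.IsSmooth (𝓡 6) Ω) (hΩd : DForm.IsClosed (𝓡 6) Ω) {S₀ S₁ : CubeChain k N}
    {W : CubeChain (k + 1) (N × Icc (0 : ℝ) 1)} (hS₀ : CubeChain.IsSmooth (𝓡 6) S₀)
    (hS₁ : CubeChain.IsSmooth (𝓡 6) S₁) (hW : CubeChain.IsSmooth cylModel W)
    (h : CubeChain.Equiv (CubeChain.boundary W)
        (CubeChain.map (slice 1) S₁ - CubeChain.map (slice 0) S₀)) :
    CubeChain.integral cylModel (cylFormWedge (fun _ => 1) Ω) W =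
      CubeChain.integral (𝓡 6) Ω S₁ := by
  have : IsManifold (𝓡 6) 1 N := IsManifold.of_le (n := ∞) (by simp)
  -- The primitive $t\,\Omega$ vanishes on the slice $t=0$ and is $\Omega$ on the slice $t=1$, so in
  -- Stokes' theorem only $S_1$ contributes.
  have hd : DForm.d cylModel (cylForm (fun t => t) Ω) = cylFormWedge (fun _ => 1) Ω := by
    rw [d_cylForm contDiff_fun_id hΩ, DForm.isClosed_iff.1 hΩd, cylForm_zero, add_zero]
    congr 1
    funext t
    simp
  have hs : DForm.IsSmooth cylModel (cylFormWedge (fun _ => 1) Ω) :=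
    isSmooth_cylFormWedge contDiff_const hΩ
  rw [← hd, hW.integral_d (isSmooth_cylForm contDiff_fun_id hΩ) (hd ▸ hs), h.integral_eq,
    CubeChain.integral_eq_linearCombination, map_sub, ← CubeChain.integral_eq_linearCombination,
    ← CubeChain.integral_eq_linearCombination, hS₁.integral_cylForm_map_slice,
    hS₀.integral_cylForm_map_slice]
  simp

end CylinderIntegral

end

theorem lemma3 {N : Type*} [TopologicalSpace N] [ChartedSpace (EuclideanSpace ℝ (Fin 6)) N]
    [IsManifold (𝓡 6) ∞ N] [CompactSpace N] [T2Space N]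
    (o : ManifoldOrientation (𝓡 6) N 6)
    (Ω : DForm (𝓡 6) N 2) (hΩ : DForm.IsSymplectic (𝓡 6) Ω)
    (ρ₀ ρ₁ : DForm (𝓡 6) N 3)
    (hpath : ∃ ρ : Icc (0 : ℝ) 1 → DForm (𝓡 6) N 3,
      DForm.IsContinuousPath (𝓡 6) ρ ∧ ρ 0 = ρ₀ ∧ ρ 1 = ρ₁ ∧
      ∀ t, IsClosedSL3Structure (ρ t) ∧ DForm.Cohomologous (𝓡 6) (ρ 0) (ρ t) ∧
        IsTamedBy o (ρ t) Ω) :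
    (∃ φ : DForm cylModel (N × Icc (0 : ℝ) 1) 3, IsClosedG2Cobordism o ρ₀ ρ₁ φ) ∧
    ∀ (S₀ S₁ : CubeChain 2 N) (W : CubeChain 3 (N × Icc (0 : ℝ) 1)),
      CubeChain.IsSmooth (𝓡 6) S₀ → CubeChain.IsCycle S₀ →
      CubeChain.IsSmooth (𝓡 6) S₁ → CubeChain.IsCycle S₁ →
      CubeChain.IsSmooth cylModel W →
      CubeChain.Equiv (CubeChain.boundary W)
        (CubeChain.map (slice 1) S₁ - CubeChain.map (slice 0) S₀) →
      0 < CubeChain.integral (𝓡 6) Ω S₁ →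
      ∃ κ₀ : ℝ, ∀ κ : ℝ, κ₀ ≤ κ → ∃ φ : DForm cylModel (N × Icc (0 : ℝ) 1) 3,
        IsClosedG2Cobordism o ρ₀ ρ₁ φ ∧ CubeChain.integral cylModel φ W = κ := by
  have : IsManifold (𝓡 6) 1 N := IsManifold.of_le (n := ∞) (by simp)
  obtain ⟨ρ, hρ, rfl, rfl, h⟩ := hpath
  obtain ⟨φ, K₀, hφ, hK₀⟩ := exists_stepForm_isClosedG2Cobordism o hΩ.1 hΩ.2.1 hρ h
  refine ⟨⟨_, hK₀ K₀ le_rfl⟩, ?_⟩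
  intro S₀ S₁ W hS₀ _ hS₁ _ hW hbd hpos
  set A := CubeChain.integral (𝓡 6) Ω S₁ with hA
  set B := CubeChain.integral cylModel φ W with hB
  -- The integral over $W$ with parameter $K$ is $B+KA$ with $A>0$; solving $B+KA=\kappa$ gives
  -- $K\ge K_0$ exactly when $\kappa\ge B+K_0A$.
  refine ⟨B + K₀ * A, fun κ hκ => ⟨_, hK₀ ((κ - B) / A) ?_, ?_⟩⟩
  · rw [ge_iff_le, le_div_iff₀ hpos]
    linarith
  · rw [hW.integral_add_smul hφ (isSmooth_cylFormWedge contDiff_const hΩ.1),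
      integral_cylFormWedge_one hΩ.1 hΩ.2.1 hS₀ hS₁ hW hbd, ← hA, ← hB,
      div_mul_cancel₀ _ hpos.ne', add_sub_cancel]
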